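/- Let $(\lambda_n)_{n\in\mathbb Z}$, $(\alpha_n)_{n\in\mathbb Z}$ be real numbers with $\lambda_n=n+\epsilon_n$, $\alpha_n=\pi+\tau_n$, $\{\epsilon_n\},\{\tau_n\}\in\ell_2$ and $\alpha_n>0$ for all $n$. Put $$B=\begin{pmatrix}0&1\\-1&0\end{pmatrix},\qquad \varphi_0(x,\lambda)=\begin{pmatrix}\sin\lambda x\\-\cos\lambda x\end{pmatrix}\quad(\lambda\in\mathbb C).$$ Then for every $x\in[0,\pi]$ the series $$F(x,t)=\sum_{n=-\infty}^{\infty}\Big[\tfrac1{\alpha_n}\varphi_0(x,\lambda_n)\varphi_0(t,\lambda_n)^{T}-\tfrac1\pi\varphi_0(x,n)\varphi_0(t,n)^{T}\Big]$$ (limit of the symmetric partial sums $\sum_{|n|\le N}$) converges in $L_2(0,\pi)$ as a function of $t$, and its sum $F$ can be taken to be a Borel function of $(x,t)$. Let $K(x,t)$ be a real $2\times2$ matrix function such that for every $x\in(0,\pi)$ the entries of $K(x,\cdot)$ are in $L_2(0,x)$ and $K$ satisfies the main equation $$F(x,t)+K(x,t)+\int_0^xK(x,\xi)F(\xi,t)\,d\xi=0\qquad\text{for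 a.e. }t\in(0,x),$$ and set $$\varphi(x,\lambda)=\varphi_0(x,\lambda)+\int_0^xK(x,t)\varphi_0(t,\lambda)\,dt .$$ Then: 1. The function $\Omega(x)=K(x,x)B-BK(x,x)$ exists for a.e. $x\in(0,\pi)$, where the value on the diagonal is understood as $$\Omega(x)=\lim_{h\downarrow0}\frac1h\int_{x-h}^x\big[K(x,t)B-BK(x,t)\big]dt$$ (this is the ordinary value whenever $K(x,\cdot)$ is continuous on $[0,x]$). It has the form $\Omega=\begin{pmatrix}p&q\\q&-p\end{pmatrix}$ with real $p,q\in L_2(0,b)$ for every $b<\pi$. 2. For every $\lambda\in\mathbb C$ the function $\varphi(\cdot,\lambda)$ is absolutely continuous on $[0,b]$ for every $b<\pi$, and $$B\varphi'(x,\lambda)+\Omega(x)\varphi(x,\lambda)=\lambda\varphi(x,\lambda)\quad\text{for a.e. }x\in(0,\pi),\qquad \varphi_1(0,\lambda)=0,\quad\varphi_2(0,\lambda)=-1.$$ 3. If moreover the $\lambda_n$ are pairwise distinct and the main equation holds, with $K(\pi,\cdot)\in L_2(0,\pi)$, also for $x=\pi$, then $p,q\in L_2(0,\pi)$ and $\varphi(\cdot,\lambda)$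 is absolutely continuous on $[0,\pi]$ for every $\lambda\in\mathbb C$. -/

import Mathlib

open MeasureTheory Filter Topology Set

noncomputable section

namespace DiracInverse

/-- The matrix `B` of the canonical Dirac system. -/
def B (R : Type) [Ring R] : Matrix (Fin 2) (Fin 2) R := !![0, 1; -1, 0]

/-- The Dirac potential with entries `p, q, q, -p`. -/
def potential (p q : ℝ → ℝ) (x : ℝ) : Matrix (Fin 2) (Fin 2) ℝ :=
  !![p x, q x; q x, -p x]

/-- The solution `(sin (l x), -cos (l x))` of the free system, for a real spectral parameter. -/
def freeSolReal (x l : ℝ) : Fin 2 → ℝ := ![Real.sin (l * x), -Real.cos (l * x)]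

/-- The solution `(sin (z x), -cos (z x))` of the free system, for a complex spectral parameter. -/
def freeSol (x : ℝ) (z : ℂ) : Fin 2 → ℂ := ![Complex.sin (z * x), -Complex.cos (z * x)]

/-- Symmetric partial sums of the series defining the kernel of the main equation. -/
def kernelPartialSum (lam alpha : ℤ → ℝ) (N : ℕ) (x t : ℝ) : Matrix (Fin 2) (Fin 2) ℝ :=
  ∑ n ∈ Finset.Icc (-(N : ℤ)) (N : ℤ),
    ((1 / alpha n) • Matrix.vecMulVec (freeSolReal x (lam n)) (freeSolReal t (lam n))
      - (1 / Real.pi) • Matrix.vecMulVec (freeSolReal x n) (freeSolReal t n))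

/-- `F` is the sum of the kernel series: it is Borel measurable in both variables, and for every
`x ∈ [0, π]` the symmetric partial sums converge to `F x` in `L²(0, π)`, entry by entry. This
determines `F x t` for every `x` and almost every `t`. -/
def IsMainKernel (lam alpha : ℤ → ℝ) (F : ℝ → ℝ → Matrix (Fin 2) (Fin 2) ℝ) : Prop :=
  (∀ i j, Measurable fun z : ℝ × ℝ => F z.1 z.2 i j) ∧
  ∀ x ∈ Icc 0 Real.pi, ∀ i j,
    Tendsto (fun N : ℕ => eLpNorm (fun t => kernelPartialSum lam alpha N x t i j - F x t i j) 2
      (volume.restrict (Ioo 0 Real.pi))) atTop (𝓝 0)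

/-- `K x` belongs to `L²(0, x)` and solves the main (Gelfand–Levitan–Marchenko type) equation
`F(x,t) + K(x,t) + ∫₀ˣ K(x,ξ) F(ξ,t) dξ = 0` on `0 < t < x`. -/
def SolvesMainEquation (F K : ℝ → ℝ → Matrix (Fin 2) (Fin 2) ℝ) (x : ℝ) : Prop :=
  ∀ i j, MemLp (fun t => K x t i j) 2 (volume.restrict (Ioo 0 x)) ∧
    ∀ᵐ t ∂(volume.restrict (Ioo 0 x)),
      F x t i j + K x t i j + ∫ ξ in (0 : ℝ)..x, (K x ξ * F ξ t) i j = 0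

/-- The function `φ = φ₀ + ∫₀ˣ K φ₀`. -/
def phi (K : ℝ → ℝ → Matrix (Fin 2) (Fin 2) ℝ) (x : ℝ) (z : ℂ) : Fin 2 → ℂ := fun i =>
  freeSol x z i
    + ∫ t in (0 : ℝ)..x, Matrix.mulVec ((K x t).map Complex.ofReal) (freeSol t z) i

/-- `M` is the value of the commutator `K B - B K` at the diagonal point `(x, x)`. Since `K x` is
only an element of `L²(0, x)`, the value is the limit of the means over `(x - h, x)`; it is
`K x x * B - B * K x x` whenever `K x` is continuous on `[0, x]`, `x > 0`. -/
def HasDiagonalCommutator (K : ℝ → ℝ → Matrix (Fin 2) (Fin 2) ℝ) (x : ℝ)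
    (M : Matrix (Fin 2) (Fin 2) ℝ) : Prop :=
  ∀ i j, Tendsto (fun h : ℝ => h⁻¹ * ∫ t in (x - h)..x, (K x t * B ℝ - B ℝ * K x t) i j)
    (𝓝[>] 0) (𝓝 (M i j))

end DiracInverse

end

/-! The main equation is solved exactly for kernels of finite rank, and the general case is a limit
of these. The limit is controlled by one coercivity estimate, uniform in `x`.

Coercivity. Testing the operator `1 + F` on a vector `v` of `L²((0, π), ℝ²)` supported in `(0, b)`
gives `‖v‖² + ∑ (⟪v, φ₀(λₙ)⟫² / αₙ - ⟪v, φ₀(n)⟫² / π)`. Parseval's identity for the integer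
frequencies cancels `‖v‖²`, so what remains is `∑ ⟪v, φ₀(λₙ)⟫² / αₙ`. This is bounded below by a
multiple of `‖v‖²` as soon as the `λₙ` satisfy a lower frame bound on `(0, b)`. A compactness
argument (`exists_coercive`) reduces the frame bound to completeness. A vector function on `(0, π)`
is encoded as a scalar function on `(-π, π)`, its pairing with `φ₀(l)` becoming the Fourier integral
at `l`. Completeness holds if `∑ (λₙ - n)²` is small; in general finitely many frequencies are
replaced. A replacement either lengthens the interval a little, which is affordable for `b < π`
(`completeFreq_of_lt`), or divides out a zero of the Fourier integral, which needs no extra length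
but requires distinct frequencies (`completeFreq_pi`). This is why distinctness enters only at `x =
π`.

Finite rank. For a partial sum of the kernel the main equation is a matrix equation. Differentiating
it, and using how the Gram matrix commutes with the diagonal of frequencies
(`diagonal_mul_mainMat`), yields the Dirac system classically, with potential `K(x,x)B - BK(x,x)`
(`hasDerivAt_pertMat`, `hasDerivAt_finSol`).

Limit. By the addition theorems the kernel is built from an even function `c` and an odd function
`d`, evaluated at `x - t` and `x + t`; both are sums of series converging in `L²(-2π, 2π)`, obtained
by linearising in `λₙ - n` and `1/αₙ - 1/π`. Hence the rows of the partial sums converge in `L²(0,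
π)` uniformly in `x`, and coercivity makes the solutions converge uniformly as well
(`exists_uniform_approx`). In the commutator with `B` the terms in `x - t` cancel, so the potentials
are `c(2x)` or `-d(2x)` plus continuous terms and converge in `L²` (`exists_approx_potential`). One
can then pass to the limit in the integrated Dirac system (`phi_eq_integral`); absolute continuity
and the equation almost everywhere follow. The diagonal means converge at the points where the
primitives of `c` and `d` are differentiable at `2x` with the right derivative. -/

noncomputable section

namespace DiracInverse

/-! ### Fourier integrals of compactly supported square integrable functions -/

/-- The exponential `exp (-i l t)`. -/
def expKernel (l t : ℝ) : ℂ := Complex.exp (((-(l * t) : ℝ) : ℂ) * Complex.I)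

/-- The Fourier integral `∫ g(t) exp (-i l t) dt`. -/
def fourierInt (g : ℝ → ℂ) (l : ℝ) : ℂ := ∫ t, g t * expKernel l t

/-- Square integrable functions vanishing outside `(-r, r)`. -/
def BandSupp (r : ℝ) (g : ℝ → ℂ) : Prop := MemLp g 2 volume ∧ ∀ t, r ≤ |t| → g t = 0

lemma norm_expKernel (l t : ℝ) : ‖expKernel l t‖ = 1 := Complex.norm_exp_ofReal_mul_I _

@[fun_prop]
lemma continuous_expKernel_left (t : ℝ) : Continuous fun l => expKernel l t := by
  unfold expKernel; fun_prop

@[fun_prop]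
lemma continuous_expKernel_right (l : ℝ) : Continuous fun t => expKernel l t := by
  unfold expKernel; fun_prop

lemma expKernel_add_right (l s t : ℝ) : expKernel l (s + t) = expKernel l s * expKernel l t := by
  unfold expKernel
  rw [← Complex.exp_add]; push_cast; ring_nf

lemma expKernel_add_left (l m t : ℝ) : expKernel (l + m) t = expKernel l t * expKernel m t := by
  unfold expKernel
  rw [← Complex.exp_add]; push_cast; ring_nf

lemma norm_expKernel_sub_le (l m t : ℝ) : ‖expKernel l t - expKernel m t‖ ≤ |l - m| * |t| := by
  have h : expKernel l t - expKernel m t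
      = expKernel m t * (Complex.exp (Complex.I * ((-((l - m) * t) : ℝ) : ℂ)) - 1) := by
    have : expKernel l t = expKernel m t * expKernel (l - m) t := by
      rw [← expKernel_add_left]; ring_nf
    rw [this, mul_sub, mul_one, expKernel, expKernel, mul_comm Complex.I]
  rw [h, norm_mul, norm_expKernel, one_mul]
  refine Real.norm_exp_I_mul_ofReal_sub_one_le.trans ?_
  rw [Real.norm_eq_abs, abs_neg, abs_mul]

lemma hasDerivAt_expKernel_left (l t : ℝ) :
    HasDerivAt (fun l => expKernel l t) (expKernel l t * (-(t : ℂ) * Complex.I)) l := by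
  unfold expKernel
  have h : HasDerivAt (fun l : ℝ => ((-(l * t) : ℝ) : ℂ) * Complex.I)
      (((-(1 * t) : ℝ) : ℂ) * Complex.I) l :=
    (((hasDerivAt_id l).mul_const t).neg.ofReal_comp).mul_const _
  convert h.cexp using 1
  push_cast; ring

lemma hasDerivAt_expKernel_right (l t : ℝ) :
    HasDerivAt (fun t => expKernel l t) (expKernel l t * (-(l : ℂ) * Complex.I)) t := by
  have h := hasDerivAt_expKernel_left t l
  have e : ∀ a b : ℝ, expKernel a b = expKernel b a := fun a b => by
    unfold expKernel; rw [mul_comm a b]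
  simpa only [e _ l, e t l] using h

/-- Cauchy–Schwarz for real square integrable functions. -/
lemma sq_integral_mul_le {α : Type*} [MeasurableSpace α] {μ : Measure α} {f g : α → ℝ}
    (hf : MemLp f 2 μ) (hg : MemLp g 2 μ) :
    (∫ x, f x * g x ∂μ) ^ 2 ≤ (∫ x, f x ^ 2 ∂μ) * ∫ x, g x ^ 2 ∂μ := by
  have key : ∀ {u v : α → ℝ} (hu : MemLp u 2 μ) (hv : MemLp v 2 μ),
      inner ℝ hu.toLp hv.toLp = ∫ x, u x * v x ∂μ := by
    intro u v hu hv
    rw [L2.inner_def]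
    refine integral_congr_ae ?_
    filter_upwards [hu.coeFn_toLp, hv.coeFn_toLp] with x h1 h2
    simp [h1, h2, mul_comm]
  have := real_inner_mul_inner_self_le hf.toLp hg.toLp
  rw [key, key, key] at this
  simpa only [sq] using this

lemma BandSupp.mono {r s : ℝ} {g : ℝ → ℂ} (h : BandSupp r g) (hrs : r ≤ s) : BandSupp s g :=
  ⟨h.1, fun t ht => h.2 t (hrs.trans ht)⟩

lemma BandSupp.integrable {r : ℝ} {g : ℝ → ℂ} (h : BandSupp r g) : Integrable g := by
  have h1 : Integrable g (volume.restrict (Icc (-r) r)) :=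
    (h.1.restrict (Icc (-r) r)).integrable (by norm_num)
  refine IntegrableOn.integrable_of_forall_notMem_eq_zero h1 fun t ht => h.2 t ?_
  by_contra hlt
  exact ht ⟨(abs_lt.1 (not_le.1 hlt)).1.le, (abs_lt.1 (not_le.1 hlt)).2.le⟩

lemma integrable_mul_expKernel {g : ℝ → ℂ} (h : Integrable g) (l : ℝ) :
    Integrable fun t => g t * expKernel l t :=
  h.mul_bdd (c := 1) (continuous_expKernel_right l).aestronglyMeasurable
    (ae_of_all _ fun t => (norm_expKernel l t).le)

lemma continuous_fourierInt {g : ℝ → ℂ} (h : Integrable g) : Continuous (fourierInt g) := by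
  refine continuous_of_dominated (bound := fun t => ‖g t‖)
    (fun l => (integrable_mul_expKernel h l).aestronglyMeasurable) ?_ h.norm ?_
  · exact fun l => ae_of_all _ fun t => by rw [norm_mul, norm_expKernel, mul_one]
  · exact ae_of_all _ fun t => by fun_prop

lemma fourierInt_add {g h : ℝ → ℂ} (hg : Integrable g) (hh : Integrable h) (l : ℝ) :
    fourierInt (fun t => g t + h t) l = fourierInt g l + fourierInt h l := by
  unfold fourierInt
  rw [← integral_add (integrable_mul_expKernel hg l) (integrable_mul_expKernel hh l)]
  simp only [add_mul]

lemma fourierInt_const_mul {g : ℝ → ℂ} (c : ℂ) (l : ℝ) :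
    fourierInt (fun t => c * g t) l = c * fourierInt g l := by
  unfold fourierInt
  rw [← integral_const_mul]
  simp only [mul_assoc]

lemma fourierInt_shift {g : ℝ → ℂ} (d l : ℝ) :
    fourierInt (fun t => g (t - d)) l = expKernel l d * fourierInt g l := by
  unfold fourierInt
  rw [← integral_const_mul,
    ← integral_sub_right_eq_self (fun t => expKernel l d * (g t * expKernel l t)) d]
  congr 1; ext t
  have : expKernel l t = expKernel l d * expKernel l (t - d) := by
    rw [← expKernel_add_right]; ring_nf
  rw [this]; ring

lemma BandSupp.setIntegral {r : ℝ} (hr : 0 < r) {g : ℝ → ℂ} (h : BandSupp r g) (w : ℝ → ℂ) :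
    ∫ t, g t * w t = ∫ t in (-r)..r, g t * w t := by
  rw [intervalIntegral.integral_of_le (by linarith), setIntegral_eq_integral_of_forall_compl_eq_zero]
  intro t ht
  rw [h.2 t, zero_mul]
  by_contra hlt
  exact ht ⟨(abs_lt.1 (not_le.1 hlt)).1, (abs_lt.1 (not_le.1 hlt)).2.le⟩

/-- Parseval's identity. -/
lemma BandSupp.hasSum_sq_fourierInt {g : ℝ → ℂ} (h : BandSupp Real.pi g) :
    HasSum (fun n : ℤ => ‖fourierInt g n‖ ^ 2) (2 * Real.pi * ∫ t, ‖g t‖ ^ 2) := by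
  have hab : -Real.pi < Real.pi := by linarith [Real.pi_pos]
  have h1 := (hasSum_sq_fourierCoeffOn hab (h.1.restrict _)).mul_left ((2 * Real.pi) ^ 2)
  have hint : ∫ t in (-Real.pi)..Real.pi, ‖g t‖ ^ 2 = ∫ t, ‖g t‖ ^ 2 := by
    rw [intervalIntegral.integral_of_le hab.le, setIntegral_eq_integral_of_forall_compl_eq_zero]
    intro t ht
    rw [h.2 t, norm_zero]; · norm_num
    by_contra hlt
    exact ht ⟨(abs_lt.1 (not_le.1 hlt)).1, (abs_lt.1 (not_le.1 hlt)).2.le⟩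
  rw [hint] at h1
  have hpi := Real.pi_ne_zero
  have e1 : ∀ n : ℤ, ‖fourierInt g n‖ ^ 2 = (2 * Real.pi) ^ 2 * ‖fourierCoeffOn hab g n‖ ^ 2 := by
    intro n
    rw [fourierCoeffOn_eq_integral, fourierInt, h.setIntegral Real.pi_pos, norm_smul]
    have e : ∀ t : ℝ, fourier (-n) (t : AddCircle (Real.pi - -Real.pi)) • g t
        = g t * expKernel n t := by
      intro t
      rw [fourier_coe_apply, smul_eq_mul, mul_comm, expKernel]
      congr 2
      have : (Real.pi : ℂ) ≠ 0 := by exact_mod_cast Real.pi_ne_zero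
      push_cast
      field_simp
      ring
    simp only [e]
    rw [show Real.pi - -Real.pi = 2 * Real.pi by ring, ← mul_pow, ← mul_assoc, Real.norm_eq_abs,
      abs_of_pos (by have := Real.pi_pos; positivity), mul_one_div_cancel (by simp),
      one_mul]
  have e2 : (2 * Real.pi) ^ 2 * (Real.pi - -Real.pi)⁻¹ • ∫ t, ‖g t‖ ^ 2
      = 2 * Real.pi * ∫ t, ‖g t‖ ^ 2 := by
    rw [show Real.pi - -Real.pi = 2 * Real.pi by ring, smul_eq_mul]
    field_simp
  rw [e2] at h1
  simpa only [e1] using h1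

lemma BandSupp.integrable_sq {r : ℝ} {g : ℝ → ℂ} (h : BandSupp r g) :
    Integrable fun t => ‖g t‖ ^ 2 :=
  (memLp_two_iff_integrable_sq_norm h.1.1).1 h.1

/-- On the support the two exponentials differ by at most `|l - m| π`; Cauchy–Schwarz on an interval
of length `2π` turns the square of this into the constant `2π · π²`. -/
lemma BandSupp.sq_norm_fourierInt_sub_le {g : ℝ → ℂ} (h : BandSupp Real.pi g) (l m : ℝ) :
    ‖fourierInt g l - fourierInt g m‖ ^ 2
      ≤ (l - m) ^ 2 * (2 * Real.pi ^ 3) * ∫ t, ‖g t‖ ^ 2 := by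
  have hab : -Real.pi ≤ Real.pi := by linarith [Real.pi_pos]
  have e : fourierInt g l - fourierInt g m
      = ∫ t in Ioc (-Real.pi) Real.pi, g t * (expKernel l t - expKernel m t) := by
    rw [← intervalIntegral.integral_of_le hab, ← h.setIntegral Real.pi_pos, fourierInt, fourierInt,
      ← integral_sub (integrable_mul_expKernel h.integrable l)
        (integrable_mul_expKernel h.integrable m)]
    simp only [mul_sub]
  have h1 : ‖fourierInt g l - fourierInt g m‖
      ≤ ∫ t in Ioc (-Real.pi) Real.pi, ‖g t‖ * (|l - m| * Real.pi) := by
    rw [e]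
    refine norm_integral_le_of_norm_le ((h.integrable.norm.mul_const _).restrict) ?_
    filter_upwards [ae_restrict_mem measurableSet_Ioc] with t ht
    rw [norm_mul]
    refine mul_le_mul_of_nonneg_left ((norm_expKernel_sub_le l m t).trans ?_) (norm_nonneg _)
    exact mul_le_mul_of_nonneg_left (abs_le.2 ⟨ht.1.le, ht.2⟩) (abs_nonneg _)
  have h2 := sq_integral_mul_le (μ := volume.restrict (Ioc (-Real.pi) Real.pi))
    (h.1.norm.restrict _) (memLp_const (|l - m| * Real.pi))
  have h3 : ∫ t in Ioc (-Real.pi) Real.pi, ‖g t‖ ^ 2 ≤ ∫ t, ‖g t‖ ^ 2 :=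
    setIntegral_le_integral h.integrable_sq (ae_of_all _ fun t => by positivity)
  refine (pow_le_pow_left₀ (norm_nonneg _) h1 2).trans (h2.trans ?_)
  rw [setIntegral_const, Measure.real, Real.volume_Ioc,
    ENNReal.toReal_ofReal (by linarith [Real.pi_pos]), mul_pow, sq_abs, smul_eq_mul]
  have h4 : (0 : ℝ) ≤ (l - m) ^ 2 * (2 * Real.pi ^ 3) := by have := Real.pi_pos; positivity
  nlinarith [mul_le_mul_of_nonneg_right h3 h4]

/-- A system of frequencies close to the integers is complete. -/
lemma BandSupp.fourierInt_eq_zero_of_near {g : ℝ → ℂ} (h : BandSupp Real.pi g) {ν : ℤ → ℝ}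
    {s : ℝ} (hν : HasSum (fun n => (ν n - n) ^ 2) s) (hs : s < 1 / Real.pi ^ 2)
    (hz : ∀ n, fourierInt g (ν n) = 0) (l : ℝ) : fourierInt g l = 0 := by
  have hpi := Real.pi_pos
  have h1 := h.hasSum_sq_fourierInt
  set J := ∫ t, ‖g t‖ ^ 2 with hJ
  have hJ0 : 0 ≤ J := integral_nonneg fun t => by positivity
  have h2 := (hν.mul_right (2 * Real.pi ^ 3)).mul_right J
  -- Since the transform vanishes at `ν n`, Parseval reads `2π J = ∑ |ĝ(n) - ĝ(ν n)|² ≤ s · 2π³ ·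
  -- J`, and `s < 1/π²` leaves only `J = 0`.
  have h3 := hasSum_le (fun n : ℤ => by
    have := h.sq_norm_fourierInt_sub_le (ν n) n
    rwa [hz n, zero_sub, norm_neg] at this) h1 h2
  have h4 : J = 0 := by
    by_contra hne
    have hJp : 0 < J := lt_of_le_of_ne hJ0 (Ne.symm hne)
    have : s * (2 * Real.pi ^ 3) < 2 * Real.pi := by
      rw [lt_div_iff₀ (by positivity)] at hs
      nlinarith
    nlinarith
  have h5 : (fun t => ‖g t‖ ^ 2) =ᵐ[volume] 0 :=
    (integral_eq_zero_iff_of_nonneg (fun t => by positivity) h.integrable_sq).1 h4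
  unfold fourierInt
  refine integral_eq_zero_of_ae ?_
  filter_upwards [h5] with t ht
  have : g t = 0 := by simpa using ht
  simp [this]

/-- The zeros of `m` are simple, hence isolated, and continuity of `u` fills the gaps. This is what
allows a multiplier to be divided out of an identity between Fourier integrals. -/
lemma eq_zero_of_mul_eq_zero_of_hasDerivAt {u m m' : ℝ → ℂ} (hu : Continuous u)
    (hm : ∀ l, HasDerivAt m (m' l) l) (hm' : ∀ l, m' l ≠ 0) (h : ∀ l, m l * u l = 0) (l : ℝ) :
    u l = 0 := by
  have h1 : ∀ᶠ z in 𝓝[≠] l, u z = 0 := by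
    filter_upwards [(hm l).eventually_ne (c := 0) (hm' l)] with z hz
    exact (mul_eq_zero.1 (h z)).resolve_left hz
  have h2 : Tendsto u (𝓝[≠] l) (𝓝 (u l)) := hu.continuousAt.tendsto.mono_left nhdsWithin_le_nhds
  exact tendsto_nhds_unique (h2.congr' h1) tendsto_const_nhds |>.symm ▸ rfl

/-- The frequencies `μ` are complete for the functions supported in `(-r, r)`. -/
def CompleteFreq (r : ℝ) (μ : ℤ → ℝ) : Prop :=
  ∀ g, BandSupp r g → (∀ n, fourierInt g (μ n) = 0) → ∀ l, fourierInt g l = 0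

/-- The function `g(t - d) - exp(-iνd) g(t)` has transform `(exp(-ild) - exp(-iνd)) ĝ(l)`. It
acquires the zero `ν` and keeps every zero of `ĝ`, at the price of a support longer by `d`. -/
lemma CompleteFreq.of_update_of_lt {r d : ℝ} (hd : 0 < d) {μ : ℤ → ℝ} {m : ℤ} {ν : ℝ}
    (h : CompleteFreq (r + d) (Function.update μ m ν)) : CompleteFreq r μ := by
  intro g hg hz
  have hg1 : BandSupp (r + d) fun t => g (t - d) := by
    refine ⟨hg.1.comp_measurePreserving (measurePreserving_sub_right volume d), fun t ht => ?_⟩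
    refine hg.2 _ ?_
    have := abs_sub_abs_le_abs_sub t d
    rw [abs_of_pos hd] at this
    linarith
  set g' : ℝ → ℂ := fun t => g (t - d) + -expKernel ν d * g t with hg'
  have hb : BandSupp (r + d) g' := by
    refine ⟨hg1.1.add (hg.1.const_mul _), fun t ht => ?_⟩
    simp only [hg', hg1.2 t ht, hg.2 t (by linarith), mul_zero, add_zero]
  have hft : ∀ l, fourierInt g' l = (expKernel l d - expKernel ν d) * fourierInt g l := by
    intro l
    rw [hg', fourierInt_add hg1.integrable (hg.integrable.const_mul _), fourierInt_shift,
      fourierInt_const_mul]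
    ring
  have h0 := h g' hb fun n => by
    rw [hft]
    by_cases hn : n = m
    · subst hn; simp
    · rw [Function.update_of_ne hn, hz, mul_zero]
  refine eq_zero_of_mul_eq_zero_of_hasDerivAt (m := fun l => expKernel l d - expKernel ν d)
    (continuous_fourierInt hg.integrable) (fun l => (hasDerivAt_expKernel_left l d).sub_const _)
    (fun l => ?_) fun l => by rw [← hft, h0]
  have : expKernel l d ≠ 0 := by rw [← norm_ne_zero_iff, norm_expKernel]; norm_num
  have hd' : (d : ℂ) ≠ 0 := by exact_mod_cast hd.ne'
  simp [this, hd']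

/-! ### Absolutely continuous functions with values in a normed space -/

lemma absolutelyContinuousOnInterval_of_dist_le {X Y : Type*} [PseudoMetricSpace X]
    [PseudoMetricSpace Y] {f : ℝ → X} {G : ℝ → Y} {a b : ℝ}
    (hG : AbsolutelyContinuousOnInterval G a b)
    (h : ∀ x ∈ uIcc a b, ∀ y ∈ uIcc a b, dist (f x) (f y) ≤ dist (G x) (G y)) :
    AbsolutelyContinuousOnInterval f a b := by
  rw [absolutelyContinuousOnInterval_iff] at hG ⊢
  intro ε hε
  obtain ⟨δ, hδ, H⟩ := hG ε hε
  refine ⟨δ, hδ, fun E hE hlen => (Finset.sum_le_sum fun i hi => ?_).trans_lt (H E hE hlen)⟩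
  obtain ⟨h1, -⟩ := hE
  have h2 := h1 i (by simpa using hi)
  exact h _ h2.1 _ h2.2

/-- Increments of the vector integral are dominated by increments of the integral of the norm, so
the scalar case suffices. -/
lemma absolutelyContinuousOnInterval_integral {E : Type*} [NormedAddCommGroup E] [NormedSpace ℝ E]
    {f : ℝ → E} {a b : ℝ} (hf : IntervalIntegrable f volume a b) :
    AbsolutelyContinuousOnInterval (fun x => ∫ t in a..x, f t) a b := by
  have hG := hf.norm.absolutelyContinuousOnInterval_intervalIntegral (left_mem_uIcc)
  refine absolutelyContinuousOnInterval_of_dist_le hG fun x hx y hy => ?_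
  have hs : ∀ z ∈ uIcc a b, IntervalIntegrable f volume a z := fun z hz =>
    hf.mono_set (uIcc_subset_uIcc left_mem_uIcc hz)
  rw [dist_eq_norm, Real.dist_eq, intervalIntegral.integral_interval_sub_left (hs x hx) (hs y hy),
    intervalIntegral.integral_interval_sub_left (hs x hx).norm (hs y hy).norm]
  exact intervalIntegral.norm_integral_le_abs_integral_norm

/-- Integration by parts for a merely integrable `u`: with `U` its primitive, `vU - ∫ (v'U + vu)` is
absolutely continuous with derivative zero almost everywhere, hence constant. -/
lemma integral_deriv_mul_primitive {u v v' : ℝ → ℂ} {a b : ℝ}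
    (hu : IntervalIntegrable u volume a b) (hv : ∀ t, HasDerivAt v (v' t) t) (hv' : Continuous v') :
    ∫ t in a..b, v' t * ∫ s in a..t, u s = v b * (∫ s in a..b, u s) - ∫ t in a..b, v t * u t := by
  have hvc : Continuous v := continuous_iff_continuousAt.2 fun t => (hv t).continuousAt
  set U : ℝ → ℂ := fun t => ∫ s in a..t, u s with hU
  have hUac : AbsolutelyContinuousOnInterval U a b := absolutelyContinuousOnInterval_integral hu
  have hvac : AbsolutelyContinuousOnInterval v a b := by
    refine ContDiffOn.absolutelyContinuousOnInterval (ContDiff.contDiffOn ?_)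
    refine contDiff_one_iff_deriv.2 ⟨fun t => (hv t).differentiableAt, ?_⟩
    rwa [show deriv v = v' from funext fun t => (hv t).deriv]
  have hi1 : IntervalIntegrable (fun t => v' t * U t) volume a b :=
    (hv'.continuousOn.mul hUac.continuousOn).intervalIntegrable
  have hi2 : IntervalIntegrable (fun t => v t * u t) volume a b :=
    hu.continuousOn_mul hvc.continuousOn
  have hac := (hvac.smul hUac).sub (absolutelyContinuousOnInterval_integral (hi1.add hi2))
  obtain ⟨C, hC⟩ := hac.const_of_ae_hasDerivAt_zero (by
    filter_upwards [hu.ae_hasDerivAt_integral, (hi1.add hi2).ae_hasDerivAt_integral] with x h1 h2 hx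
    have h3 := ((hv x).mul (h1 hx a left_mem_uIcc)).sub (h2 hx a left_mem_uIcc)
    exact h3.congr_deriv (by simp only [hU]; ring))
  have ha := hC a left_mem_uIcc
  have hb := hC b right_mem_uIcc
  rw [← ha] at hb
  change v b * U b - ∫ t in a..b, (v' t * U t + v t * u t)
    = v a * U a - ∫ t in a..a, (v' t * U t + v t * u t) at hb
  have hUa : U a = 0 := intervalIntegral.integral_same
  rw [hUa, intervalIntegral.integral_same, mul_zero, sub_zero] at hb
  rw [intervalIntegral.integral_add hi1 hi2] at hb
  simp only [hU] at hb ⊢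
  linear_combination -hb

/-! ### Replacing a zero of a Fourier integral -/

/-- A zero of the transform can be divided out inside the class: take `h(t) = exp(iμt) ∫_{-r}^t g(s)
exp(-iμs) ds` and integrate by parts. -/
lemma BandSupp.exists_div {r : ℝ} (hr : 0 < r) {g : ℝ → ℂ} (hg : BandSupp r g) {μ : ℝ}
    (hμ : fourierInt g μ = 0) :
    ∃ h, BandSupp r h ∧ ∀ l, l ≠ μ → ((l - μ : ℝ) : ℂ) * Complex.I * fourierInt h l
      = fourierInt g l := by
  set u : ℝ → ℂ := fun s => g s * expKernel μ s with hu
  have hui : Integrable u := integrable_mul_expKernel hg.integrable μ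
  have hui' : ∀ a b, IntervalIntegrable u volume a b := fun a b => hui.intervalIntegrable
  set U : ℝ → ℂ := fun t => ∫ s in (-r)..t, u s with hU
  have hUc : Continuous U := intervalIntegral.continuous_primitive hui' _
  -- The condition `ĝ(μ) = 0` says that the primitive returns to zero at `r`. Hence cutting it off
  -- at `±r` creates no boundary term.
  have hend : ∫ s in (-r)..r, u s = 0 := by rw [← hμ, fourierInt, hg.setIntegral hr]
  refine ⟨(Ioo (-r) r).indicator fun t => expKernel (-μ) t * U t, ⟨?_, fun t ht => ?_⟩,
    fun l hl => ?_⟩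
  · rw [memLp_indicator_iff_restrict measurableSet_Ioo]
    have hc : Continuous fun t => expKernel (-μ) t * U t := by fun_prop
    obtain ⟨C, hC⟩ := isCompact_Icc.exists_bound_of_continuousOn (s := Icc (-r) r) hc.continuousOn
    refine MemLp.of_bound hc.aestronglyMeasurable C ?_
    filter_upwards [ae_restrict_mem measurableSet_Ioo] with t ht
    exact hC t ⟨ht.1.le, ht.2.le⟩
  · refine indicator_of_notMem (fun hm => ?_) _
    exact absurd (abs_lt.2 ⟨hm.1, hm.2⟩) (not_lt.2 ht)
  · have hne : ((l - μ : ℝ) : ℂ) ≠ 0 := by exact_mod_cast sub_ne_zero.2 hl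
    have e1 : fourierInt ((Ioo (-r) r).indicator fun t => expKernel (-μ) t * U t) l
        = ∫ t in (-r)..r, expKernel (l - μ) t * U t := by
      rw [intervalIntegral.integral_of_le (by linarith), integral_Ioc_eq_integral_Ioo,
        ← integral_indicator measurableSet_Ioo, fourierInt]
      congr 1; ext t
      by_cases ht : t ∈ Ioo (-r) r
      · rw [indicator_of_mem ht, indicator_of_mem ht, sub_eq_add_neg, expKernel_add_left]; ring
      · rw [indicator_of_notMem ht, indicator_of_notMem ht, zero_mul]
    have e2 := integral_deriv_mul_primitive (hui' (-r) r)
      (fun t => hasDerivAt_expKernel_right (l - μ) t) (by fun_prop)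
    have e3 : fourierInt g l = ∫ t in (-r)..r, expKernel (l - μ) t * u t := by
      rw [fourierInt, hg.setIntegral hr]
      congr 1; ext t
      have : expKernel l t = expKernel (l - μ) t * expKernel μ t := by
        rw [← expKernel_add_left]; ring_nf
      rw [hu, this]; ring
    rw [hend, mul_zero, zero_sub, ← e3] at e2
    rw [e1, ← intervalIntegral.integral_const_mul, ← neg_eq_iff_eq_neg.2 e2,
      ← intervalIntegral.integral_neg]
    congr 1; ext t
    simp only [hU]
    push_cast; ring

/-- Adding `i(μₘ - ν)` times the quotient by the zero `μₘ` multiplies the transform by `(l - ν)/(l -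
μₘ)`. The zero `μₘ` is exchanged for `ν` with no growth of the support; the zeros at the other `μₙ`
survive because they differ from `μₘ`. -/
lemma CompleteFreq.of_update_of_ne {r : ℝ} (hr : 0 < r) {μ : ℤ → ℝ} {m : ℤ} {ν : ℝ}
    (hμ : ∀ n, n ≠ m → μ n ≠ μ m) (h : CompleteFreq r (Function.update μ m ν)) :
    CompleteFreq r μ := by
  intro g hg hz
  obtain ⟨k, hk, hkl⟩ := hg.exists_div hr (hz m)
  set c : ℂ := ((μ m - ν : ℝ) : ℂ) * Complex.I with hc
  set g' : ℝ → ℂ := fun t => g t + c * k t with hg'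
  have hb : BandSupp r g' := by
    refine ⟨hg.1.add (hk.1.const_mul _), fun t ht => ?_⟩
    simp only [hg', hk.2 t ht, hg.2 t ht, mul_zero, add_zero]
  have hft : ∀ l, fourierInt g' l = fourierInt g l + c * fourierInt k l := by
    intro l
    rw [hg', fourierInt_add hg.integrable (hk.integrable.const_mul _), fourierInt_const_mul]
  have hft' : ∀ l, l ≠ μ m →
      ((l - μ m : ℝ) : ℂ) * fourierInt g' l = ((l - ν : ℝ) : ℂ) * fourierInt g l := by
    intro l hl
    rw [hft, hc, ← hkl l hl]; push_cast; ring
  have h0 : ∀ l, fourierInt g' l = 0 := by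
    by_cases hνm : ν = μ m
    -- If `ν = μ m`, then `c = 0` and `g'` has the same transform as `g`.
    · have : Function.update μ m ν = μ := by rw [hνm, Function.update_eq_self]
      rw [this] at h
      refine h g' hb fun n => ?_
      have : c = 0 := by rw [hc, hνm]; simp
      rw [hft, hz, this]; simp
    · refine h g' hb fun n => ?_
      by_cases hn : n = m
      · subst hn
        rw [Function.update_self]
        have h1 := hft' ν hνm
        have h2 : ((ν - μ n : ℝ) : ℂ) ≠ 0 := by exact_mod_cast sub_ne_zero.2 hνm
        simpa [h2, sub_eq_zero, hνm] using h1
      · rw [Function.update_of_ne hn]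
        have h1 := hft' (μ n) (hμ n hn)
        have h2 : ((μ n - μ m : ℝ) : ℂ) ≠ 0 := by exact_mod_cast sub_ne_zero.2 (hμ n hn)
        rw [hz, mul_zero] at h1
        exact (mul_eq_zero.1 h1).resolve_left h2
  refine eq_zero_of_mul_eq_zero_of_hasDerivAt (m := fun l => ((l - ν : ℝ) : ℂ)) (m' := fun _ => 1)
    (continuous_fourierInt hg.integrable) (fun l => ?_) (fun _ => one_ne_zero) fun l => ?_
  · simpa using ((hasDerivAt_id l).sub_const ν).ofReal_comp
  · by_cases hl : l = μ m
    · rw [hl, hz, mul_zero]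
    · rw [← hft' l hl, h0, mul_zero]

lemma hasSum_ite_mem {ι : Type*} [DecidableEq ι] {u : ι → ℝ} {U : ℝ} (hu : HasSum u U)
    (S : Finset ι) (v : ι → ℝ) :
    HasSum (fun n => if n ∈ S then v n else u n) (U - ∑ n ∈ S, u n + ∑ n ∈ S, v n) := by
  have h := hu.add (hasSum_sum_of_ne_finset_zero (s := S)
    (f := fun n => if n ∈ S then v n - u n else 0) fun n hn => if_neg hn)
  convert h using 1
  · ext n
    split_ifs <;> ring
  · rw [Finset.sum_congr rfl fun n hn => if_pos hn, Finset.sum_sub_distrib]; ring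

lemma exists_finset_sub_sum_lt {ι : Type*} {u : ι → ℝ} {U : ℝ} (hu : HasSum u U) {ε : ℝ}
    (hε : 0 < ε) : ∃ S : Finset ι, U - ∑ n ∈ S, u n < ε := by
  have h : ∀ᶠ S : Finset ι in atTop, U - ε < ∑ n ∈ S, u n :=
    hu.eventually (lt_mem_nhds (by linarith))
  obtain ⟨S, hS⟩ := h.exists
  exact ⟨S, by linarith⟩

/-- Frequencies square summably close to the integers are complete on shorter intervals. -/
theorem completeFreq_of_lt {lam : ℤ → ℝ} (hlam : Summable fun n : ℤ => (lam n - n) ^ 2) {r : ℝ}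
    (hr : r < Real.pi) : CompleteFreq r lam := by
  obtain ⟨U, hU⟩ := hlam
  have hpi := Real.pi_pos
  obtain ⟨S, hS⟩ := exists_finset_sub_sum_lt hU (ε := 1 / Real.pi ^ 2) (by positivity)
  -- The spare length `π - r` is shared among the `S.card` replacements; the `+ 1` keeps `d` well
  -- defined when `S` is empty.
  set d : ℝ := (Real.pi - r) / (S.card + 1) with hd
  have hd0 : 0 < d := div_pos (by linarith) (by positivity)
  have hdS : r + S.card * d ≤ Real.pi := by
    have : (S.card + 1) * d = Real.pi - r := by rw [hd]; field_simp
    linarith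
  -- The exceptional frequencies are moved to their integers one at a time, each move costing `d`.
  have step : ∀ T : Finset ℤ, CompleteFreq (r + T.card * d)
      (fun n => if n ∈ T then (n : ℝ) else lam n) → CompleteFreq r lam := by
    intro T
    induction T using Finset.induction_on with
    | empty => simp
    | insert m T hm ih =>
      intro h
      refine ih (CompleteFreq.of_update_of_lt (m := m) (ν := m) hd0 ?_)
      rw [Finset.card_insert_of_notMem hm] at h
      convert h using 1
      · push_cast; ring
      · ext n
        by_cases hn : n = m
        · subst hn; simp
        · simp [hn]
  refine step S fun g hg hz => ?_
  have hs := hasSum_ite_mem hU S fun _ => 0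
  rw [Finset.sum_const_zero, add_zero] at hs
  refine (hg.mono hdS).fourierInt_eq_zero_of_near ?_ hS hz
  convert hs using 1
  ext n
  split_ifs <;> simp

/-- Distinct frequencies square summably close to the integers are complete on `(-π, π)`. -/
theorem completeFreq_pi {lam : ℤ → ℝ} (hlam : Summable fun n : ℤ => (lam n - n) ^ 2)
    (hinj : Function.Injective lam) : CompleteFreq Real.pi lam := by
  obtain ⟨U, hU⟩ := hlam
  have hpi := Real.pi_pos
  obtain ⟨S, hS⟩ := exists_finset_sub_sum_lt hU (ε := 1 / Real.pi ^ 2) (by positivity)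
  -- The new frequencies are `n + η` instead of `n`, because a replacement must not meet any `lam
  -- m`. The forbidden `η` form a countable set, while the smallness condition is open and holds at
  -- `η = 0`.
  obtain ⟨η, hη, hη'⟩ : ∃ η : ℝ, U - ∑ n ∈ S, (lam n - n) ^ 2 + ∑ n ∈ S, η ^ 2 < 1 / Real.pi ^ 2 ∧
      ∀ n m : ℤ, n + η ≠ lam m := by
    have hopen : IsOpen {η : ℝ | U - ∑ n ∈ S, (lam n - n) ^ 2 + ∑ n ∈ S, η ^ 2 < 1 / Real.pi ^ 2} :=
      isOpen_lt (by fun_prop) continuous_const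
    have hcount : (range fun z : ℤ × ℤ => lam z.2 - z.1).Countable := countable_range _
    obtain ⟨η, h1, h2⟩ := (hcount.dense_compl ℝ).inter_open_nonempty _ hopen ⟨0, by simpa using hS⟩
    exact ⟨η, h1, fun n m h => h2 ⟨(n, m), by simp only; linarith⟩⟩
  have step : ∀ T : Finset ℤ, CompleteFreq Real.pi
      (fun n => if n ∈ T then (n : ℝ) + η else lam n) → CompleteFreq Real.pi lam := by
    intro T
    induction T using Finset.induction_on with
    | empty => simp
    | insert m T hm ih =>
      intro h
      refine ih (CompleteFreq.of_update_of_ne (m := m) (ν := m + η) hpi (fun n hn => ?_) ?_)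
      · simp only [hm, if_false]
        split_ifs
        · exact hη' _ _
        · exact fun hc => hn (hinj hc)
      · convert h using 1
        ext n
        by_cases hn : n = m
        · subst hn; simp
        · simp [hn]
  refine step S fun g hg hz => ?_
  have hs := hasSum_ite_mem hU S fun _ => η ^ 2
  refine hg.fourierInt_eq_zero_of_near ?_ hη hz
  convert hs using 1
  ext n
  split_ifs <;> simp

end DiracInverse
end

noncomputable section

namespace DiracInverse

open scoped InnerProductSpace

/-! ### Coercivity of completeness -/

/-- By contradiction and compactness: otherwise unit vectors in `S` have quadratic form tending to
zero. Along a subsequence the finitely many pairings with `w n`, `n ∈ T`, converge; the bound `hC`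
then makes the vectors Cauchy, and their limit is a unit vector in `S` orthogonal to every `e n`. -/
lemma exists_coercive {V : Type*} [NormedAddCommGroup V] [InnerProductSpace ℝ V] [CompleteSpace V]
    (S : Submodule ℝ V) (hS : IsClosed (S : Set V)) (e w : ℤ → V) (T : Finset ℤ)
    (hq : ∀ f : V, Summable fun n => ⟪f, e n⟫_ℝ ^ 2) (C : ℝ)
    (hC : ∀ f, ‖f‖ ^ 2 ≤ C * ((∑' n, ⟪f, e n⟫_ℝ ^ 2) + ∑ n ∈ T, ⟪f, w n⟫_ℝ ^ 2))
    (hinj : ∀ f ∈ S, (∀ n, ⟪f, e n⟫_ℝ = 0) → f = 0) :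
    ∃ δ > 0, ∀ f ∈ S, δ * ‖f‖ ^ 2 ≤ ∑' n, ⟪f, e n⟫_ℝ ^ 2 := by
  by_contra! hcon
  have hex : ∀ k : ℕ, ∃ g ∈ S, ‖g‖ = 1 ∧ ∑' n, ⟪g, e n⟫_ℝ ^ 2 ≤ 1 / ((k : ℝ) + 1) := by
    intro k
    obtain ⟨f, hf, hlt⟩ := hcon (1 / ((k : ℝ) + 1)) (by positivity)
    have hf0 : ‖f‖ ≠ 0 := by
      intro h0
      rw [h0] at hlt
      have : 0 ≤ ∑' n, ⟪f, e n⟫_ℝ ^ 2 := tsum_nonneg fun n => sq_nonneg _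
      linarith
    refine ⟨‖f‖⁻¹ • f, S.smul_mem _ hf, ?_, ?_⟩
    · rw [norm_smul, norm_inv, norm_norm, inv_mul_cancel₀ hf0]
    · simp only [real_inner_smul_left, mul_pow]
      rw [tsum_mul_left]
      calc ‖f‖⁻¹ ^ 2 * ∑' n, ⟪f, e n⟫_ℝ ^ 2 ≤ ‖f‖⁻¹ ^ 2 * (1 / ((k : ℝ) + 1) * ‖f‖ ^ 2) :=
            mul_le_mul_of_nonneg_left hlt.le (sq_nonneg _)
        _ = 1 / ((k : ℝ) + 1) := by field_simp
  choose g hgS hg1 hgq using hex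
  set L : ℕ → (T → ℝ) := fun k n => ⟪g k, w n⟫_ℝ with hL
  have hLb : ∀ k, L k ∈ Metric.closedBall (0 : T → ℝ) (∑ n ∈ T, ‖w n‖) := by
    intro k
    rw [mem_closedBall_zero_iff, pi_norm_le_iff_of_nonneg (Finset.sum_nonneg fun n _ => norm_nonneg _)]
    intro n
    refine (norm_inner_le_norm (𝕜 := ℝ) _ _).trans ?_
    rw [hg1, one_mul]
    exact Finset.single_le_sum (f := fun n => ‖w n‖) (fun n _ => norm_nonneg _) n.2
  obtain ⟨ℓ, -, φ, hφ, hlim⟩ := tendsto_subseq_of_bounded Metric.isBounded_closedBall hLb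
  have hq0 : Tendsto (fun k => ∑' n, ⟪g (φ k), e n⟫_ℝ ^ 2) atTop (𝓝 0) :=
    squeeze_zero (fun k => tsum_nonneg fun n => sq_nonneg _) (fun k => hgq (φ k))
      (tendsto_one_div_add_atTop_nhds_zero_nat.comp hφ.tendsto_atTop)
  have hCnn : 0 ≤ C := by
    by_contra hneg
    have h1 := hC (g 0)
    have h2 : 0 ≤ (∑' n, ⟪g 0, e n⟫_ℝ ^ 2) + ∑ n ∈ T, ⟪g 0, w n⟫_ℝ ^ 2 :=
      add_nonneg (tsum_nonneg fun n => sq_nonneg _) (Finset.sum_nonneg fun n _ => sq_nonneg _)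
    rw [hg1] at h1
    nlinarith
  have hcau : CauchySeq (g ∘ φ) := by
    rw [cauchySeq_iff_tendsto_dist_atTop_0]
    have hb : ∀ z : ℕ × ℕ, dist ((g ∘ φ) z.1) ((g ∘ φ) z.2) ^ 2
        ≤ C * ((2 * (∑' n, ⟪g (φ z.1), e n⟫_ℝ ^ 2) + 2 * ∑' n, ⟪g (φ z.2), e n⟫_ℝ ^ 2)
          + ∑ n : T, (L (φ z.1) n - L (φ z.2) n) ^ 2) := by
      intro z
      rw [dist_eq_norm]
      refine (hC _).trans (mul_le_mul_of_nonneg_left (add_le_add ?_ (le_of_eq ?_)) hCnn)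
      · rw [← tsum_mul_left, ← tsum_mul_left, ← ((hq _).mul_left 2).tsum_add ((hq _).mul_left 2)]
        refine (hq _).tsum_le_tsum (fun n => ?_) (((hq _).mul_left 2).add ((hq _).mul_left 2))
        simp only [Function.comp_apply, inner_sub_left]
        nlinarith [sq_nonneg (⟪g (φ z.1), e n⟫_ℝ + ⟪g (φ z.2), e n⟫_ℝ)]
      · simp only [Function.comp_apply, inner_sub_left, hL]
        exact (Finset.sum_coe_sort T fun n => (⟪g (φ z.1), w n⟫_ℝ - ⟪g (φ z.2), w n⟫_ℝ) ^ 2).symm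
    have h1 : Tendsto (fun z : ℕ × ℕ => z.1) atTop atTop := by
      rw [← prod_atTop_atTop_eq]; exact tendsto_fst
    have h2 : Tendsto (fun z : ℕ × ℕ => z.2) atTop atTop := by
      rw [← prod_atTop_atTop_eq]; exact tendsto_snd
    have hLn : ∀ n, Tendsto (fun k => L (φ k) n) atTop (𝓝 (ℓ n)) := fun n =>
      (tendsto_pi_nhds.1 hlim) n
    have hlim2 : Tendsto (fun z : ℕ × ℕ => C * ((2 * (∑' n, ⟪g (φ z.1), e n⟫_ℝ ^ 2)
        + 2 * ∑' n, ⟪g (φ z.2), e n⟫_ℝ ^ 2) + ∑ n : T, (L (φ z.1) n - L (φ z.2) n) ^ 2)) atTop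
        (𝓝 (C * ((2 * 0 + 2 * 0) + ∑ n : T, (ℓ n - ℓ n) ^ 2))) :=
      ((((hq0.comp h1).const_mul 2).add ((hq0.comp h2).const_mul 2)).add
        (tendsto_finsetSum _ fun n _ =>
          (((hLn n).comp h1).sub ((hLn n).comp h2)).pow 2)).const_mul C
    simp only [sub_self, mul_zero, add_zero, ne_eq, OfNat.ofNat_ne_zero, not_false_eq_true,
      zero_pow, Finset.sum_const_zero] at hlim2
    have h3 := squeeze_zero (fun z => sq_nonneg _) hb hlim2
    have h4 := h3.sqrt
    simpa only [Real.sqrt_zero, Real.sqrt_sq dist_nonneg] using h4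
  obtain ⟨f, hf⟩ := cauchySeq_tendsto_of_complete hcau
  have hfS : f ∈ S := hS.mem_of_tendsto hf (Eventually.of_forall fun k => hgS _)
  have hf1 : ‖f‖ = 1 := by
    have h := hf.norm
    simp only [Function.comp_apply, hg1] at h
    exact tendsto_nhds_unique h tendsto_const_nhds
  have hf0 : f = 0 := by
    refine hinj f hfS fun n => ?_
    have h1 : Tendsto (fun k => ⟪g (φ k), e n⟫_ℝ ^ 2) atTop (𝓝 (⟪f, e n⟫_ℝ ^ 2)) :=
      (hf.inner tendsto_const_nhds).pow 2
    have h2 : Tendsto (fun k => ⟪g (φ k), e n⟫_ℝ ^ 2) atTop (𝓝 0) :=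
      squeeze_zero (fun k => sq_nonneg _)
        (fun k => (hq (g (φ k))).le_tsum n fun _ _ => sq_nonneg _) hq0
    exact pow_eq_zero_iff (two_ne_zero) |>.1 (tendsto_nhds_unique h1 h2)
  rw [hf0, norm_zero] at hf1
  exact zero_ne_one hf1

/-! ### The Hilbert space of vector functions on `(0, π)` -/

/-- The Lebesgue measure on `(0, π)`. -/
abbrev volPi : Measure ℝ := volume.restrict (Ioo 0 Real.pi)

/-- The space `L²((0, π), ℝ²)`. -/
abbrev VecL2 : Type := PiLp 2 fun _ : Fin 2 => Lp ℝ 2 volPi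

/-- A vector function on `(0, π)` with square integrable components. -/
def IsL2 (f : ℝ → Fin 2 → ℝ) : Prop := ∀ j, MemLp (fun t => f t j) 2 volPi

open Classical in
/-- The class of a square integrable vector function. -/
def toVec (f : ℝ → Fin 2 → ℝ) : VecL2 :=
  WithLp.toLp 2 fun j => if h : MemLp (fun t => f t j) 2 volPi then h.toLp _ else 0

lemma toVec_coeFn {f : ℝ → Fin 2 → ℝ} (hf : IsL2 f) (j : Fin 2) :
    (toVec f j : ℝ → ℝ) =ᵐ[volPi] fun t => f t j := by
  have : toVec f j = (hf j).toLp _ := by simp [toVec, hf j]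
  rw [this]
  exact (hf j).coeFn_toLp

lemma toVec_ext {f : ℝ → Fin 2 → ℝ} (hf : IsL2 f) {v : VecL2}
    (h : ∀ j, (v j : ℝ → ℝ) =ᵐ[volPi] fun t => f t j) : toVec f = v := by
  ext j : 1
  exact Lp.ext ((toVec_coeFn hf j).trans (h j).symm)

lemma inner_toVec {f g : ℝ → Fin 2 → ℝ} (hf : IsL2 f) (hg : IsL2 g) :
    ⟪toVec f, toVec g⟫_ℝ = ∑ j, ∫ t, f t j * g t j ∂volPi := by
  rw [PiLp.inner_apply]
  refine Finset.sum_congr rfl fun j _ => ?_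
  rw [L2.inner_def]
  refine integral_congr_ae ?_
  filter_upwards [toVec_coeFn hf j, toVec_coeFn hg j] with t h1 h2
  simp [h1, h2, mul_comm]

lemma exists_toVec_eq (v : VecL2) : ∃ f, IsL2 f ∧ toVec f = v :=
  ⟨fun t j => v j t, fun j => Lp.memLp (v j), toVec_ext (fun j => Lp.memLp (v j)) fun j => by rfl⟩

lemma IsL2.add {f g : ℝ → Fin 2 → ℝ} (hf : IsL2 f) (hg : IsL2 g) : IsL2 (f + g) :=
  fun j => (hf j).add (hg j)

lemma IsL2.sub {f g : ℝ → Fin 2 → ℝ} (hf : IsL2 f) (hg : IsL2 g) : IsL2 (f - g) :=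
  fun j => (hf j).sub (hg j)

lemma IsL2.const_smul {f : ℝ → Fin 2 → ℝ} (c : ℝ) (hf : IsL2 f) : IsL2 (c • f) :=
  fun j => (hf j).const_smul c

lemma toVec_add {f g : ℝ → Fin 2 → ℝ} (hf : IsL2 f) (hg : IsL2 g) :
    toVec (f + g) = toVec f + toVec g := by
  refine toVec_ext (hf.add hg) fun j => ?_
  filter_upwards [Lp.coeFn_add (toVec f j) (toVec g j), toVec_coeFn hf j, toVec_coeFn hg j]
    with t h h1 h2
  simp only [PiLp.add_apply, h, Pi.add_apply, h1, h2]

lemma toVec_sub {f g : ℝ → Fin 2 → ℝ} (hf : IsL2 f) (hg : IsL2 g) :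
    toVec (f - g) = toVec f - toVec g := by
  refine toVec_ext (hf.sub hg) fun j => ?_
  filter_upwards [Lp.coeFn_sub (toVec f j) (toVec g j), toVec_coeFn hf j, toVec_coeFn hg j]
    with t h h1 h2
  simp only [PiLp.sub_apply, h, Pi.sub_apply, h1, h2]

lemma toVec_smul {f : ℝ → Fin 2 → ℝ} (hf : IsL2 f) (c : ℝ) : toVec (c • f) = c • toVec f := by
  refine toVec_ext (hf.const_smul c) fun j => ?_
  filter_upwards [Lp.coeFn_smul c (toVec f j), toVec_coeFn hf j] with t h h1
  simp only [PiLp.smul_apply, h, Pi.smul_apply, h1]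

lemma IsL2.sum {ι : Type*} (s : Finset ι) {f : ι → ℝ → Fin 2 → ℝ} (hf : ∀ i, IsL2 (f i)) :
    IsL2 (∑ i ∈ s, f i) := by
  intro j
  have := memLp_finsetSum s fun i _ => hf i j
  simpa only [Finset.sum_apply] using this

lemma toVec_zero : toVec 0 = 0 :=
  toVec_ext (fun _ => MemLp.zero) fun j => by
    filter_upwards [Lp.coeFn_zero ℝ 2 volPi] with t ht
    simpa using ht

lemma toVec_sum {ι : Type*} (s : Finset ι) {f : ι → ℝ → Fin 2 → ℝ} (hf : ∀ i, IsL2 (f i)) :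
    toVec (∑ i ∈ s, f i) = ∑ i ∈ s, toVec (f i) := by
  classical
  induction s using Finset.induction_on with
  | empty => simp [toVec_zero]
  | insert i s hi ih =>
    rw [Finset.sum_insert hi, Finset.sum_insert hi, toVec_add (hf i) (IsL2.sum s hf), ih]

lemma isL2_of_continuous {f : ℝ → Fin 2 → ℝ} (hf : ∀ j, Continuous fun t => f t j) : IsL2 f := by
  intro j
  obtain ⟨C, hC⟩ := isCompact_Icc.exists_bound_of_continuousOn (s := Icc 0 Real.pi)
    (hf j).continuousOn
  refine MemLp.of_bound (hf j).aestronglyMeasurable C ?_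
  filter_upwards [ae_restrict_mem measurableSet_Ioo] with t ht
  exact hC t ⟨ht.1.le, ht.2.le⟩

lemma IsL2.indicator {f : ℝ → Fin 2 → ℝ} (hf : IsL2 f) {s : Set ℝ} (hs : MeasurableSet s) :
    IsL2 (s.indicator f) := by
  intro j
  convert (hf j).indicator hs using 1
  ext t
  by_cases ht : t ∈ s <;> simp [ht]

/-! ### Scalar representation of a vector function -/

/-- Half of the scalar function on `(-π, π)` representing a vector function on `(0, π)`. -/
def halfScalar (f : ℝ → Fin 2 → ℝ) (t : ℝ) : ℂ :=
  (Ioo 0 Real.pi).indicator (fun t => -(1 / 2 : ℂ) * (f t 1 - Complex.I * f t 0)) t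

/-- The scalar function on `(-π, π)` representing a vector function on `(0, π)`. -/
def scalarRep (f : ℝ → Fin 2 → ℝ) (t : ℝ) : ℂ :=
  halfScalar f t + (starRingEnd ℂ) (halfScalar f (-t))

lemma memLp_halfScalar {f : ℝ → Fin 2 → ℝ} (hf : IsL2 f) : MemLp (halfScalar f) 2 volume := by
  unfold halfScalar
  rw [memLp_indicator_iff_restrict measurableSet_Ioo]
  exact ((hf 1).ofReal.sub ((hf 0).ofReal.const_mul _)).const_mul _

lemma bandSupp_scalarRep {f : ℝ → Fin 2 → ℝ} (hf : IsL2 f) {b : ℝ}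
    (hfb : ∀ t, b ≤ t → f t = 0) : BandSupp b (scalarRep f) := by
  refine ⟨(memLp_halfScalar hf).add ?_, fun t ht => ?_⟩
  · exact ((memLp_halfScalar hf).comp_measurePreserving (Measure.measurePreserving_neg volume)).star
  · have key : ∀ s, b ≤ |s| → halfScalar f s = 0 := by
      intro s hs
      by_cases h : s ∈ Ioo 0 Real.pi
      · rw [abs_of_pos h.1] at hs
        simp [halfScalar, hfb s hs]
      · exact indicator_of_notMem h _
    rw [scalarRep, key t ht, key (-t) (by rwa [abs_neg])]
    simp

lemma bandSupp_pi_scalarRep {f : ℝ → Fin 2 → ℝ} (hf : IsL2 f) :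
    BandSupp Real.pi (scalarRep f) := by
  refine ⟨(memLp_halfScalar hf).add ?_, fun t ht => ?_⟩
  · exact ((memLp_halfScalar hf).comp_measurePreserving (Measure.measurePreserving_neg volume)).star
  · have key : ∀ s, Real.pi ≤ |s| → halfScalar f s = 0 := by
      intro s hs
      refine indicator_of_notMem (fun h => ?_) _
      rw [abs_of_pos h.1] at hs
      exact absurd h.2 (not_lt.2 hs)
    rw [scalarRep, key t ht, key (-t) (by rwa [abs_neg])]
    simp

lemma isL2_freeSolReal (l : ℝ) : IsL2 fun t => freeSolReal t l :=
  isL2_of_continuous fun j => by fin_cases j <;> simp [freeSolReal] <;> fun_prop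

/-- The free solution as an element of `L²((0, π), ℝ²)`. -/
def freeVec (l : ℝ) : VecL2 := toVec fun t => freeSolReal t l

lemma integrable_halfScalar {f : ℝ → Fin 2 → ℝ} (hf : IsL2 f) : Integrable (halfScalar f) := by
  have h : Integrable (halfScalar f) volPi := ((memLp_halfScalar hf).restrict _).integrable (by norm_num)
  exact IntegrableOn.integrable_of_forall_notMem_eq_zero h fun t ht => indicator_of_notMem ht _

/-- The representative takes conjugate values at `t` and `-t`, so its transform is twice the real
part of that of its half on `(0, π)`. The real part of `-(f₁ - i f₀) exp(-ilt)` is `f₀ sin lt - f₁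
cos lt`, the integrand of the pairing. -/
lemma fourierInt_scalarRep {f : ℝ → Fin 2 → ℝ} (hf : IsL2 f) (l : ℝ) :
    fourierInt (scalarRep f) l = (⟪toVec f, freeVec l⟫_ℝ : ℝ) := by
  have hA := integrable_halfScalar hf
  have hAe := integrable_mul_expKernel hA l
  have hB : Integrable fun t => (starRingEnd ℂ) (halfScalar f (-t)) :=
    (Complex.conjCLE.toContinuousLinearMap.integrable_comp hA.comp_neg)
  have h1 : ∫ t, (starRingEnd ℂ) (halfScalar f (-t)) * expKernel l t
      = (starRingEnd ℂ) (fourierInt (halfScalar f) l) := by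
    rw [fourierInt, ← integral_conj, ← integral_neg_eq_self]
    congr 1; ext t
    rw [map_mul, neg_neg]
    congr 1
    rw [expKernel, expKernel, ← Complex.exp_conj]
    simp
  have h2 : fourierInt (scalarRep f) l
      = fourierInt (halfScalar f) l + (starRingEnd ℂ) (fourierInt (halfScalar f) l) := by
    rw [← h1]
    exact fourierInt_add hA hB l
  rw [h2, Complex.add_conj, freeVec, inner_toVec hf (isL2_freeSolReal l), Fin.sum_univ_two]
  congr 1
  have h3 : (fourierInt (halfScalar f) l).re
      = ∫ t, (halfScalar f t * expKernel l t).re := (integral_re hAe).symm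
  have h4 : ∀ t, (halfScalar f t * expKernel l t).re
      = (Ioo 0 Real.pi).indicator (fun t => (1 / 2) * (f t 0 * freeSolReal t l 0
        + f t 1 * freeSolReal t l 1)) t := by
    intro t
    unfold halfScalar
    by_cases ht : t ∈ Ioo 0 Real.pi
    · rw [indicator_of_mem ht, indicator_of_mem ht, expKernel, Complex.exp_mul_I]
      simp only [← Complex.ofReal_cos, ← Complex.ofReal_sin, Real.cos_neg, Real.sin_neg]
      simp only [Complex.mul_re, Complex.mul_im, Complex.add_re, Complex.add_im, Complex.sub_re,
        Complex.sub_im, Complex.ofReal_re, Complex.ofReal_im, Complex.I_re, Complex.I_im,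
        Complex.neg_re, Complex.neg_im, freeSolReal]
      norm_num
      ring
    · simp [indicator_of_notMem ht]
  rw [h3]
  simp only [h4]
  rw [integral_indicator measurableSet_Ioo, integral_const_mul, integral_add]
  · ring
  · exact (hf 0).integrable_mul (isL2_freeSolReal l 0)
  · exact (hf 1).integrable_mul (isL2_freeSolReal l 1)

/-- The two halves have disjoint supports and each carries a quarter of the squared norm. -/
lemma integral_sq_scalarRep {f : ℝ → Fin 2 → ℝ} (hf : IsL2 f) :
    2 * ∫ t, ‖scalarRep f t‖ ^ 2 = ‖toVec f‖ ^ 2 := by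
  have hi : Integrable fun t => ‖halfScalar f t‖ ^ 2 :=
    (memLp_two_iff_integrable_sq_norm (memLp_halfScalar hf).1).1 (memLp_halfScalar hf)
  have h1 : ∀ t, ‖scalarRep f t‖ ^ 2 = ‖halfScalar f t‖ ^ 2 + ‖halfScalar f (-t)‖ ^ 2 := by
    intro t
    unfold scalarRep
    by_cases ht : t ∈ Ioo 0 Real.pi
    · have : halfScalar f (-t) = 0 := indicator_of_notMem (fun h => by linarith [h.1, ht.1]) _
      simp [this]
    · have : halfScalar f t = 0 := indicator_of_notMem ht _
      simp [this]
  have h2 : ∀ t, ‖halfScalar f t‖ ^ 2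
      = (Ioo 0 Real.pi).indicator (fun t => (1 / 4) * (f t 0 * f t 0 + f t 1 * f t 1)) t := by
    intro t
    unfold halfScalar
    by_cases ht : t ∈ Ioo 0 Real.pi
    · rw [indicator_of_mem ht, indicator_of_mem ht, ← Complex.normSq_eq_norm_sq,
        Complex.normSq_apply]
      simp
      ring
    · simp [indicator_of_notMem ht]
  simp only [h1]
  rw [integral_add hi hi.comp_neg, integral_neg_eq_self (fun t => ‖halfScalar f t‖ ^ 2),
    ← real_inner_self_eq_norm_sq, inner_toVec hf hf, Fin.sum_univ_two]
  simp only [h2]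
  rw [integral_indicator measurableSet_Ioo, integral_const_mul, integral_add]
  · ring
  · exact (hf 0).integrable_mul (hf 0)
  · exact (hf 1).integrable_mul (hf 1)

/-- Parseval's identity for the free solutions with integer frequencies. -/
lemma hasSum_sq_inner_freeVec (v : VecL2) :
    HasSum (fun n : ℤ => ⟪v, freeVec n⟫_ℝ ^ 2) (Real.pi * ‖v‖ ^ 2) := by
  obtain ⟨f, hf, rfl⟩ := exists_toVec_eq v
  have h := (bandSupp_pi_scalarRep hf).hasSum_sq_fourierInt
  simp only [fourierInt_scalarRep hf, Complex.norm_real, Real.norm_eq_abs, sq_abs] at h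
  convert h using 1
  rw [← integral_sq_scalarRep hf]; ring

lemma sq_inner_freeVec_sub_le (v : VecL2) (l m : ℝ) :
    ⟪v, freeVec l - freeVec m⟫_ℝ ^ 2 ≤ (l - m) ^ 2 * Real.pi ^ 3 * ‖v‖ ^ 2 := by
  obtain ⟨f, hf, rfl⟩ := exists_toVec_eq v
  have h := (bandSupp_pi_scalarRep hf).sq_norm_fourierInt_sub_le l m
  rw [fourierInt_scalarRep hf, fourierInt_scalarRep hf, ← Complex.ofReal_sub, Complex.norm_real,
    Real.norm_eq_abs, sq_abs, ← inner_sub_right] at h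
  rw [← integral_sq_scalarRep hf]
  linarith

/-- The elements of `L²((0, π), ℝ²)` vanishing on `[b, π)`. -/
def vanishAfter (b : ℝ) : Submodule ℝ VecL2 :=
  (Submodule.span ℝ {v | ∃ u, IsL2 u ∧ (∀ t < b, u t = 0) ∧ toVec u = v})ᗮ

lemma toVec_mem_vanishAfter {f : ℝ → Fin 2 → ℝ} (hf : IsL2 f) {b : ℝ}
    (hfb : ∀ t, b ≤ t → f t = 0) : toVec f ∈ vanishAfter b := by
  rw [vanishAfter, Submodule.mem_orthogonal]
  intro u hu
  induction hu using Submodule.span_induction with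
  | mem x hx =>
    obtain ⟨u, hu, hub, rfl⟩ := hx
    rw [inner_toVec hu hf]
    refine Finset.sum_eq_zero fun j _ => integral_eq_zero_of_ae (ae_of_all _ fun t => ?_)
    rcases lt_or_ge t b with h | h
    · simp [hub t h]
    · simp [hfb t h]
  | zero => simp
  | add x y _ _ hx hy => rw [inner_add_left, hx, hy, add_zero]
  | smul a x _ hx => rw [real_inner_smul_left, hx, mul_zero]

/-- The restriction of a representative to `[b, ∞)` is one of the spanning vectors, so it is
orthogonal to `v`. It is also orthogonal to the restriction to `(-∞, b)`, hence to itself. -/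
lemma exists_toVec_eq_of_mem_vanishAfter {b : ℝ} {v : VecL2} (hv : v ∈ vanishAfter b) :
    ∃ f, IsL2 f ∧ (∀ t, b ≤ t → f t = 0) ∧ toVec f = v := by
  obtain ⟨f, hf, rfl⟩ := exists_toVec_eq v
  have hu := hf.indicator (measurableSet_Ici (a := b))
  have hw := hf.indicator (measurableSet_Iio (a := b))
  have hsum : (Iio b).indicator f + (Ici b).indicator f = f := by
    rw [← compl_Iio, indicator_self_add_compl]
  have h1 : ⟪toVec ((Ici b).indicator f), toVec f⟫_ℝ = 0 := by
    refine (Submodule.mem_orthogonal _ _).1 hv _ (Submodule.subset_span ⟨_, hu, fun t ht => ?_, rfl⟩)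
    exact indicator_of_notMem (not_le.2 ht) _
  have h2 : ⟪toVec ((Ici b).indicator f), toVec ((Iio b).indicator f)⟫_ℝ = 0 := by
    rw [inner_toVec hu hw]
    refine Finset.sum_eq_zero fun j _ => integral_eq_zero_of_ae (ae_of_all _ fun t => ?_)
    rcases lt_or_ge t b with h | h
    · simp [indicator_of_notMem (show t ∉ Ici b from not_le.2 h)]
    · simp [indicator_of_notMem (show t ∉ Iio b from not_lt.2 h)]
  have h3 : toVec ((Ici b).indicator f) = 0 := by
    have h4 := toVec_add hw hu
    rw [hsum] at h4
    rw [h4, inner_add_right, h2, zero_add, inner_self_eq_zero] at h1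
    exact h1
  refine ⟨(Iio b).indicator f, hw, fun t ht =>
    indicator_of_notMem (show t ∉ Iio b from not_lt.2 ht) _, ?_⟩
  have h4 := toVec_add hw hu
  rw [hsum, h3, add_zero] at h4
  exact h4.symm

/-- Completeness kills the whole transform, in particular its values at the integers, and Parseval's
identity finishes. -/
lemma eq_zero_of_completeFreq {b : ℝ} {lam : ℤ → ℝ} (h : CompleteFreq b lam)
    {v : VecL2} (hv : v ∈ vanishAfter b) (hz : ∀ n, ⟪v, freeVec (lam n)⟫_ℝ = 0) : v = 0 := by
  obtain ⟨f, hf, hfb, rfl⟩ := exists_toVec_eq_of_mem_vanishAfter hv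
  have h1 := h _ (bandSupp_scalarRep hf hfb) fun n => by rw [fourierInt_scalarRep hf, hz]; simp
  have h2 := hasSum_sq_inner_freeVec (toVec f)
  have h3 : ∀ n : ℤ, ⟪toVec f, freeVec n⟫_ℝ = 0 := by
    intro n
    have := h1 n
    rw [fourierInt_scalarRep hf] at this
    exact_mod_cast this
  simp only [h3, ne_eq, OfNat.ofNat_ne_zero, not_false_eq_true, zero_pow] at h2
  have h4 := h2.unique hasSum_zero
  have : ‖toVec f‖ ^ 2 = 0 := by
    rcases mul_eq_zero.1 h4 with h5 | h5
    · exact absurd h5 Real.pi_ne_zero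
    · exact h5
  simpa using this

lemma summable_sq_inner_freeVec {lam : ℤ → ℝ} (hlam : Summable fun n : ℤ => (lam n - n) ^ 2)
    (v : VecL2) : Summable fun n => ⟪v, freeVec (lam n)⟫_ℝ ^ 2 := by
  refine Summable.of_nonneg_of_le (fun n => sq_nonneg _) (fun n => ?_)
    (((hasSum_sq_inner_freeVec v).summable.mul_left 2).add
      (((hlam.mul_right (Real.pi ^ 3)).mul_right (‖v‖ ^ 2)).mul_left 2))
  have h := sq_inner_freeVec_sub_le v (lam n) n
  rw [inner_sub_right] at h
  nlinarith [sq_nonneg (⟪v, freeVec (lam n)⟫_ℝ - 2 * ⟪v, freeVec n⟫_ℝ)]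

/-- Complete frequencies give a lower frame bound. -/
theorem exists_frame_bound {lam : ℤ → ℝ} (hlam : Summable fun n : ℤ => (lam n - n) ^ 2) {b : ℝ}
    (h : CompleteFreq b lam) :
    ∃ δ > 0, ∀ v ∈ vanishAfter b, δ * ‖v‖ ^ 2 ≤ ∑' n, ⟪v, freeVec (lam n)⟫_ℝ ^ 2 := by
  have hpi := Real.pi_pos
  obtain ⟨U, hU⟩ := id hlam
  -- Outside `T` the perturbation is small enough to be absorbed: its contribution is at most `π/4`
  -- of `‖v‖²`.
  obtain ⟨T, hT⟩ := exists_finset_sub_sum_lt hU (ε := 1 / (4 * Real.pi ^ 2)) (by positivity)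
  refine exists_coercive (vanishAfter b) (Submodule.isClosed_orthogonal _)
    (fun n => freeVec (lam n)) (fun n => freeVec (lam n) - freeVec n) T
    (summable_sq_inner_freeVec hlam) (4 / Real.pi) (fun v => ?_)
    fun v hv hz => eq_zero_of_completeFreq h hv hz
  have h1 := hasSum_sq_inner_freeVec v
  have h2 := (summable_sq_inner_freeVec hlam v).hasSum
  have h3 := (hasSum_ite_mem ((hU.mul_right (Real.pi ^ 3)).mul_right (‖v‖ ^ 2)) T
    fun n => ⟪v, freeVec (lam n) - freeVec n⟫_ℝ ^ 2)
  have h4 := hasSum_le (fun n : ℤ => ?_) h1 ((h2.mul_left 2).add (h3.mul_left 2))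
  · rw [← Finset.sum_mul, ← Finset.sum_mul] at h4
    set q := ∑' n, ⟪v, freeVec (lam n)⟫_ℝ ^ 2
    set L := ∑ n ∈ T, ⟪v, freeVec (lam n) - freeVec n⟫_ℝ ^ 2
    have h5 : (U - ∑ n ∈ T, (lam n - n) ^ 2) * Real.pi ^ 3 * ‖v‖ ^ 2 ≤ Real.pi / 4 * ‖v‖ ^ 2 := by
      refine mul_le_mul_of_nonneg_right ?_ (sq_nonneg _)
      calc (U - ∑ n ∈ T, (lam n - n) ^ 2) * Real.pi ^ 3
          ≤ 1 / (4 * Real.pi ^ 2) * Real.pi ^ 3 := mul_le_mul_of_nonneg_right hT.le (by positivity)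
        _ = Real.pi / 4 := by field_simp
    -- From `π‖v‖² ≤ 2q + 2(L + (π/4)‖v‖²)`, half of the left side is absorbed; this gives the
    -- constant `4/π`.
    have h6 : Real.pi * ‖v‖ ^ 2 ≤ 4 * (q + L) := by nlinarith
    rw [div_mul_eq_mul_div, le_div_iff₀ hpi]
    linarith
  · have h5 := sq_inner_freeVec_sub_le v (lam n) n
    have h6 : ⟪v, freeVec n⟫_ℝ ^ 2 ≤ 2 * ⟪v, freeVec (lam n)⟫_ℝ ^ 2
        + 2 * ⟪v, freeVec (lam n) - freeVec n⟫_ℝ ^ 2 := by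
      rw [inner_sub_right]
      nlinarith [sq_nonneg (2 * ⟪v, freeVec (lam n)⟫_ℝ - ⟪v, freeVec n⟫_ℝ)]
    split_ifs <;> linarith

end DiracInverse
end

noncomputable section

namespace DiracInverse

open scoped InnerProductSpace

/-! ### Differentiability of inverse matrices -/

lemma differentiableAt_det {ι : Type*} [Fintype ι] [DecidableEq ι] {M : ℝ → Matrix ι ι ℝ} {x : ℝ}
    (hM : ∀ j k, DifferentiableAt ℝ (fun s => M s j k) x) :
    DifferentiableAt ℝ (fun s => (M s).det) x := by
  simp only [Matrix.det_apply']
  exact DifferentiableAt.fun_sum fun σ _ =>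
    (DifferentiableAt.fun_finsetProd fun i _ => hM (σ i) i).const_mul _

lemma differentiableAt_inv_apply {ι : Type*} [Fintype ι] [DecidableEq ι] {M : ℝ → Matrix ι ι ℝ}
    {x : ℝ} (hM : ∀ j k, DifferentiableAt ℝ (fun s => M s j k) x) (hx : (M x).det ≠ 0) (j k : ι) :
    DifferentiableAt ℝ (fun s => (M s)⁻¹ j k) x := by
  simp only [Matrix.inv_def, Matrix.smul_apply, Ring.inverse_eq_inv', smul_eq_mul,
    Matrix.adjugate_apply]
  refine ((differentiableAt_det hM).inv hx).mul (differentiableAt_det fun a b => ?_)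
  by_cases h : a = k
  · subst h; simp
  · simpa [Matrix.updateRow_ne h] using hM a b

/-! ### Kernels of finite rank -/

/-- The integral of `cos (w t)` over `(0, x)`, for a complex frequency. -/
def cosInt (w : ℂ) (x : ℝ) : ℂ := ∫ t in (0 : ℝ)..x, Complex.cos (w * t)

/-- The integral of `cos (w t)` over `(0, x)`, for a real frequency. -/
def cosIntReal (w x : ℝ) : ℝ := ∫ t in (0 : ℝ)..x, Real.cos (w * t)

lemma hasDerivAt_cosInt (w : ℂ) (x : ℝ) :
    HasDerivAt (cosInt w) (Complex.cos (w * x)) x :=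
  (Continuous.integral_hasStrictDerivAt (by fun_prop) 0 x).hasDerivAt

lemma hasDerivAt_cosIntReal (w x : ℝ) :
    HasDerivAt (cosIntReal w) (Real.cos (w * x)) x :=
  (Continuous.integral_hasStrictDerivAt (by fun_prop) 0 x).hasDerivAt

/-- The form of `sin(wx)/w` that needs no exception at `w = 0`, so repeated frequencies are
harmless. -/
lemma mul_cosInt (w : ℂ) (x : ℝ) : w * cosInt w x = Complex.sin (w * x) := by
  rw [cosInt, ← intervalIntegral.integral_const_mul]
  have h : ∀ t ∈ uIcc 0 x, HasDerivAt (fun t : ℝ => Complex.sin (w * t)) (w * Complex.cos (w * t)) t := by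
    intro t _
    have h1 := ((hasDerivAt_id (t : ℂ)).const_mul w).csin.comp_ofReal
    simpa [mul_comm] using h1
  rw [intervalIntegral.integral_eq_sub_of_hasDerivAt h
    (by fun_prop : Continuous fun t : ℝ => w * Complex.cos (w * t)).continuousOn.intervalIntegrable]
  simp

lemma cosInt_ofReal (w x : ℝ) : cosInt w x = cosIntReal w x := by
  unfold cosInt cosIntReal
  rw [← intervalIntegral.integral_ofReal]
  simp

lemma mul_cosIntReal (w x : ℝ) : w * cosIntReal w x = Real.sin (w * x) := by
  have h := mul_cosInt w x
  rw [cosInt_ofReal] at h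
  exact_mod_cast h

lemma cosIntReal_neg (w x : ℝ) : cosIntReal (-w) x = cosIntReal w x := by
  simp [cosIntReal, neg_mul]

/-! ### Products with the matrix `B` and with a potential, entry by entry. -/

section EntriesOfB

variable {R : Type} [Ring R] {κ : Type*}

lemma B_mul_apply_zero (X : Matrix (Fin 2) κ R) (j : κ) : (B R * X) 0 j = X 1 j := by
  rw [Matrix.mul_apply, Fin.sum_univ_two]; simp [B]

lemma B_mul_apply_one (X : Matrix (Fin 2) κ R) (j : κ) : (B R * X) 1 j = -X 0 j := by
  rw [Matrix.mul_apply, Fin.sum_univ_two]; simp [B]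

lemma mul_B_apply_zero (X : Matrix κ (Fin 2) R) (j : κ) : (X * B R) j 0 = -X j 1 := by
  rw [Matrix.mul_apply, Fin.sum_univ_two]; simp [B]

lemma mul_B_apply_one (X : Matrix κ (Fin 2) R) (j : κ) : (X * B R) j 1 = X j 0 := by
  rw [Matrix.mul_apply, Fin.sum_univ_two]; simp [B]

lemma B_mulVec_zero (v : Fin 2 → R) : (B R).mulVec v 0 = v 1 := by
  rw [Matrix.mulVec, dotProduct, Fin.sum_univ_two]; simp [B]

lemma B_mulVec_one (v : Fin 2 → R) : (B R).mulVec v 1 = -v 0 := by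
  rw [Matrix.mulVec, dotProduct, Fin.sum_univ_two]; simp [B]

lemma B_mul_B (R : Type) [Ring R] : B R * B R = -1 := by
  ext i j
  fin_cases i
  · exact (B_mul_apply_zero _ _).trans (by fin_cases j <;> simp [B])
  · exact (B_mul_apply_one _ _).trans (by fin_cases j <;> simp [B])

lemma potential_mul_apply_zero (p q : ℝ → ℝ) (x : ℝ) (X : Matrix (Fin 2) κ ℝ) (j : κ) :
    (potential p q x * X) 0 j = p x * X 0 j + q x * X 1 j := by
  rw [Matrix.mul_apply, Fin.sum_univ_two]; simp [potential]

lemma potential_mul_apply_one (p q : ℝ → ℝ) (x : ℝ) (X : Matrix (Fin 2) κ ℝ) (j : κ) :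
    (potential p q x * X) 1 j = q x * X 0 j - p x * X 1 j := by
  rw [Matrix.mul_apply, Fin.sum_univ_two]; simp [potential, sub_eq_add_neg]

/-- The commutator with `B` is a Dirac potential. -/
lemma commutator_B (X : Matrix (Fin 2) (Fin 2) ℝ) : X * B ℝ - B ℝ * X
    = !![-(X 0 1 + X 1 0), X 0 0 - X 1 1; X 0 0 - X 1 1, X 0 1 + X 1 0] := by
  ext i j
  fin_cases i <;> fin_cases j <;>
    simp only [Fin.zero_eta, Fin.mk_one, Matrix.sub_apply, B_mul_apply_zero, B_mul_apply_one,
      mul_B_apply_zero, mul_B_apply_one, Matrix.of_apply, Matrix.cons_val', Matrix.cons_val_zero,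
      Matrix.cons_val_one, Matrix.cons_val_fin_one] <;> ring

end EntriesOfB

/-! ### The explicit solution for a kernel of finite rank and its Dirac system. -/

section FiniteRank

variable {ι : Type*} [Fintype ι] [DecidableEq ι] (c m : ι → ℝ)

/-- The free solutions with the given frequencies, as the columns of a matrix. -/
def freeMat (x : ℝ) : Matrix (Fin 2) ι ℝ := Matrix.of fun i j => freeSolReal x (m j) i

/-- The Gram matrix of the free solutions on `(0, x)`. -/
def gramMat (x : ℝ) : Matrix ι ι ℝ := Matrix.of fun j k => cosIntReal (m k - m j) x

/-- The matrix of the main equation for a kernel of finite rank. -/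
def mainMat (x : ℝ) : Matrix ι ι ℝ := 1 + Matrix.diagonal c * gramMat m x

/-- The perturbed solutions at the given frequencies, for a kernel of finite rank. -/
def pertMat (x : ℝ) : Matrix (Fin 2) ι ℝ := freeMat m x * (mainMat c m x)⁻¹

/-- The diagonal value of the solution of the main equation with a kernel of finite rank. -/
def finDiag (x : ℝ) : Matrix (Fin 2) (Fin 2) ℝ :=
  -(pertMat c m x * Matrix.diagonal c * (freeMat m x).transpose)

/-- The first entry of the potential belonging to a kernel of finite rank. -/
def finP (x : ℝ) : ℝ := -(finDiag c m x 0 1 + finDiag c m x 1 0)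

/-- The second entry of the potential belonging to a kernel of finite rank. -/
def finQ (x : ℝ) : ℝ := finDiag c m x 0 0 - finDiag c m x 1 1

/-- The perturbed solution for a kernel of finite rank. -/
def finSol (x : ℝ) (z : ℂ) (i : Fin 2) : ℂ :=
  freeSol x z i - ∑ j, (c j * pertMat c m x i j : ℝ) * cosInt (z - m j) x

variable {c m}

/-- The main equation in coordinates: for the kernel `∑ cₖ φ₀(x,mₖ) φ₀(t,mₖ)ᵀ` and the ansatz
`K(x,t) = -∑ cₖ Pₖ(x) φ₀(t,mₖ)ᵀ`, it follows from `P (1 + diag(c) G) = Φ`, with `G` the Gram matrix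
and `Φ` the matrix of free solutions. -/
lemma pertMat_mul_mainMat {x : ℝ} (hx : (mainMat c m x).det ≠ 0) :
    pertMat c m x * mainMat c m x = freeMat m x := by
  rw [pertMat, Matrix.mul_assoc, Matrix.nonsing_inv_mul _ (isUnit_iff_ne_zero.2 hx), Matrix.mul_one]

lemma potential_fin (x : ℝ) : potential (finP c m) (finQ c m) x
    = finDiag c m x * B ℝ - B ℝ * finDiag c m x := by
  rw [commutator_B, potential, finP, finQ, neg_neg]

lemma hasDerivAt_freeMat (x : ℝ) (i : Fin 2) (j : ι) :
    HasDerivAt (fun s => freeMat m s i j)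
      ((-(B ℝ * freeMat m x * Matrix.diagonal m)) i j) x := by
  have h1 : HasDerivAt (fun s : ℝ => m j * s) (m j * 1) x := (hasDerivAt_id x).const_mul (m j)
  fin_cases i
  · refine (h1.sin).congr_deriv ?_
    simp [Matrix.mul_diagonal, B_mul_apply_zero, freeMat, freeSolReal]
  · refine (h1.cos.neg).congr_deriv ?_
    simp [Matrix.mul_diagonal, B_mul_apply_one, freeMat, freeSolReal]

lemma hasDerivAt_mainMat (x : ℝ) (j k : ι) :
    HasDerivAt (fun s => mainMat c m s j k)
      ((Matrix.diagonal c * ((freeMat m x).transpose * freeMat m x)) j k) x := by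
  have h := ((hasDerivAt_cosIntReal (m k - m j) x).const_mul (c j)).const_add ((1 : Matrix ι ι ℝ) j k)
  have e : (fun s => mainMat c m s j k)
      = fun s => (1 : Matrix ι ι ℝ) j k + c j * cosIntReal (m k - m j) s := by
    ext s; simp [mainMat, gramMat]
  rw [e]
  refine h.congr_deriv ?_
  rw [Matrix.diagonal_mul, Matrix.mul_apply]
  simp only [Matrix.transpose_apply, Fin.sum_univ_two, freeMat, Matrix.of_apply, freeSolReal, Matrix.cons_val_zero, Matrix.cons_val_one]
  rw [sub_mul, Real.cos_sub]
  ring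

/-- Entrywise this is `(mₖ - mⱼ) ∫₀ˣ cos((mₖ - mⱼ)t) dt = sin((mₖ - mⱼ)x)`, the right side being an
entry of `Φᵀ B Φ`. The Gram matrix thus commutes with the frequencies up to a term of low rank, the
algebraic source of the Dirac system. -/
lemma diagonal_mul_mainMat (x : ℝ) : Matrix.diagonal m * mainMat c m x
    = mainMat c m x * Matrix.diagonal m
      - Matrix.diagonal c * ((freeMat m x).transpose * (B ℝ * freeMat m x)) := by
  ext j k
  have h := mul_cosIntReal (m k - m j) x
  have e : ((freeMat m x).transpose * (B ℝ * freeMat m x)) j k = Real.sin ((m k - m j) * x) := by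
    rw [Matrix.mul_apply]
    simp only [Matrix.transpose_apply, Fin.sum_univ_two, B_mul_apply_zero, B_mul_apply_one, freeMat,
      Matrix.of_apply, freeSolReal, Matrix.cons_val_zero, Matrix.cons_val_one]
    rw [sub_mul, Real.sin_sub]
    ring
  simp only [Matrix.sub_apply, Matrix.diagonal_mul, Matrix.mul_diagonal, e, mainMat,
    Matrix.add_apply, gramMat, Matrix.of_apply, ← h]
  by_cases hjk : j = k
  · subst hjk; ring
  · rw [Matrix.one_apply_ne hjk]; ring

/-- Differentiating `P M = Φ` gives `P' M = -BΦΛ - P diag(c) ΦᵀΦ`, where `Λ` is the diagonal of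
frequencies. Moving `Λ` across `M` by `diagonal_mul_mainMat` and using `B² = -1`, the correction
terms assemble into the commutator of the diagonal value with `B`. -/
lemma hasDerivAt_pertMat {x : ℝ} (hx : (mainMat c m x).det ≠ 0) (i : Fin 2) (j : ι) :
    HasDerivAt (fun s => pertMat c m s i j)
      ((-(B ℝ * (pertMat c m x * Matrix.diagonal m
        - potential (finP c m) (finQ c m) x * pertMat c m x))) i j) x := by
  have hMd : ∀ j k, DifferentiableAt ℝ (fun s => mainMat c m s j k) x := fun j k =>
    (hasDerivAt_mainMat x j k).differentiableAt
  have hPd : ∀ i j, DifferentiableAt ℝ (fun s => pertMat c m s i j) x := by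
    intro i j
    simp only [pertMat, Matrix.mul_apply]
    exact DifferentiableAt.fun_sum fun k _ => (hasDerivAt_freeMat x i k).differentiableAt.mul
      (differentiableAt_inv_apply hMd hx k j)
  set D : Matrix (Fin 2) ι ℝ := Matrix.of fun i j => deriv (fun s => pertMat c m s i j) x with hD
  set P := pertMat c m x with hP
  set M := mainMat c m x with hM
  set Φ := freeMat m x with hΦ
  have hev : ∀ᶠ s in 𝓝 x, (mainMat c m s).det ≠ 0 :=
    (differentiableAt_det hMd).continuousAt.eventually_ne hx
  have hprod : D * M + P * (Matrix.diagonal c * (Φ.transpose * Φ))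
      = -(B ℝ * Φ * Matrix.diagonal m) := by
    ext i k
    have h1 : HasDerivAt (fun s => ∑ j, pertMat c m s i j * mainMat c m s j k)
        (∑ j, (D i j * M j k + P i j * (Matrix.diagonal c * (Φ.transpose * Φ)) j k)) x :=
      HasDerivAt.fun_sum fun j _ => (hPd i j).hasDerivAt.mul (hasDerivAt_mainMat x j k)
    have h2 : (fun s => ∑ j, pertMat c m s i j * mainMat c m s j k) =ᶠ[𝓝 x]
        fun s => freeMat m s i k := by
      filter_upwards [hev] with s hs
      rw [← pertMat_mul_mainMat hs, Matrix.mul_apply]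
    have h3 := (h1.congr_of_eventuallyEq h2.symm).unique (hasDerivAt_freeMat x i k)
    rw [← hΦ] at h3
    rw [← h3, Finset.sum_add_distrib, Matrix.add_apply, Matrix.mul_apply, Matrix.mul_apply]
  have hPM : P * M = Φ := pertMat_mul_mainMat hx
  have key : D = -(B ℝ * (P * Matrix.diagonal m - potential (finP c m) (finQ c m) x * P)) := by
    -- Since `M` is invertible, the identity may be checked after multiplication by `M`, where no
    -- inverse occurs.
    have hinj : ∀ X Y : Matrix (Fin 2) ι ℝ, X * M = Y * M → X = Y := fun X Y h => by
      have := congrArg (· * M⁻¹) h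
      simpa [Matrix.mul_assoc, Matrix.mul_nonsing_inv _ (isUnit_iff_ne_zero.2 hx)] using this
    refine hinj _ _ ?_
    have hK : finDiag c m x = -(P * Matrix.diagonal c * Φ.transpose) := rfl
    rw [eq_sub_of_add_eq hprod, potential_fin, hK]
    have h1 : P * Matrix.diagonal m * M = Φ * Matrix.diagonal m
        - P * Matrix.diagonal c * Φ.transpose * B ℝ * Φ := by
      rw [Matrix.mul_assoc, hM, diagonal_mul_mainMat, ← hM, ← hΦ, Matrix.mul_sub, ← Matrix.mul_assoc,
        hPM]
      simp only [Matrix.mul_assoc]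
    rw [Matrix.neg_mul, Matrix.mul_assoc (B ℝ) _ M, Matrix.sub_mul, h1, Matrix.mul_assoc _ P M, hPM]
    set K := P * Matrix.diagonal c * Φ.transpose
    have h2 : P * (Matrix.diagonal c * (Φ.transpose * Φ)) = K * Φ := by
      simp only [K, Matrix.mul_assoc]
    rw [h2]
    have h3 : B ℝ * (B ℝ * (K * Φ)) = -(K * Φ) := by
      rw [← Matrix.mul_assoc, B_mul_B, Matrix.neg_mul, Matrix.one_mul]
    simp only [Matrix.mul_sub, Matrix.sub_mul, Matrix.neg_mul, Matrix.mul_neg, Matrix.mul_assoc, h3]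
    abel
  have := (hPd i j).hasDerivAt
  rwa [show deriv (fun s => pertMat c m s i j) x = D i j from rfl, key] at this

lemma hasDerivAt_freeSol (x : ℝ) (z : ℂ) (i : Fin 2) :
    HasDerivAt (fun s => freeSol s z i) ((-(z • (B ℂ).mulVec (freeSol x z))) i) x := by
  have h1 := (hasDerivAt_id (x : ℂ)).const_mul z
  fin_cases i
  · refine h1.csin.comp_ofReal.congr_deriv ?_
    simp [B, freeSol, mul_comm]
  · refine h1.ccos.neg.comp_ofReal.congr_deriv ?_
    simp [B, freeSol, mul_comm]

/-- The perturbed solution for a kernel of finite rank solves a Dirac system. -/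
lemma hasDerivAt_finSol {x : ℝ} (hx : (mainMat c m x).det ≠ 0) (z : ℂ) (i : Fin 2) :
    HasDerivAt (fun s => finSol c m s z i)
      (![-(z * finSol c m x z 1 - finQ c m x * finSol c m x z 0 + finP c m x * finSol c m x z 1),
        z * finSol c m x z 0 - finP c m x * finSol c m x z 0 - finQ c m x * finSol c m x z 1] i)
      x := by
  have h1 := (hasDerivAt_freeSol x z i).sub (HasDerivAt.fun_sum (u := Finset.univ) fun j _ =>
    (((hasDerivAt_pertMat hx i j).const_mul (c j)).ofReal_comp).mul (hasDerivAt_cosInt (z - m j) x))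
  refine h1.congr_deriv ?_
  have hs : ∀ j, (z - m j) * cosInt (z - m j) x
      = Complex.sin (z * x) * Complex.cos (m j * x) - Complex.cos (z * x) * Complex.sin (m j * x) := by
    intro j
    rw [mul_cosInt, sub_mul, Complex.sin_sub]
  have hc : ∀ j, Complex.cos ((z - m j) * x)
      = Complex.cos (z * x) * Complex.cos (m j * x) + Complex.sin (z * x) * Complex.sin (m j * x) := by
    intro j
    rw [sub_mul, Complex.cos_sub]
  have hK : ∀ i l, ((finDiag c m x i l : ℝ) : ℂ)
      = -∑ j, ((c j * pertMat c m x i j : ℝ) : ℂ) * ((freeSolReal x (m j) l : ℝ) : ℂ) := by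
    intro i l
    rw [finDiag, Matrix.neg_apply, Matrix.mul_apply]
    push_cast
    simp only [Matrix.mul_diagonal, Matrix.transpose_apply, freeMat, Matrix.of_apply]
    congr 1
    exact Finset.sum_congr rfl fun j _ => by push_cast; ring
  have hq : ((finQ c m x : ℝ) : ℂ) = (finDiag c m x 0 0 : ℝ) - (finDiag c m x 1 1 : ℝ) := by
    simp [finQ]
  have hp : ((finP c m x : ℝ) : ℂ) = -((finDiag c m x 0 1 : ℝ) + (finDiag c m x 1 0 : ℝ)) := by
    simp [finP]
  set S := Complex.sin (z * x) with hS
  set C := Complex.cos (z * x) with hC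
  have hphi0 : finSol c m x z 0 = S - ∑ j, (c j * pertMat c m x 0 j : ℝ) * cosInt (z - m j) x := rfl
  have hphi1 : finSol c m x z 1 = -C - ∑ j, (c j * pertMat c m x 1 j : ℝ) * cosInt (z - m j) x := rfl
  set p : ℂ := ((finP c m x : ℝ) : ℂ) with hp'
  set q : ℂ := ((finQ c m x : ℝ) : ℂ) with hq'
  set P := pertMat c m x with hP
  have e0 : ∀ j, (((-(B ℝ * (P * Matrix.diagonal m - potential (finP c m) (finQ c m) x * P))) 0 j : ℝ) : ℂ)
      = -(P 1 j * m j - (q * P 0 j - p * P 1 j)) := by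
    intro j
    simp [B_mul_apply_zero, potential_mul_apply_one, Matrix.mul_diagonal, hp', hq']
  have e1 : ∀ j, (((-(B ℝ * (P * Matrix.diagonal m - potential (finP c m) (finQ c m) x * P))) 1 j : ℝ) : ℂ)
      = P 0 j * m j - (p * P 0 j + q * P 1 j) := by
    intro j
    simp [B_mul_apply_one, potential_mul_apply_zero, Matrix.mul_diagonal, hp', hq']
  set J : Fin 2 → ℂ := fun i => ∑ j, (c j * P i j : ℝ) * cosInt (z - m j) x with hJ
  -- The sums weighted by `m j` are expressed through `z`: the difference `(z - m j) * cosInt (z - m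
  -- j) x` is a sine, whose expansion produces entries of the diagonal value.
  have hmJ : ∀ i, ∑ j, (c j * P i j : ℝ) * (m j * cosInt (z - m j) x)
      = z * J i - S * (finDiag c m x i 1 : ℝ) - C * (finDiag c m x i 0 : ℝ) := by
    intro i
    rw [hK, hK, hJ, Finset.mul_sum]
    simp only [mul_neg, sub_neg_eq_add, Finset.mul_sum, ← Finset.sum_add_distrib]
    refine Finset.sum_congr rfl fun j _ => ?_
    have := hs j
    simp only [freeSolReal, Matrix.cons_val_zero, Matrix.cons_val_one]
    push_cast
    linear_combination (-(c j * P i j : ℂ)) * this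
  have hcJ : ∀ i, ∑ j, (c j * P i j : ℝ) * Complex.cos ((z - m j) * x)
      = -(S * (finDiag c m x i 0 : ℝ)) + C * (finDiag c m x i 1 : ℝ) := by
    intro i
    rw [hK, hK]
    simp only [mul_neg, neg_neg, Finset.mul_sum, ← Finset.sum_neg_distrib, ← Finset.sum_add_distrib]
    refine Finset.sum_congr rfl fun j _ => ?_
    rw [hc j]
    simp only [freeSolReal, Matrix.cons_val_zero, Matrix.cons_val_one]
    push_cast
    ring
  fin_cases i
  · simp only [Fin.zero_eta, Fin.isValue, Matrix.cons_val_zero]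
    rw [hphi0, hphi1]
    have h3 : ∑ j, (((c j * (-(B ℝ * (P * Matrix.diagonal m
        - potential (finP c m) (finQ c m) x * P))) 0 j : ℝ) : ℂ) * cosInt (z - m j) x
        + ((c j * P 0 j : ℝ) : ℂ) * Complex.cos ((z - m j) * x))
        = -(∑ j, (c j * P 1 j : ℝ) * (m j * cosInt (z - m j) x)) + q * J 0 - p * J 1
          + ∑ j, (c j * P 0 j : ℝ) * Complex.cos ((z - m j) * x) := by
      simp only [hJ, Finset.mul_sum, ← Finset.sum_neg_distrib, ← Finset.sum_add_distrib,
        ← Finset.sum_sub_distrib]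
      refine Finset.sum_congr rfl fun j _ => ?_
      rw [Complex.ofReal_mul, e0]
      push_cast; ring
    rw [h3, hmJ, hcJ]
    simp only [B_mulVec_zero, freeSol, Pi.neg_apply, Pi.smul_apply, smul_eq_mul,
      Matrix.cons_val_zero, Matrix.cons_val_one, ← hS, ← hC]
    rw [hq, hp]
    simp only [hJ]
    ring
  · simp only [Fin.mk_one, Fin.isValue, Matrix.cons_val_one]
    rw [hphi0, hphi1]
    have h3 : ∑ j, (((c j * (-(B ℝ * (P * Matrix.diagonal m
        - potential (finP c m) (finQ c m) x * P))) 1 j : ℝ) : ℂ) * cosInt (z - m j) x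
        + ((c j * P 1 j : ℝ) : ℂ) * Complex.cos ((z - m j) * x))
        = (∑ j, (c j * P 0 j : ℝ) * (m j * cosInt (z - m j) x)) - p * J 0 - q * J 1
          + ∑ j, (c j * P 1 j : ℝ) * Complex.cos ((z - m j) * x) := by
      simp only [hJ, Finset.mul_sum, ← Finset.sum_add_distrib, ← Finset.sum_sub_distrib]
      refine Finset.sum_congr rfl fun j _ => ?_
      rw [Complex.ofReal_mul, e1]
      push_cast; ring
    rw [h3, hmJ, hcJ]
    simp only [B_mulVec_one, freeSol, Pi.neg_apply, Pi.smul_apply, smul_eq_mul,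
      Matrix.cons_val_zero, ← hS, ← hC]
    rw [hq, hp]
    simp only [hJ]
    ring

end FiniteRank

end DiracInverse
end

noncomputable section

namespace DiracInverse

open scoped InnerProductSpace ENNReal

/-! ### Trigonometric series in `L²(-2π, 2π)` -/

/-- A bound of Bessel type on finite sums makes a series with square summable coefficients satisfy
the Cauchy criterion, without orthogonality of the `w n`. -/
lemma summable_smul_of_bessel {V : Type*} [NormedAddCommGroup V] [NormedSpace ℝ V]
    [CompleteSpace V] {ι : Type*} {w : ι → V} {C : ℝ}
    (hw : ∀ (T : Finset ι) (u : ι → ℝ), ‖∑ n ∈ T, u n • w n‖ ^ 2 ≤ C * ∑ n ∈ T, u n ^ 2)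
    {u : ι → ℝ} (hu : Summable fun n => u n ^ 2) : Summable fun n => u n • w n := by
  rw [summable_iff_vanishing_norm] at hu ⊢
  intro ε hε
  obtain ⟨s, hs⟩ := hu (ε ^ 2 / (|C| + 1)) (by positivity)
  refine ⟨s, fun t ht => ?_⟩
  have h1 := hs t ht
  have h0 : 0 ≤ ∑ n ∈ t, u n ^ 2 := Finset.sum_nonneg fun n _ => sq_nonneg _
  rw [Real.norm_of_nonneg h0, lt_div_iff₀ (by positivity)] at h1
  refine lt_of_pow_lt_pow_left₀ 2 hε.le ((hw t u).trans_lt ?_)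
  nlinarith [le_abs_self C]

/-- The Lebesgue measure on `(-2π, 2π)`. -/
abbrev volTwoPi : Measure ℝ := volume.restrict (Ioo (-(2 * Real.pi)) (2 * Real.pi))

lemma memLp_volTwoPi {f : ℝ → ℝ} (hf : Continuous f) : MemLp f 2 volTwoPi := by
  obtain ⟨C, hC⟩ := isCompact_Icc.exists_bound_of_continuousOn
    (s := Icc (-(2 * Real.pi)) (2 * Real.pi)) hf.continuousOn
  refine MemLp.of_bound hf.aestronglyMeasurable C ?_
  filter_upwards [ae_restrict_mem measurableSet_Ioo] with t ht
  exact hC t ⟨ht.1.le, ht.2.le⟩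

/-- Continuous functions as elements of `L²(-2π, 2π)`. -/
def contToLp : C(ℝ, ℝ) →ₗ[ℝ] Lp ℝ 2 volTwoPi where
  toFun f := (memLp_volTwoPi f.continuous).toLp _
  map_add' _ _ := rfl
  map_smul' _ _ := rfl

lemma inner_contToLp (f g : C(ℝ, ℝ)) :
    ⟪contToLp f, contToLp g⟫_ℝ = ∫ s, f s * g s ∂volTwoPi := by
  rw [L2.inner_def]
  refine integral_congr_ae ?_
  filter_upwards [(memLp_volTwoPi f.continuous).coeFn_toLp,
    (memLp_volTwoPi g.continuous).coeFn_toLp] with t h1 h2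
  change ⟪((memLp_volTwoPi f.continuous).toLp _ : ℝ → ℝ) t,
    ((memLp_volTwoPi g.continuous).toLp _ : ℝ → ℝ) t⟫_ℝ = _
  rw [h1, h2, RCLike.inner_apply, conj_trivial, mul_comm]

lemma norm_contToLp_le (f g : C(ℝ, ℝ)) {C : ℝ}
    (h : ∀ s ∈ Ioo (-(2 * Real.pi)) (2 * Real.pi), |f s| ≤ C * |g s|) :
    ‖contToLp f‖ ≤ C * ‖contToLp g‖ := by
  refine Lp.norm_le_mul_norm_of_ae_le_mul ?_
  filter_upwards [(memLp_volTwoPi f.continuous).coeFn_toLp,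
    (memLp_volTwoPi g.continuous).coeFn_toLp, ae_restrict_mem measurableSet_Ioo] with t h1 h2 ht
  change ‖((memLp_volTwoPi f.continuous).toLp _ : ℝ → ℝ) t‖
    ≤ C * ‖((memLp_volTwoPi g.continuous).toLp _ : ℝ → ℝ) t‖
  rw [h1, h2]
  exact h t ht

/-- The function `sin (l s + θ)`. -/
def sinFun (θ l : ℝ) : C(ℝ, ℝ) := ⟨fun s => Real.sin (l * s + θ), by fun_prop⟩

lemma integral_cos_int (k : ℤ) :
    ∫ s, Real.cos (k * s) ∂volTwoPi = if k = 0 then 4 * Real.pi else 0 := by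
  have hpi := Real.pi_pos
  rw [← integral_Ioc_eq_integral_Ioo, ← intervalIntegral.integral_of_le (by linarith)]
  split_ifs with hk
  · subst hk; simp; ring
  · have hk' : (k : ℝ) ≠ 0 := by exact_mod_cast hk
    have h : ∀ t ∈ uIcc (-(2 * Real.pi)) (2 * Real.pi),
        HasDerivAt (fun s => Real.sin (k * s) / k) (Real.cos (k * t)) t := by
      intro t _
      have := (((hasDerivAt_id t).const_mul (k : ℝ)).sin).div_const (k : ℝ)
      simpa [hk'] using this
    rw [intervalIntegral.integral_eq_sub_of_hasDerivAt h
      (by fun_prop : Continuous fun t => Real.cos (k * t)).continuousOn.intervalIntegrable]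
    have h1 : Real.sin (k * (2 * Real.pi)) = 0 := by
      have := Real.sin_int_mul_pi (2 * k)
      push_cast at this
      rw [← this]; ring_nf
    rw [mul_neg, Real.sin_neg, h1]; simp

/-- Adding the system shifted by `π/2` turns products of sines into `cos((n - m)s)`, which
integrates to zero over `(-2π, 2π)` unless `n = m`. One phase `θ` alone need not give an orthogonal
system. -/
lemma inner_sinFun_add (θ : ℝ) (n m : ℤ) :
    ⟪contToLp (sinFun θ n), contToLp (sinFun θ m)⟫_ℝ
      + ⟪contToLp (sinFun (θ + Real.pi / 2) n), contToLp (sinFun (θ + Real.pi / 2) m)⟫_ℝ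
      = if n = m then 4 * Real.pi else 0 := by
  have hi : ∀ f g : C(ℝ, ℝ), Integrable (fun s => f s * g s) volTwoPi := fun f g =>
    (memLp_volTwoPi f.continuous).integrable_mul (memLp_volTwoPi g.continuous)
  rw [inner_contToLp, inner_contToLp, ← integral_add (hi _ _) (hi _ _)]
  have h := integral_cos_int (n - m)
  simp only [sub_eq_zero] at h
  rw [← h]
  congr 1; ext s
  simp only [sinFun, ContinuousMap.coe_mk]
  rw [← add_assoc, ← add_assoc, Real.sin_add_pi_div_two, Real.sin_add_pi_div_two]
  have : ((n - m : ℤ) : ℝ) * s = (n * s + θ) - (m * s + θ) := by push_cast; ring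
  rw [this, Real.cos_sub]; ring

/-- Together with the system shifted by `π/2` there is equality, with the length `4π` of the
interval as constant; the shifted square is then dropped. -/
lemma bessel_sinFun (θ : ℝ) (T : Finset ℤ) (u : ℤ → ℝ) :
    ‖∑ n ∈ T, u n • contToLp (sinFun θ n)‖ ^ 2 ≤ 4 * Real.pi * ∑ n ∈ T, u n ^ 2 := by
  have h1 : ∀ ψ : ℝ, ‖∑ n ∈ T, u n • contToLp (sinFun ψ n)‖ ^ 2
      = ∑ n ∈ T, ∑ m ∈ T, u n * u m * ⟪contToLp (sinFun ψ n), contToLp (sinFun ψ m)⟫_ℝ := by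
    intro ψ
    rw [← real_inner_self_eq_norm_sq, sum_inner]
    refine Finset.sum_congr rfl fun n _ => ?_
    rw [inner_sum]
    refine Finset.sum_congr rfl fun m _ => ?_
    rw [real_inner_smul_left, real_inner_smul_right]; ring
  have h2 : ‖∑ n ∈ T, u n • contToLp (sinFun θ n)‖ ^ 2
      + ‖∑ n ∈ T, u n • contToLp (sinFun (θ + Real.pi / 2) n)‖ ^ 2
      = 4 * Real.pi * ∑ n ∈ T, u n ^ 2 := by
    rw [h1, h1, ← Finset.sum_add_distrib, Finset.mul_sum]
    refine Finset.sum_congr rfl fun n hn => ?_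
    rw [← Finset.sum_add_distrib]
    simp only [← mul_add, inner_sinFun_add, mul_ite, mul_zero, Finset.sum_ite_eq, if_pos hn]
    ring
  nlinarith [sq_nonneg ‖∑ n ∈ T, u n • contToLp (sinFun (θ + Real.pi / 2) n)‖]

/-- The function `s sin (l s + θ)`. -/
def idMulSinFun (θ l : ℝ) : C(ℝ, ℝ) := ⟨fun s => s * Real.sin (l * s + θ), by fun_prop⟩

lemma bessel_idMulSinFun (θ : ℝ) (T : Finset ℤ) (u : ℤ → ℝ) :
    ‖∑ n ∈ T, u n • contToLp (idMulSinFun θ n)‖ ^ 2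
      ≤ (2 * Real.pi) ^ 2 * (4 * Real.pi) * ∑ n ∈ T, u n ^ 2 := by
  have h1 : ∀ s, (∑ n ∈ T, u n • idMulSinFun θ n) s = s * (∑ n ∈ T, u n • sinFun θ n) s := by
    intro s
    simp only [ContinuousMap.coe_sum, Finset.sum_apply, ContinuousMap.coe_smul, Pi.smul_apply,
      smul_eq_mul, Finset.mul_sum, idMulSinFun, sinFun, ContinuousMap.coe_mk]
    exact Finset.sum_congr rfl fun n _ => by ring
  have h2 := norm_contToLp_le (∑ n ∈ T, u n • idMulSinFun θ n) (∑ n ∈ T, u n • sinFun θ n)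
    (C := 2 * Real.pi) fun s hs => by
      rw [h1, abs_mul]
      exact mul_le_mul_of_nonneg_right (abs_le.2 ⟨hs.1.le, hs.2.le⟩) (abs_nonneg _)
  simp only [map_sum, map_smul] at h2
  calc _ ≤ (2 * Real.pi * ‖∑ n ∈ T, u n • contToLp (sinFun θ n)‖) ^ 2 :=
        pow_le_pow_left₀ (norm_nonneg _) h2 2
    _ = (2 * Real.pi) ^ 2 * ‖∑ n ∈ T, u n • contToLp (sinFun θ n)‖ ^ 2 := by ring
    _ ≤ _ := by
        rw [mul_assoc]
        exact mul_le_mul_of_nonneg_left (bessel_sinFun θ T u) (sq_nonneg _)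

/-! ### Estimates for the terms of the trigonometric series and their summability. -/

lemma abs_sin_add_sub_le (a h : ℝ) : |Real.sin (a + h) - Real.sin a| ≤ 2 * |h| := by
  rw [Real.sin_sub_sin, abs_mul, abs_mul, abs_two]
  have h1 : |Real.sin ((a + h - a) / 2)| ≤ |h| := by
    refine Real.abs_sin_le_abs.trans ?_
    rw [add_sub_cancel_left, abs_div, abs_two]
    linarith [abs_nonneg h]
  nlinarith [Real.abs_cos_le_one ((a + h + a) / 2), abs_nonneg (Real.cos ((a + h + a) / 2)),
    abs_nonneg (Real.sin ((a + h - a) / 2))]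

lemma abs_sin_sub_self_le (h : ℝ) : |Real.sin h - h| ≤ 2 * h ^ 2 := by
  have key : ∀ h : ℝ, 0 < h → |Real.sin h - h| ≤ 2 * h ^ 2 := by
    intro h hh
    have h1 := Real.sin_lt hh
    rw [abs_of_neg (by linarith)]
    rcases le_or_gt h 1 with h2 | h2
    · have := Real.sin_gt_sub_cube hh
      nlinarith [mul_pos hh hh]
    · nlinarith [Real.neg_one_le_sin h]
  rcases lt_trichotomy h 0 with h0 | h0 | h0
  · have := key (-h) (by linarith)
    rw [Real.sin_neg, neg_sq, neg_sub_neg, abs_sub_comm] at this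
    exact this
  · simp [h0]
  · exact key h h0

lemma abs_sin_add_sub_sub_le (a h : ℝ) :
    |Real.sin (a + h) - Real.sin a - h * Real.cos a| ≤ 3 * h ^ 2 := by
  have e : Real.sin (a + h) - Real.sin a - h * Real.cos a
      = Real.sin a * (Real.cos h - 1) + Real.cos a * (Real.sin h - h) := by
    rw [Real.sin_add]; ring
  have h1 : |Real.cos h - 1| ≤ h ^ 2 := by
    rw [abs_sub_comm, abs_of_nonneg (by linarith [Real.cos_le_one h])]
    linarith [Real.one_sub_sq_div_two_le_cos (x := h), sq_nonneg h]
  have h2 : |Real.sin a * (Real.cos h - 1)| ≤ h ^ 2 := by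
    rw [abs_mul]
    exact (mul_le_of_le_one_left (abs_nonneg _) (Real.abs_sin_le_one a)).trans h1
  have h3 : |Real.cos a * (Real.sin h - h)| ≤ 2 * h ^ 2 := by
    rw [abs_mul]
    exact (mul_le_of_le_one_left (abs_nonneg _) (Real.abs_cos_le_one a)).trans (abs_sin_sub_self_le h)
  rw [e]
  refine (abs_add_le _ _).trans ?_
  linarith

/-- All but finitely many `alpha n` are at least `1`, and there `1/α - 1/π = -(α - π)/(απ)` has
denominator at least `1`. -/
lemma summable_sq_inv_sub {alpha : ℤ → ℝ} (hpos : ∀ n, 0 < alpha n)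
    (halpha : Summable fun n : ℤ => (alpha n - Real.pi) ^ 2) :
    Summable fun n => (1 / alpha n - 1 / Real.pi) ^ 2 := by
  have hpi := Real.pi_pos
  have hc : Tendsto (fun n => (alpha n - Real.pi) ^ 2) cofinite (𝓝 0) :=
    halpha.tendsto_cofinite_zero
  have hev : ∀ᶠ n in cofinite, (alpha n - Real.pi) ^ 2 < 1 := hc.eventually (gt_mem_nhds one_pos)
  refine Summable.of_norm_bounded_eventually (g := fun n => (alpha n - Real.pi) ^ 2) halpha ?_
  filter_upwards [hev] with n hn
  have h1 : 1 ≤ alpha n := by nlinarith [Real.pi_gt_three]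
  rw [Real.norm_of_nonneg (sq_nonneg _)]
  have e : 1 / alpha n - 1 / Real.pi = (alpha n - Real.pi) * (-(1 / (alpha n * Real.pi))) := by
    have := (hpos n).ne'
    field_simp; ring
  rw [e, mul_pow, neg_sq]
  refine mul_le_of_le_one_right (sq_nonneg _) (pow_le_one₀ (by have := hpos n; positivity) ?_)
  rw [div_le_one (by have := hpos n; positivity)]
  nlinarith [Real.pi_gt_three]

/-- The terms of the trigonometric series defining the kernel. -/
def trigTerm (θ : ℝ) (lam alpha : ℤ → ℝ) (n : ℤ) : C(ℝ, ℝ) :=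
  (1 / alpha n) • sinFun θ (lam n) - (1 / Real.pi) • sinFun θ n

/-- With `ε = λₙ - n` and `β = 1/αₙ - 1/π`, the term is `β sin(ns + θ) + (ε/π) s cos(ns + θ)` plus a
remainder. The linear parts have square summable coefficients and converge by Bessel's inequality;
the remainder is `O(β² + ε²)` and converges absolutely. -/
lemma summable_trigTerm (θ : ℝ) {lam alpha : ℤ → ℝ}
    (hlam : Summable fun n : ℤ => (lam n - n) ^ 2)
    (halpha : Summable fun n : ℤ => (alpha n - Real.pi) ^ 2) (hpos : ∀ n, 0 < alpha n) :
    Summable fun n => contToLp (trigTerm θ lam alpha n) := by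
  have hpi := Real.pi_pos
  have hb := summable_sq_inv_sub hpos halpha
  have h1 := summable_smul_of_bessel (bessel_sinFun θ) hb
  have h2 := summable_smul_of_bessel (bessel_idMulSinFun (θ + Real.pi / 2))
    (u := fun n => (1 / Real.pi) * (lam n - n)) (by
      simp only [mul_pow]; exact hlam.mul_left _)
  set one : C(ℝ, ℝ) := ContinuousMap.const ℝ 1
  set r : ℤ → C(ℝ, ℝ) := fun n => trigTerm θ lam alpha n
    - ((1 / alpha n - 1 / Real.pi) • sinFun θ n
      + ((1 / Real.pi) * (lam n - n)) • idMulSinFun (θ + Real.pi / 2) n) with hr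
  have h3 : Summable fun n => contToLp (r n) := by
    refine Summable.of_norm_bounded (g := fun n => (4 * Real.pi * ((1 / alpha n - 1 / Real.pi) ^ 2
      + (lam n - n) ^ 2) + (1 / Real.pi) * (3 * (2 * Real.pi) ^ 2) * (lam n - n) ^ 2)
        * ‖contToLp one‖)
      ((((hb.add hlam).mul_left _).add (hlam.mul_left _)).mul_right _) fun n => ?_
    refine norm_contToLp_le _ _ fun s hs => ?_
    set β := 1 / alpha n - 1 / Real.pi with hβ
    set ε := lam n - n with hε
    -- The first summand is a product of two small quantities, the second a Taylor remainder of
    -- order two.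
    have e1 : r n s = β * (Real.sin ((n * s + θ) + ε * s) - Real.sin (n * s + θ))
        + (1 / Real.pi) * (Real.sin ((n * s + θ) + ε * s) - Real.sin (n * s + θ)
          - (ε * s) * Real.cos (n * s + θ)) := by
      have e2 : lam n * s + θ = (n * s + θ) + ε * s := by rw [hε]; ring
      simp only [hr, trigTerm, sinFun, idMulSinFun, ContinuousMap.sub_apply, ContinuousMap.add_apply,
        ContinuousMap.smul_apply, ContinuousMap.coe_mk, smul_eq_mul]
      rw [e2, ← add_assoc (n * s : ℝ), Real.sin_add_pi_div_two, hβ]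
      ring
    have hs' : |s| ≤ 2 * Real.pi := abs_le.2 ⟨hs.1.le, hs.2.le⟩
    have e3 : |β * (Real.sin ((n * s + θ) + ε * s) - Real.sin (n * s + θ))|
        ≤ 4 * Real.pi * (β ^ 2 + ε ^ 2) := by
      rw [abs_mul]
      have h4 := abs_sin_add_sub_le (n * s + θ) (ε * s)
      rw [abs_mul] at h4
      have h5 : 2 * (|ε| * |s|) ≤ 4 * Real.pi * |ε| := by nlinarith [abs_nonneg ε]
      have h6 := mul_le_mul_of_nonneg_left (h4.trans h5) (abs_nonneg β)
      have h7 : |β| * |ε| ≤ β ^ 2 + ε ^ 2 := by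
        nlinarith [sq_abs β, sq_abs ε, sq_nonneg (|β| - |ε|), sq_nonneg β, sq_nonneg ε]
      calc _ ≤ |β| * (4 * Real.pi * |ε|) := h6
        _ = 4 * Real.pi * (|β| * |ε|) := by ring
        _ ≤ _ := mul_le_mul_of_nonneg_left h7 (by positivity)
    have e4 : |(1 / Real.pi) * (Real.sin ((n * s + θ) + ε * s) - Real.sin (n * s + θ)
          - (ε * s) * Real.cos (n * s + θ))| ≤ (1 / Real.pi) * (3 * (2 * Real.pi) ^ 2) * ε ^ 2 := by
      rw [abs_mul, abs_of_pos (by positivity : (0 : ℝ) < 1 / Real.pi), mul_assoc (1 / Real.pi)]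
      refine mul_le_mul_of_nonneg_left ((abs_sin_add_sub_sub_le _ _).trans ?_) (by positivity)
      have : s ^ 2 ≤ (2 * Real.pi) ^ 2 := by rw [← sq_abs s]; exact pow_le_pow_left₀ (abs_nonneg _) hs' 2
      rw [mul_pow]
      nlinarith [sq_nonneg ε]
    have e5 : |one s| = 1 := by simp [one]
    rw [e5, mul_one, e1]
    exact (abs_add_le _ _).trans (add_le_add e3 e4)
  have h4 := (h1.add h2).add h3
  convert h4 using 1
  ext1 n
  rw [← map_smul, ← map_smul, ← map_add, ← map_add]
  exact congrArg contToLp (add_sub_cancel _ _).symm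

lemma tendsto_Icc_neg_atTop :
    Tendsto (fun N : ℕ => Finset.Icc (-(N : ℤ)) N) atTop atTop := by
  refine tendsto_atTop.2 fun S => ?_
  filter_upwards [eventually_ge_atTop (S.sup Int.natAbs)] with N hN
  intro n hn
  have h1 : n.natAbs ≤ N := (Finset.le_sup (f := Int.natAbs) hn).trans hN
  rw [Finset.mem_Icc]
  omega

/-- Symmetric partial sums of the trigonometric series defining the kernel. -/
def trigSum (θ : ℝ) (lam alpha : ℤ → ℝ) (N : ℕ) (s : ℝ) : ℝ :=
  ∑ n ∈ Finset.Icc (-(N : ℤ)) N,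
    ((1 / alpha n) * Real.sin (lam n * s + θ) - (1 / Real.pi) * Real.sin (n * s + θ))

@[fun_prop]
lemma continuous_trigSum (θ : ℝ) (lam alpha : ℤ → ℝ) (N : ℕ) :
    Continuous (trigSum θ lam alpha N) := by
  unfold trigSum; fun_prop

lemma exists_trigSum_limit (θ : ℝ) {lam alpha : ℤ → ℝ}
    (hlam : Summable fun n : ℤ => (lam n - n) ^ 2)
    (halpha : Summable fun n : ℤ => (alpha n - Real.pi) ^ 2) (hpos : ∀ n, 0 < alpha n) :
    ∃ c : ℝ → ℝ, Measurable c ∧ MemLp c 2 volTwoPi ∧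
      Tendsto (fun N => eLpNorm (fun s => trigSum θ lam alpha N s - c s) 2 volTwoPi) atTop
        (𝓝 0) := by
  obtain ⟨S, hS⟩ := summable_trigTerm θ hlam halpha hpos
  refine ⟨S, (Lp.stronglyMeasurable S).measurable, Lp.memLp S, ?_⟩
  have h1 : Tendsto (fun N : ℕ => ∑ n ∈ Finset.Icc (-(N : ℤ)) N, contToLp (trigTerm θ lam alpha n))
      atTop (𝓝 S) := hS.comp tendsto_Icc_neg_atTop
  rw [tendsto_iff_edist_tendsto_0] at h1
  refine h1.congr fun N => ?_
  rw [← map_sum, Lp.edist_def]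
  refine eLpNorm_congr_ae ?_
  have h2 := (memLp_volTwoPi (∑ n ∈ Finset.Icc (-(N : ℤ)) N,
    trigTerm θ lam alpha n).continuous).coeFn_toLp
  filter_upwards [h2] with s hs
  rw [Pi.sub_apply]
  congr 1
  refine hs.trans ?_
  simp [ContinuousMap.coe_sum, trigSum, trigTerm, sinFun]

/-- The limit of the trigonometric series can be chosen with the parity of the partial sums. -/
lemma exists_trigSum_limit_parity (θ : ℝ) {lam alpha : ℤ → ℝ}
    (hlam : Summable fun n : ℤ => (lam n - n) ^ 2)
    (halpha : Summable fun n : ℤ => (alpha n - Real.pi) ^ 2) (hpos : ∀ n, 0 < alpha n) {σ : ℝ}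
    (hσ : σ * σ = 1) (hpar : ∀ N s, trigSum θ lam alpha N (-s) = σ * trigSum θ lam alpha N s) :
    ∃ c : ℝ → ℝ, Measurable c ∧ MemLp c 2 volTwoPi ∧ (∀ s, c (-s) = σ * c s) ∧
      Tendsto (fun N => eLpNorm (fun s => trigSum θ lam alpha N s - c s) 2 volTwoPi) atTop
        (𝓝 0) := by
  obtain ⟨c, hc, hcL, hlim⟩ := exists_trigSum_limit θ hlam halpha hpos
  have hmp : MeasurePreserving (fun s : ℝ => -s) volTwoPi volTwoPi := by
    have h := (Measure.measurePreserving_neg (volume : Measure ℝ)).restrict_preimage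
      (measurableSet_Ioo (a := -(2 * Real.pi)) (b := 2 * Real.pi))
    have e : (Neg.neg ⁻¹' Ioo (-(2 * Real.pi)) (2 * Real.pi) : Set ℝ)
        = Ioo (-(2 * Real.pi)) (2 * Real.pi) := by
      ext s
      simp only [mem_Ioo, mem_preimage]
      constructor <;> rintro ⟨h1, h2⟩ <;> constructor <;> linarith
    rw [e] at h
    exact h
  have hσ1 : ‖σ‖ₑ = 1 := by
    rcases mul_self_eq_one_iff.1 hσ with h | h <;> simp [h]
  -- Symmetrising a limit enforces the parity at every point; as the partial sums already have it,
  -- their distance to the limit does not grow.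
  refine ⟨fun s => (1 / 2) * (c s + σ * c (-s)), by fun_prop,
    (hcL.add ((hcL.comp_measurePreserving hmp).const_mul σ)).const_mul _, fun s => ?_, ?_⟩
  · simp only [neg_neg]
    linear_combination (-(1 / 2) * c (-s)) * hσ
  · refine tendsto_of_tendsto_of_tendsto_of_le_of_le tendsto_const_nhds hlim (fun _ => zero_le)
      fun N => ?_
    set g : ℝ → ℝ := fun s => trigSum θ lam alpha N s - c s with hg
    have hgm : Measurable g := ((continuous_trigSum θ lam alpha N).measurable).sub hc
    have e : (fun s => trigSum θ lam alpha N s - (1 / 2) * (c s + σ * c (-s)))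
        = (1 / 2 : ℝ) • (g + σ • (g ∘ fun s => -s)) := by
      ext s
      simp only [hg, Pi.smul_apply, Pi.add_apply, Function.comp_apply, smul_eq_mul, hpar]
      linear_combination (-(1 / 2) * trigSum θ lam alpha N s) * hσ
    rw [e, eLpNorm_const_smul]
    have h1 := eLpNorm_add_le (p := 2) (μ := volTwoPi) hgm.aestronglyMeasurable
      ((hgm.comp measurable_neg).const_smul σ).aestronglyMeasurable (by norm_num)
    rw [eLpNorm_const_smul, hσ1, one_mul,
      eLpNorm_comp_measurePreserving hgm.aestronglyMeasurable hmp] at h1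
    refine (mul_le_mul_right h1 _).trans ?_
    rw [← two_mul, ← mul_assoc]
    have : ‖(1 / 2 : ℝ)‖ₑ * 2 = 1 := by
      rw [Real.enorm_eq_ofReal (by norm_num), ENNReal.ofReal_div_of_pos (by norm_num)]
      simp [ENNReal.inv_mul_cancel]
    rw [this, one_mul]

end DiracInverse
end

noncomputable section

namespace DiracInverse

open scoped InnerProductSpace ENNReal

/-! ### The kernel of the main equation -/

/-- The kernel built from an even function `c` and an odd function `d`. -/
def kernelMat (c d : ℝ → ℝ) (x t : ℝ) : Matrix (Fin 2) (Fin 2) ℝ :=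
  !![(c (x - t) - c (x + t)) / 2, (-d (x - t) - d (x + t)) / 2;
    (d (x - t) - d (x + t)) / 2, (c (x - t) + c (x + t)) / 2]

/-- The functions `c` and `d` are the sums of the trigonometric series defining the kernel. -/
structure IsKernelPair (lam alpha : ℤ → ℝ) (c d : ℝ → ℝ) : Prop where
  measurable_even : Measurable c
  measurable_odd : Measurable d
  memLp_even : MemLp c 2 volTwoPi
  memLp_odd : MemLp d 2 volTwoPi
  even : ∀ s, c (-s) = c s
  odd : ∀ s, d (-s) = -d s
  tendsto_even : Tendsto (fun N => eLpNorm
    (fun s => trigSum (Real.pi / 2) lam alpha N s - c s) 2 volTwoPi) atTop (𝓝 0)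
  tendsto_odd : Tendsto (fun N => eLpNorm
    (fun s => trigSum 0 lam alpha N s - d s) 2 volTwoPi) atTop (𝓝 0)

lemma exists_isKernelPair {lam alpha : ℤ → ℝ}
    (hlam : Summable fun n : ℤ => (lam n - n) ^ 2)
    (halpha : Summable fun n : ℤ => (alpha n - Real.pi) ^ 2) (hpos : ∀ n, 0 < alpha n) :
    ∃ c d, IsKernelPair lam alpha c d := by
  obtain ⟨c, h1, h2, h3, h4⟩ := exists_trigSum_limit_parity (Real.pi / 2) hlam halpha hpos
    (σ := 1) (by norm_num) fun N s => by
      simp [trigSum, Real.sin_add_pi_div_two]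
  obtain ⟨d, h5, h6, h7, h8⟩ := exists_trigSum_limit_parity 0 hlam halpha hpos
    (σ := -1) (by norm_num) fun N s => by
      simp only [trigSum, add_zero, mul_neg, Real.sin_neg, neg_mul, one_mul,
        ← Finset.sum_neg_distrib]
      exact Finset.sum_congr rfl fun n _ => by ring
  exact ⟨c, d, h1, h5, h2, h6, fun s => by simpa using h3 s, fun s => by simpa using h7 s, h4, h8⟩

lemma kernelMat_symm {c d : ℝ → ℝ} (hc : ∀ s, c (-s) = c s) (hd : ∀ s, d (-s) = -d s) (x t : ℝ)
    (i j : Fin 2) : kernelMat c d x t i j = kernelMat c d t x j i := by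
  have h1 : c (x - t) = c (t - x) := by rw [← hc, neg_sub]
  have h2 : d (x - t) = -d (t - x) := by rw [← hd, neg_sub]
  fin_cases i <;> fin_cases j <;> simp [kernelMat, h1, h2, add_comm x t]

/-- By the product formulas for sine and cosine, every entry depends on `x` and `t` only through
functions of `x - t` and `x + t`. -/
lemma kernelPartialSum_eq (lam alpha : ℤ → ℝ) (N : ℕ) (x t : ℝ) :
    kernelPartialSum lam alpha N x t
      = kernelMat (trigSum (Real.pi / 2) lam alpha N) (trigSum 0 lam alpha N) x t := by
  have key : ∀ l : ℝ, Matrix.vecMulVec (freeSolReal x l) (freeSolReal t l)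
      = kernelMat (fun s => Real.sin (l * s + Real.pi / 2)) (fun s => Real.sin (l * s + 0)) x t := by
    intro l
    ext i j
    fin_cases i <;> fin_cases j <;>
      simp [kernelMat, freeSolReal, Matrix.vecMulVec_apply, mul_sub, mul_add,
        Real.cos_sub, Real.cos_add, Real.sin_sub, Real.sin_add] <;> ring
  ext i j
  simp only [kernelPartialSum, Matrix.sum_apply, Matrix.sub_apply, Matrix.smul_apply, key,
    smul_eq_mul]
  fin_cases i <;> fin_cases j <;>
    simp only [Fin.zero_eta, Fin.mk_one, kernelMat, trigSum, Matrix.of_apply, Matrix.cons_val',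
      Matrix.cons_val_zero, Matrix.cons_val_one, Matrix.cons_val_fin_one,
      ← Finset.sum_add_distrib, ← Finset.sum_sub_distrib, ← Finset.sum_neg_distrib,
      Finset.sum_div] <;>
    exact Finset.sum_congr rfl fun n _ => by ring

lemma measurePreserving_add_volPi (x : ℝ) : MeasurePreserving (fun t => x + t) volPi
    (volume.restrict (Ioo x (x + Real.pi))) := by
  have h := (measurePreserving_add_left (volume : Measure ℝ) x).restrict_preimage
    (measurableSet_Ioo (a := x) (b := x + Real.pi))
  have e : ((fun t => x + t) ⁻¹' Ioo x (x + Real.pi) : Set ℝ) = Ioo 0 Real.pi := by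
    ext t; simp
  rwa [e] at h

lemma measurePreserving_sub_volPi (x : ℝ) : MeasurePreserving (fun t => x - t) volPi
    (volume.restrict (Ioo (x - Real.pi) x)) := by
  have h := (Measure.measurePreserving_sub_left (volume : Measure ℝ) x).restrict_preimage
    (measurableSet_Ioo (a := x - Real.pi) (b := x))
  have e : ((fun t => x - t) ⁻¹' Ioo (x - Real.pi) x : Set ℝ) = Ioo 0 Real.pi := by
    ext t
    simp only [mem_preimage, mem_Ioo]
    constructor <;> rintro ⟨h1, h2⟩ <;> constructor <;> linarith
  rwa [e] at h

/-- For `x` and `t` in `[0, π]` the arguments `x ± t` stay in `[-2π, 2π]`, which explains the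
interval on which the series are studied. -/
lemma restrict_add_le_volTwoPi {x : ℝ} (hx : x ∈ Icc 0 Real.pi) :
    volume.restrict (Ioo x (x + Real.pi)) ≤ volTwoPi :=
  Measure.restrict_mono (Ioo_subset_Ioo (by linarith [hx.1, Real.pi_pos]) (by linarith [hx.2])) le_rfl

lemma restrict_sub_le_volTwoPi {x : ℝ} (hx : x ∈ Icc 0 Real.pi) :
    volume.restrict (Ioo (x - Real.pi) x) ≤ volTwoPi :=
  Measure.restrict_mono (Ioo_subset_Ioo (by linarith [hx.1, Real.pi_pos])
    (by linarith [hx.2, Real.pi_pos])) le_rfl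

lemma memLp_comp_add {f : ℝ → ℝ} (hf : MemLp f 2 volTwoPi) {x : ℝ} (hx : x ∈ Icc 0 Real.pi) :
    MemLp (fun t => f (x + t)) 2 volPi :=
  (hf.mono_measure (restrict_add_le_volTwoPi hx)).comp_measurePreserving
    (measurePreserving_add_volPi x)

lemma memLp_comp_sub {f : ℝ → ℝ} (hf : MemLp f 2 volTwoPi) {x : ℝ} (hx : x ∈ Icc 0 Real.pi) :
    MemLp (fun t => f (x - t)) 2 volPi :=
  (hf.mono_measure (restrict_sub_le_volTwoPi hx)).comp_measurePreserving
    (measurePreserving_sub_volPi x)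

lemma eLpNorm_comp_add_le {f : ℝ → ℝ} (hf : Measurable f) {x : ℝ} (hx : x ∈ Icc 0 Real.pi) :
    eLpNorm (fun t => f (x + t)) 2 volPi ≤ eLpNorm f 2 volTwoPi := by
  have h := eLpNorm_comp_measurePreserving (p := 2) hf.aestronglyMeasurable
    (measurePreserving_add_volPi x)
  exact h.le.trans (eLpNorm_mono_measure _ (restrict_add_le_volTwoPi hx))

lemma eLpNorm_comp_sub_le {f : ℝ → ℝ} (hf : Measurable f) {x : ℝ} (hx : x ∈ Icc 0 Real.pi) :
    eLpNorm (fun t => f (x - t)) 2 volPi ≤ eLpNorm f 2 volTwoPi := by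
  have h := eLpNorm_comp_measurePreserving (p := 2) hf.aestronglyMeasurable
    (measurePreserving_sub_volPi x)
  exact h.le.trans (eLpNorm_mono_measure _ (restrict_sub_le_volTwoPi hx))

lemma memLp_kernelMat {c d : ℝ → ℝ} (hc : MemLp c 2 volTwoPi) (hd : MemLp d 2 volTwoPi) {x : ℝ}
    (hx : x ∈ Icc 0 Real.pi) (i j : Fin 2) : MemLp (fun t => kernelMat c d x t i j) 2 volPi := by
  have h1 := memLp_comp_add hc hx
  have h2 := memLp_comp_sub hc hx
  have h3 := memLp_comp_add hd hx
  have h4 := memLp_comp_sub hd hx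
  have half : ∀ {f : ℝ → ℝ}, MemLp f 2 volPi → MemLp (fun t => f t / 2) 2 volPi := fun {f} hf => by
    simpa only [div_eq_inv_mul] using hf.const_mul 2⁻¹
  fin_cases i <;> fin_cases j
  · exact half (h2.sub h1)
  · exact half (h4.neg.sub h3)
  · exact half (h4.sub h3)
  · exact half (h2.add h1)

lemma eLpNorm_half_le {f g : ℝ → ℝ} (hf : Measurable f) (hg : Measurable g) {x : ℝ}
    (hx : x ∈ Icc 0 Real.pi) {σ τ : ℝ} (hσ : |σ| = 1) (hτ : |τ| = 1) :
    eLpNorm (fun t => (σ * f (x - t) + τ * g (x + t)) / 2) 2 volPi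
      ≤ eLpNorm f 2 volTwoPi + eLpNorm g 2 volTwoPi := by
  have e : (fun t => (σ * f (x - t) + τ * g (x + t)) / 2)
      = (fun t => (σ / 2) * f (x - t)) + fun t => (τ / 2) * g (x + t) := by
    ext t; simp only [Pi.add_apply]; ring
  have bound : ∀ {h : ℝ → ℝ} {r : ℝ}, |r| = 1 →
      eLpNorm (fun t => (r / 2) * h t) 2 volPi ≤ eLpNorm h 2 volPi := by
    intro h r hr
    refine eLpNorm_mono fun t => ?_
    rw [norm_mul, Real.norm_eq_abs, abs_div, hr, abs_two]
    linarith [norm_nonneg (h t)]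
  rw [e]
  refine (eLpNorm_add_le
    ((hf.comp (measurable_const.sub measurable_id)).const_mul _).aestronglyMeasurable
    ((hg.comp (measurable_const.add measurable_id)).const_mul _).aestronglyMeasurable
    (by norm_num)).trans (add_le_add ?_ ?_)
  · exact (bound hσ).trans (eLpNorm_comp_sub_le hf hx)
  · exact (bound hτ).trans (eLpNorm_comp_add_le hg hx)

/-- The distance of the partial sums of the kernel from the kernel. -/
def kernelError (lam alpha : ℤ → ℝ) (c d : ℝ → ℝ) (N : ℕ) : ℝ≥0∞ :=
  2 * (eLpNorm (fun s => trigSum (Real.pi / 2) lam alpha N s - c s) 2 volTwoPi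
    + eLpNorm (fun s => trigSum 0 lam alpha N s - d s) 2 volTwoPi)

section Pair

variable {lam alpha : ℤ → ℝ} {c d : ℝ → ℝ}

lemma IsKernelPair.tendsto_kernelError (h : IsKernelPair lam alpha c d) :
    Tendsto (kernelError lam alpha c d) atTop (𝓝 0) := by
  have := ENNReal.Tendsto.const_mul (a := 2) (h.tendsto_even.add h.tendsto_odd) (by simp)
  rw [add_zero, mul_zero] at this
  exact this

lemma IsKernelPair.kernelError_ne_top (h : IsKernelPair lam alpha c d) (N : ℕ) :
    kernelError lam alpha c d N ≠ ∞ := by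
  refine ENNReal.mul_ne_top (by simp) (ENNReal.add_ne_top.2 ⟨?_, ?_⟩)
  · exact ((memLp_volTwoPi (continuous_trigSum _ lam alpha N)).sub h.memLp_even).2.ne
  · exact ((memLp_volTwoPi (continuous_trigSum _ lam alpha N)).sub h.memLp_odd).2.ne

/-- The bound does not depend on `x`, since translation and reflection preserve Lebesgue measure.
All later uniformity in `x` rests on this. -/
lemma IsKernelPair.eLpNorm_sub_le (h : IsKernelPair lam alpha c d) (N : ℕ) {x : ℝ}
    (hx : x ∈ Icc 0 Real.pi) (i j : Fin 2) :
    eLpNorm (fun t => kernelPartialSum lam alpha N x t i j - kernelMat c d x t i j) 2 volPi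
      ≤ kernelError lam alpha c d N := by
  have hcm : Measurable fun s => trigSum (Real.pi / 2) lam alpha N s - c s :=
    (continuous_trigSum _ _ _ _).measurable.sub h.measurable_even
  have hdm : Measurable fun s => trigSum 0 lam alpha N s - d s :=
    (continuous_trigSum _ _ _ _).measurable.sub h.measurable_odd
  have h1 : |(1 : ℝ)| = 1 := abs_one
  have h2 : |(-1 : ℝ)| = 1 := by simp
  unfold kernelError
  rw [two_mul]
  simp only [kernelPartialSum_eq]
  fin_cases i <;> fin_cases j
  · refine le_trans (le_of_eq ?_) ((eLpNorm_half_le hcm hcm hx h1 h2).trans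
      (add_le_add le_self_add le_self_add))
    congr 1; ext t; simp [kernelMat]; ring
  · refine le_trans (le_of_eq ?_) ((eLpNorm_half_le hdm hdm hx h2 h2).trans
      (add_le_add le_add_self le_add_self))
    congr 1; ext t; simp [kernelMat]; ring
  · refine le_trans (le_of_eq ?_) ((eLpNorm_half_le hdm hdm hx h1 h2).trans
      (add_le_add le_add_self le_add_self))
    congr 1; ext t; simp [kernelMat]; ring
  · refine le_trans (le_of_eq ?_) ((eLpNorm_half_le hcm hcm hx h1 h1).trans
      (add_le_add le_self_add le_self_add))
    congr 1; ext t; simp [kernelMat]; ring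

lemma measurable_kernelMat (hc : Measurable c) (hd : Measurable d) (i j : Fin 2) :
    Measurable fun z : ℝ × ℝ => kernelMat c d z.1 z.2 i j := by
  have h1 : Measurable fun z : ℝ × ℝ => c (z.1 - z.2) := hc.comp (measurable_fst.sub measurable_snd)
  have h2 : Measurable fun z : ℝ × ℝ => c (z.1 + z.2) := hc.comp (measurable_fst.add measurable_snd)
  have h3 : Measurable fun z : ℝ × ℝ => d (z.1 - z.2) := hd.comp (measurable_fst.sub measurable_snd)
  have h4 : Measurable fun z : ℝ × ℝ => d (z.1 + z.2) := hd.comp (measurable_fst.add measurable_snd)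
  fin_cases i <;> fin_cases j
  · exact (h1.sub h2).div_const 2
  · exact (h3.neg.sub h4).div_const 2
  · exact (h3.sub h4).div_const 2
  · exact (h1.add h2).div_const 2

lemma IsKernelPair.isMainKernel (h : IsKernelPair lam alpha c d) :
    IsMainKernel lam alpha (kernelMat c d) :=
  ⟨measurable_kernelMat h.measurable_even h.measurable_odd, fun _ hx i j =>
    tendsto_of_tendsto_of_tendsto_of_le_of_le tendsto_const_nhds h.tendsto_kernelError
      (fun _ => zero_le) fun N => h.eLpNorm_sub_le N hx i j⟩

lemma ae_eq_of_tendsto_eLpNorm {μ : Measure ℝ} {f g : ℝ → ℝ} {k : ℕ → ℝ → ℝ} (hf : Measurable f)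
    (hg : Measurable g) (hk : ∀ N, Measurable (k N))
    (h1 : Tendsto (fun N => eLpNorm (fun t => k N t - f t) 2 μ) atTop (𝓝 0))
    (h2 : Tendsto (fun N => eLpNorm (fun t => k N t - g t) 2 μ) atTop (𝓝 0)) :
    ∀ᵐ t ∂μ, f t = g t := by
  have h5 := h1.add h2
  rw [add_zero] at h5
  have h3 : eLpNorm (fun t => f t - g t) 2 μ ≤ 0 := by
    refine ge_of_tendsto' h5 fun N => ?_
    have e : (fun t => f t - g t) = (fun t => k N t - g t) - fun t => k N t - f t := by
      ext t; simp
    rw [e]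
    refine (eLpNorm_sub_le ((hk N).sub hg).aestronglyMeasurable
      ((hk N).sub hf).aestronglyMeasurable (by norm_num)).trans ?_
    exact (add_comm _ _).le
  have h4 := (eLpNorm_eq_zero_iff (hf.sub hg).aestronglyMeasurable (by norm_num)).1
    (le_antisymm h3 zero_le)
  filter_upwards [h4] with t ht
  simpa [sub_eq_zero] using ht

lemma measurable_kernelMat_right (hc : Measurable c) (hd : Measurable d) (x : ℝ) (i j : Fin 2) :
    Measurable fun t => kernelMat c d x t i j := by
  have h := measurable_kernelMat hc hd i j
  generalize kernelMat c d = k at h ⊢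
  exact Measurable.of_uncurry_left (f := fun x t => k x t i j) h

lemma measurable_kernelPartialSum (N : ℕ) (x : ℝ) (i j : Fin 2) :
    Measurable fun t => kernelPartialSum lam alpha N x t i j := by
  have e : (fun t => kernelPartialSum lam alpha N x t i j)
      = fun t => kernelMat (trigSum (Real.pi / 2) lam alpha N) (trigSum 0 lam alpha N) x t i j :=
    funext fun t => by rw [kernelPartialSum_eq]
  rw [e]
  exact measurable_kernelMat_right (continuous_trigSum _ _ _ _).measurable
    (continuous_trigSum _ _ _ _).measurable x i j

lemma IsKernelPair.ae_eq (h : IsKernelPair lam alpha c d)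
    {F : ℝ → ℝ → Matrix (Fin 2) (Fin 2) ℝ} (hF : IsMainKernel lam alpha F) {x : ℝ}
    (hx : x ∈ Icc 0 Real.pi) (i j : Fin 2) :
    ∀ᵐ t ∂volPi, F x t i j = kernelMat c d x t i j := by
  have hm1 : Measurable fun t => F x t i j :=
    Measurable.of_uncurry_left (f := fun x t => F x t i j) (hF.1 i j)
  exact ae_eq_of_tendsto_eLpNorm hm1
    (measurable_kernelMat_right h.measurable_even h.measurable_odd x i j)
    (fun N => measurable_kernelPartialSum N x i j) (hF.2 x hx i j) (h.isMainKernel.2 x hx i j)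

/-! ### The rows of the kernel as elements of the Hilbert space -/

/-- The factor `2` is a convenient majorant of `√2`, for two components. -/
lemma norm_toVec_le {f : ℝ → Fin 2 → ℝ} (hf : IsL2 f) {e : ℝ≥0∞} (he : e ≠ ∞)
    (h : ∀ j, eLpNorm (fun t => f t j) 2 volPi ≤ e) : ‖toVec f‖ ≤ 2 * e.toReal := by
  have h1 : ∀ j, ‖toVec f j‖ ≤ e.toReal := by
    intro j
    rw [Lp.norm_def, eLpNorm_congr_ae (toVec_coeFn hf j)]
    exact ENNReal.toReal_mono he (h j)
  have h2 : ‖toVec f‖ ^ 2 = ‖toVec f 0‖ ^ 2 + ‖toVec f 1‖ ^ 2 := by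
    rw [PiLp.norm_sq_eq_of_L2, Fin.sum_univ_two]
  have h0 : 0 ≤ e.toReal := ENNReal.toReal_nonneg
  refine le_of_sq_le_sq ?_ (by positivity)
  rw [h2]
  nlinarith [h1 0, h1 1, norm_nonneg (toVec f 0), norm_nonneg (toVec f 1)]

lemma norm_toVec_le_of_bound {f : ℝ → Fin 2 → ℝ} (hf : IsL2 f) {C : ℝ} (hC : 0 ≤ C)
    (h : ∀ j, ∀ t ∈ Ioo 0 Real.pi, |f t j| ≤ C) : ‖toVec f‖ ≤ 4 * C := by
  have h1 : ∀ j, ∫ t, f t j * f t j ∂volPi ≤ 4 * C ^ 2 := by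
    intro j
    have h2 : ∫ t, f t j * f t j ∂volPi ≤ ∫ _, C ^ 2 ∂volPi := by
      refine integral_mono_ae ((hf j).integrable_mul (hf j)) (integrable_const _) ?_
      filter_upwards [ae_restrict_mem measurableSet_Ioo] with t ht
      have := h j t ht
      rw [← sq, ← sq_abs]
      exact pow_le_pow_left₀ (abs_nonneg _) this 2
    rw [setIntegral_const, Measure.real, Real.volume_Ioo, sub_zero,
      ENNReal.toReal_ofReal Real.pi_pos.le, smul_eq_mul] at h2
    nlinarith [Real.pi_le_four, sq_nonneg C]
  refine le_of_sq_le_sq ?_ (by positivity)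
  rw [← real_inner_self_eq_norm_sq, inner_toVec hf hf, Fin.sum_univ_two]
  nlinarith [h1 0, h1 1, sq_nonneg C]

/-- A row of the kernel as an element of the Hilbert space. -/
def kernelRow (c d : ℝ → ℝ) (t : ℝ) (j : Fin 2) : VecL2 := toVec fun ξ k => kernelMat c d t ξ j k

lemma isL2_kernelMat (hc : MemLp c 2 volTwoPi) (hd : MemLp d 2 volTwoPi) {x : ℝ}
    (hx : x ∈ Icc 0 Real.pi) (i : Fin 2) : IsL2 fun t j => kernelMat c d x t i j :=
  fun j => memLp_kernelMat hc hd hx i j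

/-! ### Rows and integral operators of finite rank. -/

section FiniteRank

variable {ι : Type*} [Fintype ι] (a m : ι → ℝ)

/-- A row of a kernel of finite rank as an element of the Hilbert space. -/
def finRow (t : ℝ) (j : Fin 2) : VecL2 := ∑ k, (a k * freeSolReal t (m k) j) • freeVec (m k)

/-- The integral operator with a kernel of finite rank. -/
def finOp (u : VecL2) : VecL2 := ∑ k, (a k * ⟪u, freeVec (m k)⟫_ℝ) • freeVec (m k)

lemma continuous_freeSolReal (l : ℝ) (j : Fin 2) : Continuous fun t => freeSolReal t l j := by
  fin_cases j <;> simp [freeSolReal] <;> fun_prop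

lemma continuous_finRow (j : Fin 2) : Continuous fun t => finRow a m t j :=
  continuous_finsetSum _ fun k _ =>
    (continuous_const.mul (continuous_freeSolReal (m k) j)).smul continuous_const

lemma finOp_eq (u : VecL2) : finOp a m u = toVec fun t j => ⟪u, finRow a m t j⟫_ℝ := by
  have h := toVec_sum Finset.univ fun k => (isL2_freeSolReal (m k)).const_smul (a k * ⟪u, freeVec (m k)⟫_ℝ)
  have h2 : finOp a m u = ∑ k, toVec ((a k * ⟪u, freeVec (m k)⟫_ℝ) • fun t => freeSolReal t (m k)) :=
    Finset.sum_congr rfl fun k _ => (toVec_smul (isL2_freeSolReal (m k)) _).symm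
  rw [h2, ← h]
  congr 1
  ext t j
  simp only [Finset.sum_apply, Pi.smul_apply, smul_eq_mul, finRow, inner_sum, real_inner_smul_right]
  exact Finset.sum_congr rfl fun k _ => by ring

lemma inner_finOp (u v : VecL2) :
    ⟪finOp a m u, v⟫_ℝ = ∑ k, a k * ⟪u, freeVec (m k)⟫_ℝ * ⟪v, freeVec (m k)⟫_ℝ := by
  rw [finOp, sum_inner]
  exact Finset.sum_congr rfl fun k _ => by rw [real_inner_smul_left, real_inner_comm v]

lemma finOp_sub (u v : VecL2) : finOp a m (u - v) = finOp a m u - finOp a m v := by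
  simp only [finOp, inner_sub_left, mul_sub, sub_smul, Finset.sum_sub_distrib]

end FiniteRank

/-! ### Partial sums of the kernel as kernels of finite rank. -/

/-- The index type of the terms of a partial sum of the kernel. -/
abbrev PartialIndex (N : ℕ) : Type :=
  {n // n ∈ Finset.Icc (-(N : ℤ)) N} ⊕ {n // n ∈ Finset.Icc (-(N : ℤ)) N}

/-- The coefficients of a partial sum of the kernel. -/
def partialCoef (alpha : ℤ → ℝ) (N : ℕ) : PartialIndex N → ℝ :=
  Sum.elim (fun n => 1 / alpha n) fun _ => -(1 / Real.pi)

/-- The frequencies of a partial sum of the kernel. -/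
def partialFreq (lam : ℤ → ℝ) (N : ℕ) : PartialIndex N → ℝ :=
  Sum.elim (fun n => lam n) fun n => (n : ℤ)

lemma sum_partialIndex {V : Type*} [AddCommGroup V] [Module ℝ V] (lam alpha : ℤ → ℝ) (N : ℕ)
    (g : ℝ → V) :
    ∑ k, partialCoef alpha N k • g (partialFreq lam N k)
      = ∑ n ∈ Finset.Icc (-(N : ℤ)) N, ((1 / alpha n) • g (lam n) - (1 / Real.pi) • g n) := by
  rw [Fintype.sum_sum_type, Finset.sum_sub_distrib, sub_eq_add_neg, ← Finset.sum_neg_distrib]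
  congr 1
  · exact Finset.sum_coe_sort (Finset.Icc (-(N : ℤ)) N) fun n => (1 / alpha n) • g (lam n)
  · simp only [partialCoef, partialFreq, Sum.elim_inr, neg_smul]
    exact Finset.sum_coe_sort (Finset.Icc (-(N : ℤ)) N) fun n => -((1 / Real.pi) • g (n : ℝ))

lemma kernelPartialSum_apply (lam alpha : ℤ → ℝ) (N : ℕ) (x t : ℝ) (i j : Fin 2) :
    kernelPartialSum lam alpha N x t i j = ∑ k, partialCoef alpha N k
      * (freeSolReal x (partialFreq lam N k) i * freeSolReal t (partialFreq lam N k) j) := by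
  have h := sum_partialIndex lam alpha N fun l => freeSolReal x l i * freeSolReal t l j
  simp only [smul_eq_mul] at h
  rw [h]
  simp [kernelPartialSum, Matrix.sum_apply, Matrix.vecMulVec_apply]

lemma finRow_partial (lam alpha : ℤ → ℝ) (N : ℕ) (t : ℝ) (j : Fin 2) :
    finRow (partialCoef alpha N) (partialFreq lam N) t j
      = toVec fun ξ k => kernelPartialSum lam alpha N t ξ j k := by
  have h := toVec_sum Finset.univ fun k => (isL2_freeSolReal (partialFreq lam N k)).const_smul
    (partialCoef alpha N k * freeSolReal t (partialFreq lam N k) j)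
  have h2 : finRow (partialCoef alpha N) (partialFreq lam N) t j
      = ∑ k, toVec ((partialCoef alpha N k * freeSolReal t (partialFreq lam N k) j) •
        fun s => freeSolReal s (partialFreq lam N k)) :=
    Finset.sum_congr rfl fun k _ => (toVec_smul (isL2_freeSolReal _) _).symm
  rw [h2, ← h]
  congr 1
  ext ξ k
  simp only [Finset.sum_apply, Pi.smul_apply, smul_eq_mul, kernelPartialSum_apply, mul_assoc]

/-- The bound for the distance of rows of the partial sums from the rows of the kernel. -/
def rowError (lam alpha : ℤ → ℝ) (c d : ℝ → ℝ) (N : ℕ) : ℝ :=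
  2 * (kernelError lam alpha c d N).toReal

lemma rowError_nonneg (N : ℕ) : 0 ≤ rowError lam alpha c d N :=
  mul_nonneg zero_le_two ENNReal.toReal_nonneg

lemma IsKernelPair.tendsto_rowError (h : IsKernelPair lam alpha c d) :
    Tendsto (rowError lam alpha c d) atTop (𝓝 0) := by
  have h1 := (ENNReal.tendsto_toReal ENNReal.zero_ne_top).comp h.tendsto_kernelError
  have h2 := h1.const_mul 2
  rw [ENNReal.toReal_zero, mul_zero] at h2
  exact h2

lemma IsKernelPair.norm_finRow_sub_le (h : IsKernelPair lam alpha c d) (N : ℕ) {t : ℝ}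
    (ht : t ∈ Icc 0 Real.pi) (j : Fin 2) :
    ‖finRow (partialCoef alpha N) (partialFreq lam N) t j - kernelRow c d t j‖
      ≤ rowError lam alpha c d N := by
  have h1 : IsL2 fun ξ k => kernelPartialSum lam alpha N t ξ j k := by
    simp only [kernelPartialSum_eq]
    exact isL2_kernelMat (memLp_volTwoPi (continuous_trigSum _ _ _ _))
      (memLp_volTwoPi (continuous_trigSum _ _ _ _)) ht j
  have h2 := isL2_kernelMat h.memLp_even h.memLp_odd ht j
  rw [finRow_partial, kernelRow, ← toVec_sub h1 h2]
  exact norm_toVec_le (h1.sub h2) (h.kernelError_ne_top N) fun k => h.eLpNorm_sub_le N ht j k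

/-- Uniform limit of the continuous rows of the partial sums: although `c` and `d` are only square
integrable, the row depends continuously on its position. -/
lemma IsKernelPair.continuousOn_kernelRow (h : IsKernelPair lam alpha c d) (j : Fin 2) :
    ContinuousOn (fun t => kernelRow c d t j) (Icc 0 Real.pi) := by
  have hu : TendstoUniformlyOn (fun N t => finRow (partialCoef alpha N) (partialFreq lam N) t j)
      (fun t => kernelRow c d t j) atTop (Icc 0 Real.pi) := by
    rw [Metric.tendstoUniformlyOn_iff]
    intro ε hε
    filter_upwards [h.tendsto_rowError.eventually (gt_mem_nhds hε)] with N hN t ht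
    rw [dist_comm, dist_eq_norm]
    exact (h.norm_finRow_sub_le N ht j).trans_lt hN
  exact hu.continuousOn (Frequently.of_forall fun N => (continuous_finRow _ _ j).continuousOn)

lemma IsKernelPair.exists_bound_kernelRow (h : IsKernelPair lam alpha c d) :
    ∃ M, 0 ≤ M ∧ ∀ t ∈ Icc 0 Real.pi, ∀ j, ‖kernelRow c d t j‖ ≤ M := by
  obtain ⟨M0, h0⟩ := isCompact_Icc.exists_bound_of_continuousOn (h.continuousOn_kernelRow 0)
  obtain ⟨M1, h1⟩ := isCompact_Icc.exists_bound_of_continuousOn (h.continuousOn_kernelRow 1)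
  refine ⟨max 0 (max M0 M1), le_max_left _ _, fun t ht j => ?_⟩
  fin_cases j
  · exact (h0 t ht).trans ((le_max_left _ _).trans (le_max_right _ _))
  · exact (h1 t ht).trans ((le_max_right _ _).trans (le_max_right _ _))

/-! ### The integral operator and its approximation. -/

/-- The integral operator of the main equation. -/
def kernelOp (c d : ℝ → ℝ) (u : VecL2) : VecL2 := toVec fun t j => ⟪u, kernelRow c d t j⟫_ℝ

lemma isL2_of_continuousOn {f : ℝ → Fin 2 → ℝ}
    (hf : ∀ j, ContinuousOn (fun t => f t j) (Icc 0 Real.pi)) : IsL2 f := by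
  intro j
  obtain ⟨C, hC⟩ := isCompact_Icc.exists_bound_of_continuousOn (hf j)
  refine MemLp.of_bound (((hf j).mono Ioo_subset_Icc_self).aestronglyMeasurable measurableSet_Ioo) C ?_
  filter_upwards [ae_restrict_mem measurableSet_Ioo] with t ht
  exact hC t ⟨ht.1.le, ht.2.le⟩

lemma IsKernelPair.isL2_inner_kernelRow (h : IsKernelPair lam alpha c d) (u : VecL2) :
    IsL2 fun t j => ⟪u, kernelRow c d t j⟫_ℝ :=
  isL2_of_continuousOn fun j => continuousOn_const.inner (h.continuousOn_kernelRow j)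

lemma IsKernelPair.norm_finOp_sub_le (h : IsKernelPair lam alpha c d) (N : ℕ) (u : VecL2) :
    ‖finOp (partialCoef alpha N) (partialFreq lam N) u - kernelOp c d u‖
      ≤ 4 * (rowError lam alpha c d N * ‖u‖) := by
  have h1 : IsL2 fun t j => ⟪u, finRow (partialCoef alpha N) (partialFreq lam N) t j⟫_ℝ :=
    isL2_of_continuous fun j => continuous_const.inner (continuous_finRow _ _ j)
  have h2 := h.isL2_inner_kernelRow u
  rw [finOp_eq, kernelOp, ← toVec_sub h1 h2]
  refine norm_toVec_le_of_bound (h1.sub h2) (mul_nonneg (rowError_nonneg N) (norm_nonneg _))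
    fun j t ht => ?_
  rw [Pi.sub_apply, Pi.sub_apply, ← inner_sub_right, mul_comm]
  exact (abs_real_inner_le_norm _ _).trans (mul_le_mul_of_nonneg_left
    (h.norm_finRow_sub_le N ⟨ht.1.le, ht.2.le⟩ j) (norm_nonneg _))

/-! ### Coercivity of the main equation -/

lemma exists_le_of_summable_sq {alpha : ℤ → ℝ}
    (halpha : Summable fun n : ℤ => (alpha n - Real.pi) ^ 2) : ∃ A > 0, ∀ n, alpha n ≤ A := by
  refine ⟨1 + ∑' n, (alpha n - Real.pi) ^ 2 + Real.pi, ?_, fun n => ?_⟩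
  · have : 0 ≤ ∑' n, (alpha n - Real.pi) ^ 2 := tsum_nonneg fun n => sq_nonneg _
    have := Real.pi_pos
    positivity
  · have := halpha.le_tsum n fun _ _ => sq_nonneg _
    nlinarith [sq_nonneg (alpha n - Real.pi - 1)]

lemma vanishAfter_mono {x b : ℝ} (h : x ≤ b) : vanishAfter x ≤ vanishAfter b := by
  intro v hv
  obtain ⟨f, hf, hfx, rfl⟩ := exists_toVec_eq_of_mem_vanishAfter hv
  exact toVec_mem_vanishAfter hf fun t ht => hfx t (h.trans ht)

/-- The main equation is coercive on `(0, b)` if the frequencies are complete there. -/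
theorem IsKernelPair.exists_coercive (h : IsKernelPair lam alpha c d)
    (hlam : Summable fun n : ℤ => (lam n - n) ^ 2)
    (halpha : Summable fun n : ℤ => (alpha n - Real.pi) ^ 2) (hpos : ∀ n, 0 < alpha n) {b : ℝ}
    (hb : CompleteFreq b lam) :
    ∃ δ > 0, ∀ v ∈ vanishAfter b, δ * ‖v‖ ^ 2 ≤ ‖v‖ ^ 2 + ⟪kernelOp c d v, v⟫_ℝ := by
  obtain ⟨δ, hδ, hframe⟩ := exists_frame_bound hlam hb
  obtain ⟨A, hA, hAb⟩ := exists_le_of_summable_sq halpha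
  refine ⟨1 / A * δ, by positivity, fun v hv => ?_⟩
  have h1 : Tendsto (fun N => ‖v‖ ^ 2
      + ⟪finOp (partialCoef alpha N) (partialFreq lam N) v, v⟫_ℝ) atTop
      (𝓝 (‖v‖ ^ 2 + ⟪kernelOp c d v, v⟫_ℝ)) := by
    refine tendsto_const_nhds.add (Tendsto.inner ?_ tendsto_const_nhds)
    rw [tendsto_iff_norm_sub_tendsto_zero]
    refine squeeze_zero (fun _ => norm_nonneg _) (fun N => h.norm_finOp_sub_le N v) ?_
    simpa using (h.tendsto_rowError.mul_const ‖v‖).const_mul 4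
  have h2 : Tendsto (fun N : ℕ => 1 / A * ∑ n ∈ Finset.Icc (-(N : ℤ)) N,
      ⟪v, freeVec (lam n)⟫_ℝ ^ 2) atTop (𝓝 (1 / A * ∑' n, ⟪v, freeVec (lam n)⟫_ℝ ^ 2)) :=
    ((summable_sq_inner_freeVec hlam v).hasSum.comp tendsto_Icc_neg_atTop).const_mul _
  have h3 := le_of_tendsto_of_tendsto' h2 h1 fun N => by
    rw [inner_finOp]
    have e := sum_partialIndex lam alpha N fun l => ⟪v, freeVec l⟫_ℝ ^ 2
    simp only [smul_eq_mul, sq, ← mul_assoc] at e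
    rw [e, Finset.sum_sub_distrib]
    have hB := sum_le_hasSum (Finset.Icc (-(N : ℤ)) N) (fun n _ => sq_nonneg _)
      (hasSum_sq_inner_freeVec v)
    -- For a partial sum only Bessel's inequality is available, but it has the right direction: the
    -- negative part of the form costs at most `‖v‖²`, leaving the weighted sum over `lam n`.
    have hB' : ∑ n ∈ Finset.Icc (-(N : ℤ)) N,
        1 / Real.pi * ⟪v, freeVec n⟫_ℝ * ⟪v, freeVec n⟫_ℝ ≤ ‖v‖ ^ 2 := by
      simp only [mul_assoc, ← sq]
      rw [← Finset.mul_sum, one_div_mul_eq_div, div_le_iff₀ Real.pi_pos]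
      linarith
    have hL : 1 / A * ∑ n ∈ Finset.Icc (-(N : ℤ)) N, ⟪v, freeVec (lam n)⟫_ℝ ^ 2
        ≤ ∑ n ∈ Finset.Icc (-(N : ℤ)) N,
          1 / alpha n * ⟪v, freeVec (lam n)⟫_ℝ * ⟪v, freeVec (lam n)⟫_ℝ := by
      rw [Finset.mul_sum]
      refine Finset.sum_le_sum fun n _ => ?_
      rw [mul_assoc, ← sq]
      exact mul_le_mul_of_nonneg_right (one_div_le_one_div_of_le (hpos n) (hAb n)) (sq_nonneg _)
    linarith
  calc 1 / A * δ * ‖v‖ ^ 2 = 1 / A * (δ * ‖v‖ ^ 2) := by ring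
    _ ≤ 1 / A * ∑' n, ⟪v, freeVec (lam n)⟫_ℝ ^ 2 :=
        mul_le_mul_of_nonneg_left (hframe v hv) (by positivity)
    _ ≤ _ := h3

/-- The operators differ in norm by at most four times the row error; once that error is below
`δ/8`, half of the coercivity survives. -/
lemma IsKernelPair.eventually_coercive_partial (h : IsKernelPair lam alpha c d) {b δ : ℝ}
    (hδ : 0 < δ) (hco : ∀ v ∈ vanishAfter b, δ * ‖v‖ ^ 2 ≤ ‖v‖ ^ 2 + ⟪kernelOp c d v, v⟫_ℝ) :
    ∀ᶠ N in atTop, ∀ v ∈ vanishAfter b, δ / 2 * ‖v‖ ^ 2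
      ≤ ‖v‖ ^ 2 + ⟪finOp (partialCoef alpha N) (partialFreq lam N) v, v⟫_ℝ := by
  filter_upwards [h.tendsto_rowError.eventually (gt_mem_nhds (show 0 < δ / 8 by positivity))]
    with N hN v hv
  have h1 := hco v hv
  have h2 := (abs_real_inner_le_norm
    (finOp (partialCoef alpha N) (partialFreq lam N) v - kernelOp c d v) v).trans
    (mul_le_mul_of_nonneg_right (h.norm_finOp_sub_le N v) (norm_nonneg v))
  rw [inner_sub_left] at h2
  have h3 := (abs_le.1 h2).1
  nlinarith [sq_nonneg ‖v‖]

end Pair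

end DiracInverse
end

noncomputable section

namespace DiracInverse

open scoped InnerProductSpace ENNReal

/-! ### Truncated vector functions -/

lemma volPi_restrict_Iio {x : ℝ} (hx : x ∈ Icc 0 Real.pi) :
    volPi.restrict (Iio x) = volume.restrict (Ioo 0 x) := by
  rw [Measure.restrict_restrict measurableSet_Iio]
  congr 1
  ext t
  simp only [mem_inter_iff, mem_Iio, mem_Ioo]
  exact ⟨fun h => ⟨h.2.1, h.1⟩, fun h => ⟨h.2, h.1, h.2.trans_le hx.2⟩⟩

lemma isL2_indicator_Iio_iff {f : ℝ → Fin 2 → ℝ} {x : ℝ} (hx : x ∈ Icc 0 Real.pi) :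
    IsL2 ((Iio x).indicator f) ↔ ∀ j, MemLp (fun t => f t j) 2 (volume.restrict (Ioo 0 x)) := by
  refine forall_congr' fun j => ?_
  have e : (fun t => (Iio x).indicator f t j) = (Iio x).indicator fun t => f t j := by
    ext t
    by_cases ht : t ∈ Iio x <;> simp [ht]
  rw [e, memLp_indicator_iff_restrict measurableSet_Iio, volPi_restrict_Iio hx]

lemma indicator_Iio_of_le {f : ℝ → Fin 2 → ℝ} {x t : ℝ} (ht : x ≤ t) :
    (Iio x).indicator f t = 0 := indicator_of_notMem (notMem_Iio.2 ht) _

lemma integral_indicator_Iio {x : ℝ} (hx : x ∈ Icc 0 Real.pi) (f : ℝ → ℝ) :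
    ∫ t, (Iio x).indicator f t ∂volPi = ∫ t in (0 : ℝ)..x, f t := by
  rw [integral_indicator measurableSet_Iio, volPi_restrict_Iio hx,
    intervalIntegral.integral_of_le hx.1, integral_Ioc_eq_integral_Ioo]

lemma inner_toVec_indicator {f g : ℝ → Fin 2 → ℝ} {x : ℝ} (hx : x ∈ Icc 0 Real.pi)
    (hf : IsL2 ((Iio x).indicator f)) (hg : IsL2 g) :
    ⟪toVec ((Iio x).indicator f), toVec g⟫_ℝ = ∫ t in (0 : ℝ)..x, ∑ j, f t j * g t j := by
  have h : ∀ j ∈ Finset.univ, Integrable (fun t => (Iio x).indicator f t j * g t j) volPi :=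
    fun j _ => (hf j).integrable_mul (hg j)
  rw [inner_toVec hf hg, ← integral_finsetSum _ h, ← integral_indicator_Iio hx]
  congr 1
  ext t
  by_cases ht : t ∈ Iio x <;> simp [ht]

lemma inner_toVec_indicator_of_mem {f : ℝ → Fin 2 → ℝ} {x : ℝ} (hf : IsL2 f) {v : VecL2}
    (hv : v ∈ vanishAfter x) : ⟪toVec ((Iio x).indicator f), v⟫_ℝ = ⟪toVec f, v⟫_ℝ := by
  obtain ⟨g, hg, hgx, rfl⟩ := exists_toVec_eq_of_mem_vanishAfter hv
  rw [inner_toVec (hf.indicator measurableSet_Iio) hg, inner_toVec hf hg]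
  refine Finset.sum_congr rfl fun j _ => ?_
  congr 1
  ext t
  by_cases ht : t ∈ Iio x
  · simp [ht]
  · simp [hgx t (notMem_Iio.1 ht)]

/-- The free solution cut off at `x`. -/
def truncVec (x l : ℝ) : VecL2 := toVec ((Iio x).indicator fun t => freeSolReal t l)

lemma isL2_truncVec (x l : ℝ) : IsL2 ((Iio x).indicator fun t => freeSolReal t l) :=
  (isL2_freeSolReal l).indicator measurableSet_Iio

lemma truncVec_mem (x l : ℝ) : truncVec x l ∈ vanishAfter x :=
  toVec_mem_vanishAfter (isL2_truncVec x l) fun _ ht => indicator_Iio_of_le ht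

lemma inner_truncVec_of_mem {x : ℝ} (l : ℝ) {v : VecL2} (hv : v ∈ vanishAfter x) :
    ⟪truncVec x l, v⟫_ℝ = ⟪freeVec l, v⟫_ℝ :=
  inner_toVec_indicator_of_mem (isL2_freeSolReal l) hv

lemma inner_truncVec_freeVec {x : ℝ} (hx : x ∈ Icc 0 Real.pi) (l k : ℝ) :
    ⟪truncVec x l, freeVec k⟫_ℝ = cosIntReal (k - l) x := by
  rw [truncVec, freeVec, inner_toVec_indicator hx (isL2_truncVec x l) (isL2_freeSolReal k), cosIntReal]
  congr 1
  ext t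
  simp only [Fin.sum_univ_two, freeSolReal, Matrix.cons_val_zero, Matrix.cons_val_one]
  rw [sub_mul, Real.cos_sub]
  ring

/-- The pairing of a real vector function with the free solution at a complex parameter. -/
def freePair (z : ℂ) (v : VecL2) : ℂ :=
  (⟪v, toVec fun t j => (freeSol t z j).re⟫_ℝ : ℝ)
    + (⟪v, toVec fun t j => (freeSol t z j).im⟫_ℝ : ℝ) * Complex.I

lemma continuous_freeSol (z : ℂ) (j : Fin 2) : Continuous fun t => freeSol t z j := by
  fin_cases j <;> simp [freeSol] <;> fun_prop

lemma isL2_freeSol_re (z : ℂ) : IsL2 fun t j => (freeSol t z j).re :=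
  isL2_of_continuous fun j => Complex.continuous_re.comp (continuous_freeSol z j)

lemma isL2_freeSol_im (z : ℂ) : IsL2 fun t j => (freeSol t z j).im :=
  isL2_of_continuous fun j => Complex.continuous_im.comp (continuous_freeSol z j)

lemma freePair_add (z : ℂ) (u v : VecL2) : freePair z (u + v) = freePair z u + freePair z v := by
  simp only [freePair, inner_add_left, Complex.ofReal_add]; ring

lemma freePair_smul (z : ℂ) (r : ℝ) (v : VecL2) : freePair z (r • v) = r * freePair z v := by
  simp only [freePair, real_inner_smul_left, Complex.ofReal_mul]; ring

lemma freePair_neg (z : ℂ) (v : VecL2) : freePair z (-v) = -freePair z v := by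
  simp only [freePair, inner_neg_left, Complex.ofReal_neg]; ring

lemma freePair_sum {ι : Type*} (z : ℂ) (s : Finset ι) (v : ι → VecL2) :
    freePair z (∑ k ∈ s, v k) = ∑ k ∈ s, freePair z (v k) := by
  simp only [freePair, sum_inner, Complex.ofReal_sum, Finset.sum_add_distrib, Finset.sum_mul]

lemma exists_norm_freePair_le (z : ℂ) : ∃ C, 0 ≤ C ∧ ∀ v, ‖freePair z v‖ ≤ C * ‖v‖ := by
  refine ⟨‖toVec fun t j => (freeSol t z j).re‖ + ‖toVec fun t j => (freeSol t z j).im‖,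
    by positivity, fun v => ?_⟩
  refine (norm_add_le _ _).trans ?_
  rw [norm_mul, Complex.norm_I, mul_one, Complex.norm_real, Complex.norm_real, add_mul]
  exact add_le_add ((norm_inner_le_norm _ _).trans_eq (mul_comm _ _))
    ((norm_inner_le_norm _ _).trans_eq (mul_comm _ _))

lemma freePair_toVec_indicator {f : ℝ → Fin 2 → ℝ} {x : ℝ} (hx : x ∈ Icc 0 Real.pi)
    (hf : IsL2 ((Iio x).indicator f)) (z : ℂ) :
    freePair z (toVec ((Iio x).indicator f))
      = ∫ t in (0 : ℝ)..x, ∑ j, (f t j : ℂ) * freeSol t z j := by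
  have hi : ∀ g : ℝ → Fin 2 → ℝ, (∀ j, Continuous fun t => g t j) →
      IntervalIntegrable (fun t => ∑ j, f t j * g t j) volume 0 x := by
    intro g hg
    rw [intervalIntegrable_iff_integrableOn_Ioo_of_le hx.1]
    refine integrable_finsetSum _ fun j _ => ?_
    refine ((isL2_indicator_Iio_iff hx).1 hf j).integrable_mul (q := 2) ?_
    have := (isL2_of_continuous hg j).mono_measure
      (Measure.restrict_mono (Ioo_subset_Ioo_right hx.2) le_rfl : volume.restrict (Ioo 0 x) ≤ volPi)
    exact this
  have cast : ∀ {g : ℝ → ℝ}, IntervalIntegrable g volume 0 x →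
      IntervalIntegrable (fun t => (g t : ℂ)) volume 0 x := fun h => ⟨h.1.ofReal, h.2.ofReal⟩
  have h1 := cast (hi (fun t j => (freeSol t z j).re) fun j => Complex.continuous_re.comp (continuous_freeSol z j))
  have h2 := cast (hi (fun t j => (freeSol t z j).im) fun j => Complex.continuous_im.comp (continuous_freeSol z j))
  rw [freePair, inner_toVec_indicator hx hf (isL2_freeSol_re z),
    inner_toVec_indicator hx hf (isL2_freeSol_im z), ← intervalIntegral.integral_ofReal,
    ← intervalIntegral.integral_ofReal, ← intervalIntegral.integral_mul_const,
    ← intervalIntegral.integral_add h1 (h2.mul_const _)]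
  congr 1
  ext t
  push_cast
  rw [Finset.sum_mul, ← Finset.sum_add_distrib]
  refine Finset.sum_congr rfl fun j _ => ?_
  conv_rhs => rw [← Complex.re_add_im (freeSol t z j)]
  ring

lemma freePair_truncVec {x : ℝ} (hx : x ∈ Icc 0 Real.pi) (z : ℂ) (l : ℝ) :
    freePair z (truncVec x l) = cosInt (z - l) x := by
  rw [truncVec, freePair_toVec_indicator hx (isL2_truncVec x l), cosInt]
  congr 1
  ext t
  simp only [Fin.sum_univ_two, freeSolReal, freeSol, Matrix.cons_val_zero, Matrix.cons_val_one]
  rw [sub_mul, Complex.cos_sub]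
  push_cast
  ring

/-! ### The main equation with a kernel of finite rank -/

section FiniteRank

variable {ι : Type*} [Fintype ι] [DecidableEq ι] {a m : ι → ℝ}

/-- A null vector `u` gives `v = ∑ uₖ φ₀(·,mₖ)`, cut off at `x`, with `uⱼ + aⱼ ⟪v, φ₀(mⱼ)⟫ = 0`. The
coercive form at `v` is then zero, so `v = 0`, and the same relation gives `u = 0`; independence of
the free solutions is not needed. -/
lemma det_mainMat_ne_zero {x δ : ℝ} (hx : x ∈ Icc 0 Real.pi) (hδ : 0 < δ)
    (hco : ∀ v ∈ vanishAfter x, δ * ‖v‖ ^ 2 ≤ ‖v‖ ^ 2 + ⟪finOp a m v, v⟫_ℝ) :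
    (mainMat a m x).det ≠ 0 := by
  intro hdet
  obtain ⟨u, hu0, hu⟩ := Matrix.exists_mulVec_eq_zero_iff.2 hdet
  set v : VecL2 := ∑ k, u k • truncVec x (m k) with hv
  have hvm : v ∈ vanishAfter x := Submodule.sum_mem _ fun k _ => Submodule.smul_mem _ _ (truncVec_mem x _)
  have hw : ∀ j, ⟪v, freeVec (m j)⟫_ℝ = ∑ k, cosIntReal (m k - m j) x * u k := by
    intro j
    rw [hv, sum_inner]
    refine Finset.sum_congr rfl fun k _ => ?_
    rw [real_inner_smul_left, inner_truncVec_freeVec hx, ← cosIntReal_neg, neg_sub, mul_comm]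
  have hM : ∀ j, u j + a j * ⟪v, freeVec (m j)⟫_ℝ = 0 := by
    intro j
    have := congrFun hu j
    rw [mainMat, Matrix.add_mulVec, Matrix.one_mulVec, ← Matrix.mulVec_mulVec, Pi.add_apply,
      Matrix.mulVec_diagonal] at this
    rw [hw]
    exact this
  have hn : ‖v‖ ^ 2 = ∑ k, u k * ⟪v, freeVec (m k)⟫_ℝ := by
    rw [← real_inner_self_eq_norm_sq]
    conv_lhs => rw [hv]
    rw [sum_inner]
    refine Finset.sum_congr rfl fun k _ => ?_
    rw [← hv, real_inner_smul_left, inner_truncVec_of_mem _ hvm, real_inner_comm]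
  have h0 := hco v hvm
  rw [inner_finOp, hn, ← Finset.sum_add_distrib, ← hn, Finset.sum_eq_zero] at h0
  · have hv0 : v = 0 := by
      by_contra h
      have := norm_pos_iff.2 h
      have : 0 < δ * ‖v‖ ^ 2 := by positivity
      linarith
    refine hu0 (funext fun j => ?_)
    have := hM j
    rwa [hv0, inner_zero_left, mul_zero, add_zero] at this
  · intro k _
    have := hM k
    linear_combination ⟪v, freeVec (m k)⟫_ℝ * this

variable (a m) in
/-- A row of the solution of the main equation with a kernel of finite rank. -/
def finVec (x : ℝ) (i : Fin 2) : VecL2 := -∑ k, (a k * pertMat a m x i k) • truncVec x (m k)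

lemma finVec_mem (x : ℝ) (i : Fin 2) : finVec a m x i ∈ vanishAfter x :=
  Submodule.neg_mem _ (Submodule.sum_mem _ fun _ _ => Submodule.smul_mem _ _ (truncVec_mem x _))

lemma inner_finVec_freeVec {x : ℝ} (hx : x ∈ Icc 0 Real.pi) (hdet : (mainMat a m x).det ≠ 0)
    (i : Fin 2) (k : ι) :
    ⟪finVec a m x i, freeVec (m k)⟫_ℝ = pertMat a m x i k - freeSolReal x (m k) i := by
  have h := congrFun (congrFun (pertMat_mul_mainMat hdet) i) k
  rw [mainMat, Matrix.mul_add, Matrix.mul_one, Matrix.add_apply, ← Matrix.mul_assoc,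
    Matrix.mul_apply] at h
  have h2 : freeMat m x i k = freeSolReal x (m k) i := rfl
  rw [← h2, ← h, finVec, inner_neg_left, sum_inner, sub_add_cancel_left]
  congr 1
  refine Finset.sum_congr rfl fun j _ => ?_
  rw [real_inner_smul_left, inner_truncVec_freeVec hx, Matrix.mul_diagonal, gramMat, Matrix.of_apply]
  ring

lemma finVec_weak {x : ℝ} (hx : x ∈ Icc 0 Real.pi) (hdet : (mainMat a m x).det ≠ 0)
    (i : Fin 2) {v : VecL2} (hv : v ∈ vanishAfter x) :
    ⟪finRow a m x i, v⟫_ℝ + ⟪finVec a m x i, v⟫_ℝ + ⟪finOp a m (finVec a m x i), v⟫_ℝ = 0 := by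
  have e : ⟪finVec a m x i, v⟫_ℝ = -∑ k, a k * pertMat a m x i k * ⟪truncVec x (m k), v⟫_ℝ := by
    rw [finVec, inner_neg_left, sum_inner]
    simp only [real_inner_smul_left]
  rw [inner_finOp, finRow, e, sum_inner, ← Finset.sum_neg_distrib, ← Finset.sum_add_distrib, ← Finset.sum_add_distrib]
  refine Finset.sum_eq_zero fun k _ => ?_
  rw [real_inner_smul_left, inner_truncVec_of_mem _ hv,
    inner_finVec_freeVec hx hdet, real_inner_comm v]
  ring

lemma finSol_eq {x : ℝ} (hx : x ∈ Icc 0 Real.pi) (z : ℂ) (i : Fin 2) :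
    finSol a m x z i = freeSol x z i + freePair z (finVec a m x i) := by
  rw [finSol, finVec, freePair_neg, freePair_sum, sub_eq_add_neg]
  congr 2
  exact Finset.sum_congr rfl fun k _ => by rw [freePair_smul, freePair_truncVec hx]

/-- The main equation evaluated at `t = x`: minus the kernel on the diagonal, minus the integral
term. -/
lemma finDiag_eq {x : ℝ} (hx : x ∈ Icc 0 Real.pi) (hdet : (mainMat a m x).det ≠ 0) (i l : Fin 2) :
    finDiag a m x i l = -(∑ k, a k * (freeSolReal x (m k) i * freeSolReal x (m k) l))
      - ⟪finVec a m x i, finRow a m x l⟫_ℝ := by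
  rw [finDiag, Matrix.neg_apply, Matrix.mul_apply, finRow, inner_sum, ← Finset.sum_neg_distrib,
    ← Finset.sum_neg_distrib, ← Finset.sum_sub_distrib]
  refine Finset.sum_congr rfl fun k _ => ?_
  rw [real_inner_smul_right, inner_finVec_freeVec hx hdet, Matrix.mul_diagonal,
    Matrix.transpose_apply, freeMat, Matrix.of_apply]
  ring

end FiniteRank

end DiracInverse
end

noncomputable section

namespace DiracInverse

open scoped InnerProductSpace ENNReal

/-! ### Solutions of the main equation in the Hilbert space -/

/-- A row of a solution of the main equation as an element of the Hilbert space. -/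
def cutRow (K : ℝ → ℝ → Matrix (Fin 2) (Fin 2) ℝ) (x : ℝ) (i : Fin 2) : VecL2 :=
  toVec ((Iio x).indicator fun t j => K x t i j)

lemma solvesMainEquation_zero (F K : ℝ → ℝ → Matrix (Fin 2) (Fin 2) ℝ) :
    SolvesMainEquation F K 0 := by
  intro i j
  simp

section Solution

variable {lam alpha : ℤ → ℝ} {c d : ℝ → ℝ} {F K : ℝ → ℝ → Matrix (Fin 2) (Fin 2) ℝ} {x : ℝ}

lemma SolvesMainEquation.isL2 (hK : SolvesMainEquation F K x) (hx : x ∈ Icc 0 Real.pi) (i : Fin 2) :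
    IsL2 ((Iio x).indicator fun t j => K x t i j) :=
  (isL2_indicator_Iio_iff hx).2 fun j => (hK i j).1

lemma SolvesMainEquation.cutRow_mem (hK : SolvesMainEquation F K x) (hx : x ∈ Icc 0 Real.pi)
    (i : Fin 2) : cutRow K x i ∈ vanishAfter x :=
  toVec_mem_vanishAfter (hK.isL2 hx i) fun _ ht => indicator_Iio_of_le ht

lemma SolvesMainEquation.phi_eq (hK : SolvesMainEquation F K x) (hx : x ∈ Icc 0 Real.pi) (z : ℂ)
    (i : Fin 2) : phi K x z i = freeSol x z i + freePair z (cutRow K x i) := by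
  rw [cutRow, freePair_toVec_indicator hx (hK.isL2 hx i), phi]
  rfl

/-- `F ξ` is known for every `ξ` and almost every `t`, but the integral in the main equation runs
over `ξ` with `t` fixed. Joint measurability lets the quantifiers be exchanged, and the symmetry of
the kernel turns the column into a row. -/
lemma IsKernelPair.ae_ae_eq (h : IsKernelPair lam alpha c d) (hF : IsMainKernel lam alpha F)
    (k j : Fin 2) : ∀ᵐ t ∂volPi, ∀ᵐ ξ ∂volPi, F ξ t k j = kernelMat c d t ξ j k := by
  have hk := measurable_kernelMat h.measurable_even h.measurable_odd k j
  have hae : ∀ᵐ ξ ∂volPi, ∀ᵐ t ∂volPi, F ξ t k j = kernelMat c d ξ t k j := by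
    filter_upwards [ae_restrict_mem measurableSet_Ioo] with ξ hξ
    exact h.ae_eq hF ⟨hξ.1.le, hξ.2.le⟩ k j
  have hs := measurableSet_eq_fun (hF.1 k j) hk
  have hcomm := (Measure.ae_ae_comm (μ := volPi) (ν := volPi)
    (p := fun ξ t => F ξ t k j = kernelMat c d ξ t k j) hs).1 hae
  filter_upwards [hcomm] with t ht
  filter_upwards [ht] with ξ hξ
  rw [hξ, kernelMat_symm h.even h.odd]

/-- The main equation holds pointwise with the rows of the kernel. -/
lemma SolvesMainEquation.ae_row (hK : SolvesMainEquation F K x) (h : IsKernelPair lam alpha c d)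
    (hF : IsMainKernel lam alpha F) (hx : x ∈ Icc 0 Real.pi) (i j : Fin 2) :
    ∀ᵐ t ∂volPi, t < x →
      kernelMat c d x t i j + K x t i j + ⟪cutRow K x i, kernelRow c d t j⟫_ℝ = 0 := by
  have h1 : ∀ᵐ t ∂volPi, t < x →
      F x t i j + K x t i j + ∫ ξ in (0 : ℝ)..x, (K x ξ * F ξ t) i j = 0 := by
    have := (hK i j).2
    rw [← volPi_restrict_Iio hx] at this
    exact (ae_restrict_iff' measurableSet_Iio).1 this
  filter_upwards [h1, h.ae_eq hF hx i j, h.ae_ae_eq hF 0 j, h.ae_ae_eq hF 1 j,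
    ae_restrict_mem measurableSet_Ioo] with t ht hFt h0 h1 htm htx
  rw [← hFt, ← ht htx, cutRow, kernelRow, inner_toVec_indicator hx (hK.isL2 hx i)
    (isL2_kernelMat h.memLp_even h.memLp_odd ⟨htm.1.le, htm.2.le⟩ j),
    ← integral_indicator_Iio hx, ← integral_indicator_Iio hx]
  congr 1
  refine integral_congr_ae ?_
  filter_upwards [h0, h1] with ξ h0 h1
  by_cases hξ : ξ ∈ Iio x
  · simp only [indicator_of_mem hξ]
    rw [Matrix.mul_apply, Fin.sum_univ_two, Fin.sum_univ_two, h0, h1]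
  · simp only [indicator_of_notMem hξ]

lemma SolvesMainEquation.weak (hK : SolvesMainEquation F K x) (h : IsKernelPair lam alpha c d)
    (hF : IsMainKernel lam alpha F) (hx : x ∈ Icc 0 Real.pi) (i : Fin 2) {v : VecL2}
    (hv : v ∈ vanishAfter x) : ⟪kernelRow c d x i, v⟫_ℝ + ⟪cutRow K x i, v⟫_ℝ
      + ⟪kernelOp c d (cutRow K x i), v⟫_ℝ = 0 := by
  obtain ⟨g, hg, hgx, rfl⟩ := exists_toVec_eq_of_mem_vanishAfter hv
  have h1 := isL2_kernelMat h.memLp_even h.memLp_odd hx i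
  have h2 := hK.isL2 hx i
  have h3 := h.isL2_inner_kernelRow (cutRow K x i)
  rw [← inner_add_left, ← inner_add_left, kernelOp, kernelRow]
  conv_lhs => enter [2, 1, 2]; rw [cutRow]
  rw [← toVec_add h1 h2, ← toVec_add (h1.add h2) h3, inner_toVec ((h1.add h2).add h3) hg]
  refine Finset.sum_eq_zero fun j _ => integral_eq_zero_of_ae ?_
  filter_upwards [hK.ae_row h hF hx i j] with t ht
  simp only [Pi.add_apply, Pi.zero_apply]
  by_cases htx : t < x
  · rw [indicator_of_mem (mem_Iio.2 htx), ht htx, zero_mul]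
  · rw [hgx t (not_lt.1 htx), Pi.zero_apply, mul_zero]

end Solution

/-! ### Stability of coercive equations -/

section Stability

variable {V : Type*} [NormedAddCommGroup V] [InnerProductSpace ℝ V]

/-- The a priori estimate: test the equation with `v = u`. -/
lemma norm_le_of_weak {S : Submodule ℝ V} {T : V → V} {r u : V} {δ : ℝ}
    (hco : ∀ v ∈ S, δ * ‖v‖ ^ 2 ≤ ‖v‖ ^ 2 + ⟪T v, v⟫_ℝ) (hu : u ∈ S)
    (hw : ∀ v ∈ S, ⟪r, v⟫_ℝ + ⟪u, v⟫_ℝ + ⟪T u, v⟫_ℝ = 0) : δ * ‖u‖ ≤ ‖r‖ := by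
  have h1 := hco u hu
  have h2 := hw u hu
  have h3 := (abs_le.1 (abs_real_inner_le_norm r u)).1
  rw [real_inner_self_eq_norm_sq] at h2
  rcases (norm_nonneg u).eq_or_lt with h0 | h0
  · rw [← h0, mul_zero]; exact norm_nonneg r
  · refine le_of_mul_le_mul_right ?_ h0
    nlinarith

/-- The difference of the solutions solves the equation for `T'` with data `(r' - r) + (T' u - T
u)`, to which the a priori estimate applies. -/
lemma norm_sub_le_of_weak {S : Submodule ℝ V} {T T' : V → V} {r r' u u' : V} {δ e : ℝ}
    (hco : ∀ v ∈ S, δ * ‖v‖ ^ 2 ≤ ‖v‖ ^ 2 + ⟪T' v, v⟫_ℝ) (hsub : T' (u' - u) = T' u' - T' u)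
    (hu : u ∈ S) (hu' : u' ∈ S)
    (hw : ∀ v ∈ S, ⟪r, v⟫_ℝ + ⟪u, v⟫_ℝ + ⟪T u, v⟫_ℝ = 0)
    (hw' : ∀ v ∈ S, ⟪r', v⟫_ℝ + ⟪u', v⟫_ℝ + ⟪T' u', v⟫_ℝ = 0)
    (hr : ‖r' - r‖ ≤ e) (hT : ‖T' u - T u‖ ≤ 4 * (e * ‖u‖)) :
    δ * ‖u' - u‖ ≤ e + 4 * (e * ‖u‖) := by
  have hv := S.sub_mem hu' hu
  have h1 : ∀ v ∈ S, ⟪(r' - r) + (T' u - T u), v⟫_ℝ + ⟪u' - u, v⟫_ℝ + ⟪T' (u' - u), v⟫_ℝ = 0 := by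
    intro v hv
    rw [hsub]
    simp only [inner_sub_left, inner_add_left]
    linarith [hw v hv, hw' v hv]
  exact (norm_le_of_weak hco hv h1).trans ((norm_add_le _ _).trans (add_le_add hr hT))

end Stability

/-! ### Approximation by kernels of finite rank -/

section Approximation

variable {lam alpha : ℤ → ℝ} {c d : ℝ → ℝ} {F K : ℝ → ℝ → Matrix (Fin 2) (Fin 2) ℝ} {b : ℝ}

/-- Uniform approximation of the solution of the main equation on `[0, b]` by the solutions with
kernels of finite rank. -/
lemma exists_uniform_approx (h : IsKernelPair lam alpha c d) (hF : IsMainKernel lam alpha F)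
    (hb : b ∈ Icc 0 Real.pi) (hK : ∀ x ∈ Icc 0 b, SolvesMainEquation F K x) {δ : ℝ} (hδ : 0 < δ)
    (hco : ∀ v ∈ vanishAfter b, δ * ‖v‖ ^ 2 ≤ ‖v‖ ^ 2 + ⟪kernelOp c d v, v⟫_ℝ) :
    ∃ (C : ℝ) (E : ℕ → ℝ), 0 ≤ C ∧ Tendsto E atTop (𝓝 0) ∧
      (∀ x ∈ Icc 0 b, ∀ i, ‖cutRow K x i‖ ≤ C) ∧
      ∀ᶠ N in atTop, ∀ x ∈ Icc 0 b,
        (mainMat (partialCoef alpha N) (partialFreq lam N) x).det ≠ 0 ∧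
        ∀ i, ‖finVec (partialCoef alpha N) (partialFreq lam N) x i - cutRow K x i‖ ≤ E N := by
  obtain ⟨M, hM0, hM⟩ := h.exists_bound_kernelRow
  have hmem : ∀ x ∈ Icc 0 b, x ∈ Icc 0 Real.pi := fun x hx => ⟨hx.1, hx.2.trans hb.2⟩
  have hC : ∀ x ∈ Icc 0 b, ∀ i, ‖cutRow K x i‖ ≤ M / δ := by
    -- Coercivity on `(0, b)` is inherited by every shorter interval with the same `δ`, so the bound
    -- does not depend on `x`.
    intro x hx i
    rw [le_div_iff₀' hδ]
    exact (norm_le_of_weak (fun v hv => hco v (vanishAfter_mono hx.2 hv))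
      ((hK x hx).cutRow_mem (hmem x hx) i)
      fun v hv => (hK x hx).weak h hF (hmem x hx) i hv).trans (hM x (hmem x hx) i)
  refine ⟨M / δ, fun N => (δ / 2)⁻¹ * (rowError lam alpha c d N
    + 4 * (rowError lam alpha c d N * (M / δ))), by positivity, ?_, hC, ?_⟩
  · have := (h.tendsto_rowError.add ((h.tendsto_rowError.mul_const (M / δ)).const_mul 4)).const_mul
      (δ / 2)⁻¹
    simpa using this
  · filter_upwards [h.eventually_coercive_partial hδ hco] with N hN x hx
    have hcoN := fun v hv => hN v (vanishAfter_mono hx.2 hv)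
    have hdet := det_mainMat_ne_zero (hmem x hx) (half_pos hδ) hcoN
    refine ⟨hdet, fun i => ?_⟩
    rw [le_inv_mul_iff₀ (half_pos hδ)]
    refine (norm_sub_le_of_weak hcoN (finOp_sub _ _ _ _) ((hK x hx).cutRow_mem (hmem x hx) i)
      (finVec_mem x i) (fun v hv => (hK x hx).weak h hF (hmem x hx) i hv)
      (fun v hv => finVec_weak (hmem x hx) hdet i hv) (h.norm_finRow_sub_le N (hmem x hx) i)
      (h.norm_finOp_sub_le N _)).trans ?_
    have := rowError_nonneg (lam := lam) (alpha := alpha) (c := c) (d := d) N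
    have := hC x hx i
    gcongr

end Approximation

end DiracInverse
end

noncomputable section

namespace DiracInverse

open scoped InnerProductSpace ENNReal

/-! ### Limits of integrals -/

/-- Convergence in the mean times uniform convergence: `PΦ - pφ = Φ(P - p) + (Φ - φ)p`, with `Φ`
eventually bounded by `C + 1`. -/
lemma tendsto_integral_mul_of_uniform {μ : Measure ℝ} {P : ℕ → ℝ → ℝ} {p : ℝ → ℝ}
    {Φ : ℕ → ℝ → ℂ} {φ : ℝ → ℂ} {C : ℝ} {E : ℕ → ℝ} (hp : Integrable p μ)
    (hP : ∀ᶠ N in atTop, Integrable (P N) μ)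
    (hlim : Tendsto (fun N => ∫⁻ t, ‖P N t - p t‖ₑ ∂μ) atTop (𝓝 0))
    (hφ : AEStronglyMeasurable φ μ) (hΦ : ∀ᶠ N in atTop, AEStronglyMeasurable (Φ N) μ)
    (hC : ∀ᵐ t ∂μ, ‖φ t‖ ≤ C) (hE : Tendsto E atTop (𝓝 0))
    (hEΦ : ∀ᶠ N in atTop, ∀ᵐ t ∂μ, ‖Φ N t - φ t‖ ≤ E N) :
    Tendsto (fun N => ∫ t, (P N t : ℂ) * Φ N t ∂μ) atTop (𝓝 (∫ t, (p t : ℂ) * φ t ∂μ)) := by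
  have hbound : ∀ᶠ N in atTop, ∀ᵐ t ∂μ, ‖Φ N t‖ ≤ C + 1 := by
    filter_upwards [hEΦ, hE.eventually (gt_mem_nhds zero_lt_one)] with N h1 h2
    filter_upwards [h1, hC] with t h3 h4
    have := norm_sub_norm_le (Φ N t) (φ t)
    linarith
  refine tendsto_integral_of_L1 (fun t => (p t : ℂ) * φ t) (hp.ofReal.aestronglyMeasurable.mul hφ) ?_ ?_
  · filter_upwards [hP, hΦ, hbound] with N h1 h2 h3
    exact h1.ofReal.mul_bdd h2 h3
  · have hlim2 : Tendsto (fun N => ENNReal.ofReal (C + 1) * (∫⁻ t, ‖P N t - p t‖ₑ ∂μ)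
        + ENNReal.ofReal (E N) * ∫⁻ t, ‖p t‖ₑ ∂μ) atTop (𝓝 0) := by
      have h1 := ENNReal.Tendsto.const_mul (a := ENNReal.ofReal (C + 1)) hlim (by simp)
      have h2 := ENNReal.Tendsto.mul_const (b := ∫⁻ t, ‖p t‖ₑ ∂μ)
        (ENNReal.tendsto_ofReal hE) (Or.inr hp.2.ne)
      have := h1.add h2
      simpa using this
    refine tendsto_of_tendsto_of_tendsto_of_le_of_le' tendsto_const_nhds hlim2
      (Eventually.of_forall fun _ => zero_le) ?_
    filter_upwards [hEΦ, hbound] with N h1 h2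
    rw [← lintegral_const_mul' _ _ ENNReal.ofReal_ne_top,
      ← lintegral_const_mul' _ _ ENNReal.ofReal_ne_top,
      ← lintegral_add_right' _ (hp.aestronglyMeasurable.enorm.const_mul _)]
    refine lintegral_mono_ae ?_
    filter_upwards [h1, h2] with t h1 h2
    have e : (P N t : ℂ) * Φ N t - (p t : ℂ) * φ t
        = Φ N t * ((P N t - p t : ℝ) : ℂ) + (Φ N t - φ t) * (p t : ℂ) := by
      push_cast; ring
    rw [e]
    refine (enorm_add_le _ _).trans (add_le_add ?_ ?_)
    · rw [enorm_mul]
      refine mul_le_mul' ?_ (by rw [← ofReal_norm, ← ofReal_norm, Complex.norm_real])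
      rw [← ofReal_norm]
      exact ENNReal.ofReal_le_ofReal h2
    · rw [enorm_mul]
      refine mul_le_mul' ?_ (by rw [← ofReal_norm, ← ofReal_norm, Complex.norm_real])
      rw [← ofReal_norm]
      exact ENNReal.ofReal_le_ofReal h1

lemma tendsto_lintegral_enorm_of_eLpNorm_two {μ : Measure ℝ} [IsFiniteMeasure μ]
    {f : ℕ → ℝ → ℝ} (hf : ∀ᶠ N in atTop, AEStronglyMeasurable (f N) μ)
    (h : Tendsto (fun N => eLpNorm (f N) 2 μ) atTop (𝓝 0)) :
    Tendsto (fun N => ∫⁻ t, ‖f N t‖ₑ ∂μ) atTop (𝓝 0) := by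
  have h1 := ENNReal.Tendsto.mul_const (b := μ univ ^ (1 / (1 : ℝ≥0∞).toReal - 1 / (2 : ℝ≥0∞).toReal)) h
    (Or.inr (ENNReal.rpow_ne_top_of_nonneg (by norm_num) (measure_ne_top _ _)))
  rw [zero_mul] at h1
  refine tendsto_of_tendsto_of_tendsto_of_le_of_le' tendsto_const_nhds h1
    (Eventually.of_forall fun _ => zero_le) ?_
  filter_upwards [hf] with N hN
  rw [← eLpNorm_one_eq_lintegral_enorm]
  exact eLpNorm_le_eLpNorm_mul_rpow_measure_univ (by norm_num) hN

lemma memLp_of_continuousOn_Icc {f : ℝ → ℝ} {b : ℝ} (hf : ContinuousOn f (Icc 0 b)) :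
    MemLp f 2 (volume.restrict (Ioo 0 b)) := by
  obtain ⟨C, hC⟩ := isCompact_Icc.exists_bound_of_continuousOn hf
  refine MemLp.of_bound ((hf.mono Ioo_subset_Icc_self).aestronglyMeasurable measurableSet_Ioo) C ?_
  filter_upwards [ae_restrict_mem measurableSet_Ioo] with t ht
  exact hC t ⟨ht.1.le, ht.2.le⟩

/-- Adding a uniformly convergent sequence of continuous functions to a sequence converging in the
mean. -/
lemma memLp_and_tendsto_add_uniform {b : ℝ} {g S : ℝ → ℝ} {G T : ℕ → ℝ → ℝ} {E : ℕ → ℝ}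
    (hg : MemLp g 2 (volume.restrict (Ioo 0 b)))
    (hG : ∀ N, MemLp (G N) 2 (volume.restrict (Ioo 0 b)))
    (hlim : Tendsto (fun N => eLpNorm (fun t => G N t - g t) 2 (volume.restrict (Ioo 0 b)))
      atTop (𝓝 0))
    (hT : ∀ᶠ N in atTop, ContinuousOn (T N) (Icc 0 b)) (hE : Tendsto E atTop (𝓝 0))
    (hTS : ∀ᶠ N in atTop, ∀ x ∈ Icc 0 b, |T N x - S x| ≤ E N) :
    MemLp (fun t => g t + S t) 2 (volume.restrict (Ioo 0 b)) ∧
    Tendsto (fun N => eLpNorm (fun t => (G N t + T N t) - (g t + S t)) 2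
      (volume.restrict (Ioo 0 b))) atTop (𝓝 0) := by
  have hS : ContinuousOn S (Icc 0 b) := by
    have hu : TendstoUniformlyOn T S atTop (Icc 0 b) := by
      rw [Metric.tendstoUniformlyOn_iff]
      intro ε hε
      filter_upwards [hE.eventually (gt_mem_nhds hε), hTS] with N h1 h2 x hx
      rw [dist_comm, Real.dist_eq]
      exact (h2 x hx).trans_lt h1
    exact hu.continuousOn hT.frequently
  have hSm := memLp_of_continuousOn_Icc hS
  refine ⟨hg.add hSm, ?_⟩
  set κ : ℝ≥0∞ := (volume.restrict (Ioo 0 b)) univ ^ (2 : ℝ≥0∞).toReal⁻¹ with hκ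
  have hκt : κ ≠ ∞ := ENNReal.rpow_ne_top_of_nonneg (by norm_num) (measure_ne_top _ _)
  have h1 : Tendsto (fun N => eLpNorm (fun t => G N t - g t) 2 (volume.restrict (Ioo 0 b))
      + κ * ENNReal.ofReal (E N)) atTop (𝓝 0) := by
    have := hlim.add (ENNReal.Tendsto.const_mul (a := κ) (ENNReal.tendsto_ofReal hE) (Or.inr hκt))
    simpa using this
  refine tendsto_of_tendsto_of_tendsto_of_le_of_le' tendsto_const_nhds h1
    (Eventually.of_forall fun _ => zero_le) ?_
  filter_upwards [hT, hTS] with N h2 h3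
  have e : (fun t => (G N t + T N t) - (g t + S t)) = (fun t => G N t - g t) + fun t => T N t - S t := by
    ext t; simp only [Pi.add_apply]; ring
  rw [e]
  refine (eLpNorm_add_le ((hG N).sub hg).1 ((memLp_of_continuousOn_Icc h2).sub hSm).1
    (by norm_num)).trans (add_le_add le_rfl ?_)
  refine eLpNorm_le_of_ae_bound ?_
  filter_upwards [ae_restrict_mem measurableSet_Ioo] with t ht
  exact h3 t ⟨ht.1.le, ht.2.le⟩

/-! ### Doubling of the variable -/

/-- On the diagonal the kernel involves `c(2x)` and `d(2x)`; doubling the variable halves the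
density of the measure, so norms and null sets carry over. -/
lemma map_two_mul_volPi_le : Measure.map (fun x : ℝ => 2 * x) volPi ≤ volTwoPi := by
  have hs : Ioo 0 Real.pi = (fun x : ℝ => 2 * x) ⁻¹' Ioo 0 (2 * Real.pi) := by
    ext x
    simp only [mem_preimage, mem_Ioo]
    constructor <;> rintro ⟨h1, h2⟩ <;> constructor <;> linarith
  have hm : Measurable fun x : ℝ => 2 * x := measurable_id.const_mul 2
  rw [volPi, hs, ← Measure.restrict_map hm measurableSet_Ioo, Real.map_volume_mul_left two_ne_zero]
  refine (Measure.restrict_mono (Ioo_subset_Ioo_left (by linarith [Real.pi_pos]) :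
    Ioo 0 (2 * Real.pi) ⊆ Ioo (-(2 * Real.pi)) (2 * Real.pi)) le_rfl).trans ?_
  rw [Measure.restrict_smul]
  refine Measure.le_iff.2 fun s _ => ?_
  rw [Measure.smul_apply, smul_eq_mul]
  refine mul_le_of_le_one_left zero_le ?_
  rw [ENNReal.ofReal_le_one, abs_of_pos (by norm_num)]
  norm_num

lemma memLp_comp_two_mul {f : ℝ → ℝ} (hf : MemLp f 2 volTwoPi) :
    MemLp (fun x => f (2 * x)) 2 volPi :=
  (hf.mono_measure map_two_mul_volPi_le).comp_of_map (measurable_id.const_mul 2).aemeasurable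

lemma eLpNorm_comp_two_mul_le {f : ℝ → ℝ} (hf : MemLp f 2 volTwoPi) :
    eLpNorm (fun x => f (2 * x)) 2 volPi ≤ eLpNorm f 2 volTwoPi := by
  have h := eLpNorm_map_measure (p := 2) (hf.mono_measure map_two_mul_volPi_le).1
    (measurable_id.const_mul 2).aemeasurable
  exact h.symm.le.trans (eLpNorm_mono_measure _ map_two_mul_volPi_le)

lemma ae_comp_two_mul {P : ℝ → Prop} (h : ∀ᵐ y ∂volTwoPi, P y) : ∀ᵐ x ∂volPi, P (2 * x) :=
  ae_of_ae_map (measurable_id.const_mul 2).aemeasurable (ae_mono map_two_mul_volPi_le h)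

end DiracInverse
end

noncomputable section

namespace DiracInverse

open scoped InnerProductSpace ENNReal

/-! ### The potential -/

/-- The first entry of the potential recovered from the main equation. -/
def limP (c d : ℝ → ℝ) (K : ℝ → ℝ → Matrix (Fin 2) (Fin 2) ℝ) (x : ℝ) : ℝ :=
  -d (2 * x) + (⟪cutRow K x 0, kernelRow c d x 1⟫_ℝ + ⟪cutRow K x 1, kernelRow c d x 0⟫_ℝ)

/-- The second entry of the potential recovered from the main equation. -/
def limQ (c d : ℝ → ℝ) (K : ℝ → ℝ → Matrix (Fin 2) (Fin 2) ℝ) (x : ℝ) : ℝ :=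
  c (2 * x) + (⟪cutRow K x 1, kernelRow c d x 1⟫_ℝ - ⟪cutRow K x 0, kernelRow c d x 0⟫_ℝ)

section FiniteRank

variable {lam alpha : ℤ → ℝ} {N : ℕ} {x : ℝ}

lemma finDiag_partial (hx : x ∈ Icc 0 Real.pi)
    (hdet : (mainMat (partialCoef alpha N) (partialFreq lam N) x).det ≠ 0) (i l : Fin 2) :
    finDiag (partialCoef alpha N) (partialFreq lam N) x i l
      = -kernelMat (trigSum (Real.pi / 2) lam alpha N) (trigSum 0 lam alpha N) x x i l
        - ⟪finVec (partialCoef alpha N) (partialFreq lam N) x i,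
          finRow (partialCoef alpha N) (partialFreq lam N) x l⟫_ℝ := by
  rw [finDiag_eq hx hdet, ← kernelPartialSum_apply, kernelPartialSum_eq]

/-- In the commutator the terms at `x - t = 0` cancel and only the value at `2x` remains. The
potential can therefore converge in `L²` although the kernel itself has no control at a single
point. -/
lemma finP_partial (hx : x ∈ Icc 0 Real.pi)
    (hdet : (mainMat (partialCoef alpha N) (partialFreq lam N) x).det ≠ 0) :
    finP (partialCoef alpha N) (partialFreq lam N) x = -trigSum 0 lam alpha N (2 * x)
      + (⟪finVec (partialCoef alpha N) (partialFreq lam N) x 0,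
          finRow (partialCoef alpha N) (partialFreq lam N) x 1⟫_ℝ
        + ⟪finVec (partialCoef alpha N) (partialFreq lam N) x 1,
          finRow (partialCoef alpha N) (partialFreq lam N) x 0⟫_ℝ) := by
  rw [finP, finDiag_partial hx hdet, finDiag_partial hx hdet]
  simp only [kernelMat, Matrix.of_apply, Matrix.cons_val', Matrix.cons_val_zero,
    Matrix.cons_val_one, Matrix.cons_val_fin_one, ← two_mul]
  ring

lemma finQ_partial (hx : x ∈ Icc 0 Real.pi)
    (hdet : (mainMat (partialCoef alpha N) (partialFreq lam N) x).det ≠ 0) :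
    finQ (partialCoef alpha N) (partialFreq lam N) x = trigSum (Real.pi / 2) lam alpha N (2 * x)
      + (⟪finVec (partialCoef alpha N) (partialFreq lam N) x 1,
          finRow (partialCoef alpha N) (partialFreq lam N) x 1⟫_ℝ
        - ⟪finVec (partialCoef alpha N) (partialFreq lam N) x 0,
          finRow (partialCoef alpha N) (partialFreq lam N) x 0⟫_ℝ) := by
  rw [finQ, finDiag_partial hx hdet, finDiag_partial hx hdet]
  simp only [kernelMat, Matrix.of_apply, Matrix.cons_val', Matrix.cons_val_zero,
    Matrix.cons_val_one, Matrix.cons_val_fin_one, ← two_mul]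
  ring

end FiniteRank

section Continuity

variable {ι : Type*} [Fintype ι] [DecidableEq ι] {a m : ι → ℝ} {x : ℝ}

lemma continuousAt_finDiag (hx : (mainMat a m x).det ≠ 0) (i l : Fin 2) :
    ContinuousAt (fun s => finDiag a m s i l) x := by
  have e : (fun s => finDiag a m s i l)
      = fun s => -∑ k, pertMat a m s i k * a k * freeMat m s l k := by
    ext s
    rw [finDiag, Matrix.neg_apply, Matrix.mul_apply]
    simp only [Matrix.mul_diagonal, Matrix.transpose_apply]
  rw [e]
  exact (tendsto_finsetSum _ fun k _ => (((hasDerivAt_pertMat hx i k).continuousAt.mul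
    continuousAt_const).mul (hasDerivAt_freeMat x l k).continuousAt)).neg

lemma continuousAt_finP (hx : (mainMat a m x).det ≠ 0) : ContinuousAt (finP a m) x :=
  ((continuousAt_finDiag hx 0 1).add (continuousAt_finDiag hx 1 0)).neg

lemma continuousAt_finQ (hx : (mainMat a m x).det ≠ 0) : ContinuousAt (finQ a m) x :=
  (continuousAt_finDiag hx 0 0).sub (continuousAt_finDiag hx 1 1)

end Continuity

lemma abs_inner_sub_inner_le {V : Type*} [NormedAddCommGroup V] [InnerProductSpace ℝ V]
    {u u' r r' : V} {e E C M : ℝ} (hu : ‖u' - u‖ ≤ E) (hr : ‖r' - r‖ ≤ e) (hC : ‖u‖ ≤ C)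
    (hM : ‖r‖ ≤ M) : |⟪u', r'⟫_ℝ - ⟪u, r⟫_ℝ| ≤ E * (M + e) + C * e := by
  have h1 : ⟪u', r'⟫_ℝ - ⟪u, r⟫_ℝ = ⟪u' - u, r'⟫_ℝ + ⟪u, r' - r⟫_ℝ := by
    rw [inner_sub_left, inner_sub_right]; ring
  have h2 : ‖r'‖ ≤ M + e := by
    have := norm_sub_norm_le r' r
    linarith
  rw [h1]
  refine (abs_add_le _ _).trans (add_le_add ((abs_real_inner_le_norm _ _).trans ?_)
    ((abs_real_inner_le_norm _ _).trans ?_))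
  · exact mul_le_mul hu h2 (norm_nonneg _) ((norm_nonneg _).trans hu)
  · exact mul_le_mul hC hr (norm_nonneg _) ((norm_nonneg _).trans hC)

section Limit

variable {lam alpha : ℤ → ℝ} {c d : ℝ → ℝ} {F K : ℝ → ℝ → Matrix (Fin 2) (Fin 2) ℝ} {b : ℝ}

lemma tendsto_eLpNorm_comp_two_mul {f : ℝ → ℝ} {g : ℕ → ℝ → ℝ} (hf : MemLp f 2 volTwoPi)
    (hg : ∀ N, Continuous (g N)) (hb : b ≤ Real.pi)
    (h : Tendsto (fun N => eLpNorm (fun s => g N s - f s) 2 volTwoPi) atTop (𝓝 0)) :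
    Tendsto (fun N => eLpNorm (fun x => g N (2 * x) - f (2 * x)) 2 (volume.restrict (Ioo 0 b)))
      atTop (𝓝 0) := by
  refine tendsto_of_tendsto_of_tendsto_of_le_of_le tendsto_const_nhds h
    (fun _ => zero_le) fun N => ?_
  refine (eLpNorm_mono_measure _ (Measure.restrict_mono (Ioo_subset_Ioo_right hb) le_rfl)).trans ?_
  exact eLpNorm_comp_two_mul_le (f := fun s => g N s - f s) ((memLp_volTwoPi (hg N)).sub hf)

/-- The potential recovered from the main equation is the limit in the mean of potentials belonging
to kernels of finite rank. -/
theorem exists_approx_potential (h : IsKernelPair lam alpha c d) (hF : IsMainKernel lam alpha F)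
    (hb : b ∈ Icc 0 Real.pi) (hK : ∀ x ∈ Icc 0 b, SolvesMainEquation F K x) {δ : ℝ} (hδ : 0 < δ)
    (hco : ∀ v ∈ vanishAfter b, δ * ‖v‖ ^ 2 ≤ ‖v‖ ^ 2 + ⟪kernelOp c d v, v⟫_ℝ) :
    MemLp (limP c d K) 2 (volume.restrict (Ioo 0 b)) ∧
    MemLp (limQ c d K) 2 (volume.restrict (Ioo 0 b)) ∧
    Tendsto (fun N => eLpNorm (fun t => finP (partialCoef alpha N) (partialFreq lam N) t
      - limP c d K t) 2 (volume.restrict (Ioo 0 b))) atTop (𝓝 0) ∧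
    Tendsto (fun N => eLpNorm (fun t => finQ (partialCoef alpha N) (partialFreq lam N) t
      - limQ c d K t) 2 (volume.restrict (Ioo 0 b))) atTop (𝓝 0) := by
  obtain ⟨C, E, hC0, hE, hC, happ⟩ := exists_uniform_approx h hF hb hK hδ hco
  obtain ⟨M, hM0, hM⟩ := h.exists_bound_kernelRow
  have hmem : ∀ x ∈ Icc 0 b, x ∈ Icc 0 Real.pi := fun x hx => ⟨hx.1, hx.2.trans hb.2⟩
  set e := rowError lam alpha c d with he
  -- Each entry of the potential contains two inner products, each within `E N * (M + e N) + C * e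
  -- N` of its limit.
  set W : ℕ → ℝ := fun N => 2 * (E N * (M + e N) + C * e N) with hW
  have hWlim : Tendsto W atTop (𝓝 0) := by
    have := ((hE.mul (h.tendsto_rowError.const_add M)).add (h.tendsto_rowError.const_mul C)).const_mul 2
    simpa using this
  have hle : volume.restrict (Ioo 0 b) ≤ volPi :=
    Measure.restrict_mono (Ioo_subset_Ioo_right hb.2) le_rfl
  have hcts : ∀ θ N, Continuous fun x => trigSum θ lam alpha N (2 * x) := fun θ N =>
    (continuous_trigSum θ lam alpha N).comp (continuous_const.mul continuous_id)
  have hpart : ∀ᶠ N in atTop, ∀ x ∈ Icc 0 b, ∀ i j,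
      |⟪finVec (partialCoef alpha N) (partialFreq lam N) x i,
          finRow (partialCoef alpha N) (partialFreq lam N) x j⟫_ℝ
        - ⟪cutRow K x i, kernelRow c d x j⟫_ℝ| ≤ E N * (M + e N) + C * e N := by
    filter_upwards [happ] with N hN x hx i j
    exact abs_inner_sub_inner_le ((hN x hx).2 i) (h.norm_finRow_sub_le N (hmem x hx) j)
      (hC x hx i) (hM x (hmem x hx) j)
  have hdmem : MemLp (fun x => -d (2 * x)) 2 (volume.restrict (Ioo 0 b)) :=
    ((memLp_comp_two_mul h.memLp_odd).mono_measure hle).neg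
  have hcmem : MemLp (fun x => c (2 * x)) 2 (volume.restrict (Ioo 0 b)) :=
    (memLp_comp_two_mul h.memLp_even).mono_measure hle
  -- The trigonometric sum converges only in the mean; once it is split off, the rest of the
  -- potential is continuous and converges uniformly.
  have key1 := memLp_and_tendsto_add_uniform (b := b) (g := fun x => -d (2 * x))
    (S := fun x => ⟪cutRow K x 0, kernelRow c d x 1⟫_ℝ + ⟪cutRow K x 1, kernelRow c d x 0⟫_ℝ)
    (G := fun N x => -trigSum 0 lam alpha N (2 * x))
    (T := fun N x => finP (partialCoef alpha N) (partialFreq lam N) x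
      + trigSum 0 lam alpha N (2 * x)) (E := W) hdmem
    (fun N => memLp_of_continuousOn_Icc (hcts 0 N).neg.continuousOn)
    (by
      refine (tendsto_eLpNorm_comp_two_mul h.memLp_odd (continuous_trigSum 0 lam alpha) hb.2
        h.tendsto_odd).congr fun N => ?_
      rw [← eLpNorm_neg]
      congr 1
      ext x
      simp only [Pi.neg_apply]
      ring)
    (by
      filter_upwards [happ] with N hN x hx
      exact ((continuousAt_finP (hN x hx).1).add (hcts 0 N).continuousAt).continuousWithinAt)
    hWlim
    (by
      filter_upwards [happ, hpart] with N hN h2 x hx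
      rw [finP_partial (hmem x hx) (hN x hx).1]
      have h3 := abs_le.1 (h2 x hx 0 1)
      have h4 := abs_le.1 (h2 x hx 1 0)
      rw [abs_le]
      simp only [hW]
      constructor <;> linarith)
  have key2 := memLp_and_tendsto_add_uniform (b := b) (g := fun x => c (2 * x))
    (S := fun x => ⟪cutRow K x 1, kernelRow c d x 1⟫_ℝ - ⟪cutRow K x 0, kernelRow c d x 0⟫_ℝ)
    (G := fun N x => trigSum (Real.pi / 2) lam alpha N (2 * x))
    (T := fun N x => finQ (partialCoef alpha N) (partialFreq lam N) x
      - trigSum (Real.pi / 2) lam alpha N (2 * x)) (E := W) hcmem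
    (fun N => memLp_of_continuousOn_Icc (hcts _ N).continuousOn)
    (tendsto_eLpNorm_comp_two_mul h.memLp_even (continuous_trigSum _ lam alpha) hb.2
        h.tendsto_even)
    (by
      filter_upwards [happ] with N hN x hx
      exact ((continuousAt_finQ (hN x hx).1).sub (hcts _ N).continuousAt).continuousWithinAt)
    hWlim
    (by
      filter_upwards [happ, hpart] with N hN h2 x hx
      rw [finQ_partial (hmem x hx) (hN x hx).1]
      have h3 := abs_le.1 (h2 x hx 1 1)
      have h4 := abs_le.1 (h2 x hx 0 0)
      rw [abs_le]
      simp only [hW]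
      constructor <;> linarith)
  refine ⟨key1.1, key2.1, key1.2.congr fun N => ?_, key2.2.congr fun N => ?_⟩
  · congr 1; ext t; simp only [limP]; ring
  · congr 1; ext t; simp only [limQ]; ring

end Limit

end DiracInverse
end

noncomputable section

namespace DiracInverse

open scoped InnerProductSpace ENNReal

/-! ### The Dirac system in integrated form -/

/-- The right hand side of the Dirac system solved for the derivative. -/
def diracField (p q : ℝ) (z : ℂ) (w : Fin 2 → ℂ) : Fin 2 → ℂ :=
  ![-(z * w 1 - q * w 0 + p * w 1), z * w 0 - p * w 0 - q * w 1]

lemma B_mulVec_diracField (p q : ℝ → ℝ) (x : ℝ) (z : ℂ) (w : Fin 2 → ℂ) :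
    (B ℂ).mulVec (diracField (p x) (q x) z w)
      + ((potential p q x).map Complex.ofReal).mulVec w = z • w := by
  ext i
  have h : ((potential p q x).map Complex.ofReal).mulVec w i
      = ![p x * w 0 + q x * w 1, q x * w 0 - p x * w 1] i := by
    rw [Matrix.mulVec, dotProduct, Fin.sum_univ_two]
    fin_cases i <;> simp [potential, sub_eq_add_neg]
  rw [Pi.add_apply, h]
  fin_cases i
  · simp only [Fin.zero_eta, B_mulVec_zero, diracField, Matrix.cons_val_zero, Matrix.cons_val_one,
      Pi.smul_apply, smul_eq_mul]
    ring
  · simp only [Fin.mk_one, B_mulVec_one, diracField, Matrix.cons_val_zero, Matrix.cons_val_one,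
      Pi.smul_apply, smul_eq_mul]
    ring

section IntegralForm

variable {μ : Measure ℝ} {p q : ℝ → ℝ} {w : ℝ → Fin 2 → ℂ}

lemma integrable_diracField (z : ℂ) (h1 : ∀ j, Integrable (fun t => w t j) μ)
    (hp : ∀ j, Integrable (fun t => (p t : ℂ) * w t j) μ)
    (hq : ∀ j, Integrable (fun t => (q t : ℂ) * w t j) μ) (i : Fin 2) :
    Integrable (fun t => diracField (p t) (q t) z (w t) i) μ := by
  fin_cases i
  · exact ((((h1 1).const_mul z).sub (hq 0)).add (hp 1)).neg
  · exact (((h1 0).const_mul z).sub (hp 0)).sub (hq 1)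

lemma integral_diracField (z : ℂ) (h1 : ∀ j, Integrable (fun t => w t j) μ)
    (hp : ∀ j, Integrable (fun t => (p t : ℂ) * w t j) μ)
    (hq : ∀ j, Integrable (fun t => (q t : ℂ) * w t j) μ) (i : Fin 2) :
    ∫ t, diracField (p t) (q t) z (w t) i ∂μ
      = ![-(z * ∫ t, w t 1 ∂μ) + (∫ t, q t * w t 0 ∂μ) - ∫ t, p t * w t 1 ∂μ,
        (z * ∫ t, w t 0 ∂μ) - (∫ t, p t * w t 0 ∂μ) - ∫ t, q t * w t 1 ∂μ] i := by
  fin_cases i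
  · have e := integral_neg (μ := μ) fun t => z * w t 1 - q t * w t 0 + p t * w t 1
    have e2 := integral_add (((h1 1).const_mul z).sub (hq 0)) (hp 1)
    have e3 := integral_sub ((h1 1).const_mul z) (hq 0)
    simp only [Pi.sub_apply] at e2
    simp only [Fin.zero_eta, diracField, Matrix.cons_val_zero]
    rw [e, e2, e3, integral_const_mul]
    ring
  · have e2 := integral_sub (((h1 0).const_mul z).sub (hp 0)) (hq 1)
    have e3 := integral_sub ((h1 0).const_mul z) (hp 0)
    simp only [Pi.sub_apply] at e2
    simp only [Fin.mk_one, diracField, Matrix.cons_val_one, Matrix.cons_val_fin_one]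
    rw [e2, e3, integral_const_mul]

end IntegralForm

lemma freePair_sub (z : ℂ) (u v : VecL2) : freePair z (u - v) = freePair z u - freePair z v := by
  rw [sub_eq_add_neg, freePair_add, freePair_neg, ← sub_eq_add_neg]

section FiniteRank

variable {ι : Type*} [Fintype ι] [DecidableEq ι] {a m : ι → ℝ} {b : ℝ}

lemma continuousOn_finSol (hdet : ∀ x ∈ Icc 0 b, (mainMat a m x).det ≠ 0) (z : ℂ) (i : Fin 2) :
    ContinuousOn (fun x => finSol a m x z i) (Icc 0 b) := fun x hx =>
  (hasDerivAt_finSol (hdet x hx) z i).continuousAt.continuousWithinAt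

lemma continuousOn_finP (hdet : ∀ x ∈ Icc 0 b, (mainMat a m x).det ≠ 0) :
    ContinuousOn (finP a m) (Icc 0 b) := fun x hx =>
  (continuousAt_finP (hdet x hx)).continuousWithinAt

lemma continuousOn_finQ (hdet : ∀ x ∈ Icc 0 b, (mainMat a m x).det ≠ 0) :
    ContinuousOn (finQ a m) (Icc 0 b) := fun x hx =>
  (continuousAt_finQ (hdet x hx)).continuousWithinAt

lemma finSol_zero (z : ℂ) (i : Fin 2) : finSol a m 0 z i = freeSol 0 z i := by
  simp [finSol, cosInt]

lemma continuousOn_diracField {p q : ℝ → ℝ} {w : ℝ → Fin 2 → ℂ} {s : Set ℝ}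
    (hp : ContinuousOn p s) (hq : ContinuousOn q s) (hw : ∀ j, ContinuousOn (fun t => w t j) s)
    (z : ℂ) (i : Fin 2) : ContinuousOn (fun t => diracField (p t) (q t) z (w t) i) s := by
  have hp' := Complex.continuous_ofReal.comp_continuousOn hp
  have hq' := Complex.continuous_ofReal.comp_continuousOn hq
  fin_cases i
  · exact (((continuousOn_const.mul (hw 1)).sub (hq'.mul (hw 0))).add (hp'.mul (hw 1))).neg
  · exact ((continuousOn_const.mul (hw 0)).sub (hp'.mul (hw 0))).sub (hq'.mul (hw 1))

lemma finSol_eq_integral (hdet : ∀ x ∈ Icc 0 b, (mainMat a m x).det ≠ 0) (z : ℂ) (i : Fin 2)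
    {x : ℝ} (hx : x ∈ Icc 0 b) : finSol a m x z i = freeSol 0 z i
      + ∫ t in (0 : ℝ)..x, diracField (finP a m t) (finQ a m t) z (finSol a m t z) i := by
  have hsub : uIcc 0 x ⊆ Icc 0 b := by
    rw [uIcc_of_le hx.1]; exact Icc_subset_Icc_right hx.2
  have hd : ∀ t ∈ uIcc 0 x, HasDerivAt (fun s => finSol a m s z i)
      (diracField (finP a m t) (finQ a m t) z (finSol a m t z) i) t := fun t ht =>
    hasDerivAt_finSol (hdet t (hsub ht)) z i
  have hc := (continuousOn_diracField (continuousOn_finP hdet) (continuousOn_finQ hdet)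
    (fun j => continuousOn_finSol hdet z j) z i).mono hsub
  rw [intervalIntegral.integral_eq_sub_of_hasDerivAt hd hc.intervalIntegrable, finSol_zero]
  ring

end FiniteRank

section Limit

variable {lam alpha : ℤ → ℝ} {c d : ℝ → ℝ} {F K : ℝ → ℝ → Matrix (Fin 2) (Fin 2) ℝ} {b : ℝ}

/-- The solution recovered from the main equation satisfies the Dirac system in integrated form. -/
theorem phi_eq_integral (h : IsKernelPair lam alpha c d) (hF : IsMainKernel lam alpha F)
    (hb : b ∈ Icc 0 Real.pi) (hK : ∀ x ∈ Icc 0 b, SolvesMainEquation F K x) {δ : ℝ} (hδ : 0 < δ)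
    (hco : ∀ v ∈ vanishAfter b, δ * ‖v‖ ^ 2 ≤ ‖v‖ ^ 2 + ⟪kernelOp c d v, v⟫_ℝ) (z : ℂ) (i : Fin 2) :
    Integrable (fun t => diracField (limP c d K t) (limQ c d K t) z (phi K t z) i)
      (volume.restrict (Ioo 0 b)) ∧
    ∀ x ∈ Icc 0 b, phi K x z i = freeSol 0 z i
      + ∫ t in (0 : ℝ)..x, diracField (limP c d K t) (limQ c d K t) z (phi K t z) i := by
  obtain ⟨_, E, -, hE, -, happ⟩ := exists_uniform_approx h hF hb hK hδ hco
  obtain ⟨hp, hq, hpl, hql⟩ := exists_approx_potential h hF hb hK hδ hco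
  obtain ⟨Cz, hCz, hpair⟩ := exists_norm_freePair_le z
  have hmem : ∀ x ∈ Icc 0 b, x ∈ Icc 0 Real.pi := fun x hx => ⟨hx.1, hx.2.trans hb.2⟩
  have hunif : ∀ᶠ N in atTop, ∀ x ∈ Icc 0 b, ∀ j,
      ‖finSol (partialCoef alpha N) (partialFreq lam N) x z j - phi K x z j‖ ≤ Cz * E N := by
    filter_upwards [happ] with N hN x hx j
    rw [finSol_eq (hmem x hx), (hK x hx).phi_eq (hmem x hx), add_sub_add_left_eq_sub, ← freePair_sub]
    exact (hpair _).trans (mul_le_mul_of_nonneg_left ((hN x hx).2 j) hCz)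
  have hElim : Tendsto (fun N => Cz * E N) atTop (𝓝 0) := by simpa using hE.const_mul Cz
  have hφc : ∀ j, ContinuousOn (fun x => phi K x z j) (Icc 0 b) := by
    intro j
    have hu : TendstoUniformlyOn
        (fun N x => finSol (partialCoef alpha N) (partialFreq lam N) x z j)
        (fun x => phi K x z j) atTop (Icc 0 b) := by
      rw [Metric.tendstoUniformlyOn_iff]
      intro ε hε
      filter_upwards [hElim.eventually (gt_mem_nhds hε), hunif] with N h1 h2 x hx
      rw [dist_comm, dist_eq_norm]
      exact (h2 x hx j).trans_lt h1
    exact hu.continuousOn (happ.mono fun N hN =>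
      continuousOn_finSol (fun x hx => (hN x hx).1) z j).frequently
  choose C hC using fun j => isCompact_Icc.exists_bound_of_continuousOn (hφc j)
  -- Every integral in the Dirac system passes to the limit, because the potentials converge in the
  -- mean and the solutions uniformly. The term without potential is the case of the constant factor
  -- `1`.
  have main : ∀ x ∈ Icc 0 b, ∀ j,
      (Integrable (fun t => phi K t z j) (volume.restrict (Ioo 0 x))
        ∧ Integrable (fun t => (limP c d K t : ℂ) * phi K t z j) (volume.restrict (Ioo 0 x))
        ∧ Integrable (fun t => (limQ c d K t : ℂ) * phi K t z j) (volume.restrict (Ioo 0 x)))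
      ∧ Tendsto (fun N => ∫ t in Ioo 0 x, finSol (partialCoef alpha N) (partialFreq lam N) t z j)
        atTop (𝓝 (∫ t in Ioo 0 x, phi K t z j))
      ∧ Tendsto (fun N => ∫ t in Ioo 0 x, (finP (partialCoef alpha N) (partialFreq lam N) t : ℂ)
          * finSol (partialCoef alpha N) (partialFreq lam N) t z j)
        atTop (𝓝 (∫ t in Ioo 0 x, (limP c d K t : ℂ) * phi K t z j))
      ∧ Tendsto (fun N => ∫ t in Ioo 0 x, (finQ (partialCoef alpha N) (partialFreq lam N) t : ℂ)
          * finSol (partialCoef alpha N) (partialFreq lam N) t z j)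
        atTop (𝓝 (∫ t in Ioo 0 x, (limQ c d K t : ℂ) * phi K t z j)) := by
    intro x hx j
    have hsub : Ioo 0 x ⊆ Icc 0 b := Ioo_subset_Icc_self.trans (Icc_subset_Icc_right hx.2)
    have hle : volume.restrict (Ioo 0 x) ≤ volume.restrict (Ioo 0 b) :=
      Measure.restrict_mono (Ioo_subset_Ioo_right hx.2) le_rfl
    have hmeas : ∀ {f : ℝ → ℂ}, ContinuousOn f (Icc 0 b) →
        AEStronglyMeasurable f (volume.restrict (Ioo 0 x)) := fun hf =>
      (hf.mono hsub).aestronglyMeasurable measurableSet_Ioo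
    have hmeasR : ∀ {f : ℝ → ℝ}, ContinuousOn f (Icc 0 b) →
        AEStronglyMeasurable f (volume.restrict (Ioo 0 x)) := fun hf =>
      (hf.mono hsub).aestronglyMeasurable measurableSet_Ioo
    have hbd : ∀ᵐ t ∂volume.restrict (Ioo 0 x), ‖phi K t z j‖ ≤ C j := by
      filter_upwards [ae_restrict_mem measurableSet_Ioo] with t ht
      exact hC j t (hsub ht)
    have hbdN : ∀ᶠ N in atTop, ∀ᵐ t ∂volume.restrict (Ioo 0 x),
        ‖finSol (partialCoef alpha N) (partialFreq lam N) t z j - phi K t z j‖ ≤ Cz * E N := by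
      filter_upwards [hunif] with N hN
      filter_upwards [ae_restrict_mem measurableSet_Ioo] with t ht
      exact hN t (hsub ht) j
    have hmN : ∀ᶠ N in atTop, AEStronglyMeasurable
        (fun t => finSol (partialCoef alpha N) (partialFreq lam N) t z j)
        (volume.restrict (Ioo 0 x)) := by
      filter_upwards [happ] with N hN
      exact hmeas (continuousOn_finSol (fun x hx => (hN x hx).1) z j)
    have hP : ∀ᶠ N in atTop, MemLp (finP (partialCoef alpha N) (partialFreq lam N)) 2
        (volume.restrict (Ioo 0 b)) := by
      filter_upwards [happ] with N hN
      exact memLp_of_continuousOn_Icc (continuousOn_finP fun x hx => (hN x hx).1)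
    have hQ : ∀ᶠ N in atTop, MemLp (finQ (partialCoef alpha N) (partialFreq lam N)) 2
        (volume.restrict (Ioo 0 b)) := by
      filter_upwards [happ] with N hN
      exact memLp_of_continuousOn_Icc (continuousOn_finQ fun x hx => (hN x hx).1)
    have general : ∀ {g : ℝ → ℝ} {G : ℕ → ℝ → ℝ}, MemLp g 2 (volume.restrict (Ioo 0 b)) →
        (∀ᶠ N in atTop, MemLp (G N) 2 (volume.restrict (Ioo 0 b))) →
        Tendsto (fun N => eLpNorm (fun t => G N t - g t) 2 (volume.restrict (Ioo 0 b))) atTop (𝓝 0) →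
        Integrable (fun t => (g t : ℂ) * phi K t z j) (volume.restrict (Ioo 0 x)) ∧
        Tendsto (fun N => ∫ t in Ioo 0 x, (G N t : ℂ)
          * finSol (partialCoef alpha N) (partialFreq lam N) t z j)
        atTop (𝓝 (∫ t in Ioo 0 x, (g t : ℂ) * phi K t z j)) := by
      intro g G hg hG hl
      have hgx := (hg.mono_measure hle).integrable (by norm_num)
      refine ⟨hgx.ofReal.mul_bdd (hmeas (hφc j)) hbd, ?_⟩
      refine tendsto_integral_mul_of_uniform hgx
        (hG.mono fun N hN => (hN.mono_measure hle).integrable (by norm_num)) ?_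
        (hmeas (hφc j)) hmN hbd hElim hbdN
      refine tendsto_lintegral_enorm_of_eLpNorm_two (f := fun N t => G N t - g t)
        (hG.mono fun N hN => ((hN.sub hg).mono_measure hle).1) ?_
      exact tendsto_of_tendsto_of_tendsto_of_le_of_le tendsto_const_nhds hl (fun _ => zero_le)
        fun N => eLpNorm_mono_measure _ hle
    have g1 := general (g := fun _ => 1) (G := fun _ _ => 1) (memLp_const 1)
      (Eventually.of_forall fun _ => memLp_const 1) (by simp)
    simp only [Complex.ofReal_one, one_mul] at g1
    have g2 := general hp hP hpl
    have g3 := general hq hQ hql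
    exact ⟨⟨g1.1, g2.1, g3.1⟩, g1.2, g2.2, g3.2⟩
  refine ⟨?_, fun x hx => ?_⟩
  · have hbb : b ∈ Icc 0 b := ⟨hb.1, le_rfl⟩
    exact integrable_diracField z (fun j => (main b hbb j).1.1) (fun j => (main b hbb j).1.2.1)
      (fun j => (main b hbb j).1.2.2) i
  · have hlim : Tendsto (fun N => finSol (partialCoef alpha N) (partialFreq lam N) x z i) atTop
        (𝓝 (phi K x z i)) := by
      rw [tendsto_iff_norm_sub_tendsto_zero]
      exact squeeze_zero' (Eventually.of_forall fun _ => norm_nonneg _)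
        (hunif.mono fun N hN => hN x hx i) hElim
    -- Both sides are limits of the integrated system for the partial sums.
    refine tendsto_nhds_unique hlim ?_
    rw [intervalIntegral.integral_of_le hx.1, integral_Ioc_eq_integral_Ioo,
      integral_diracField z (fun j => (main x hx j).1.1) (fun j => (main x hx j).1.2.1)
      (fun j => (main x hx j).1.2.2) i]
    have hN : ∀ᶠ N in atTop, freeSol 0 z i
        + ![-(z * ∫ t in Ioo 0 x, finSol (partialCoef alpha N) (partialFreq lam N) t z 1)
            + (∫ t in Ioo 0 x, (finQ (partialCoef alpha N) (partialFreq lam N) t : ℂ)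
                * finSol (partialCoef alpha N) (partialFreq lam N) t z 0)
            - ∫ t in Ioo 0 x, (finP (partialCoef alpha N) (partialFreq lam N) t : ℂ)
                * finSol (partialCoef alpha N) (partialFreq lam N) t z 1,
          (z * ∫ t in Ioo 0 x, finSol (partialCoef alpha N) (partialFreq lam N) t z 0)
            - (∫ t in Ioo 0 x, (finP (partialCoef alpha N) (partialFreq lam N) t : ℂ)
                * finSol (partialCoef alpha N) (partialFreq lam N) t z 0)
            - ∫ t in Ioo 0 x, (finQ (partialCoef alpha N) (partialFreq lam N) t : ℂ)
                * finSol (partialCoef alpha N) (partialFreq lam N) t z 1] i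
        = finSol (partialCoef alpha N) (partialFreq lam N) x z i := by
      filter_upwards [happ] with N hN
      have hdet := fun x hx => (hN x hx).1
      have hsub : Icc 0 x ⊆ Icc 0 b := Icc_subset_Icc_right hx.2
      have hint : ∀ {f : ℝ → ℂ}, ContinuousOn f (Icc 0 b) →
          Integrable f (volume.restrict (Ioo 0 x)) := fun hf =>
        ((hf.mono hsub).integrableOn_Icc).mono_set Ioo_subset_Icc_self
      have hpc := Complex.continuous_ofReal.comp_continuousOn (continuousOn_finP hdet)
      have hqc := Complex.continuous_ofReal.comp_continuousOn (continuousOn_finQ hdet)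
      rw [finSol_eq_integral hdet z i hx, intervalIntegral.integral_of_le hx.1,
        integral_Ioc_eq_integral_Ioo,
        integral_diracField z (fun j => hint (continuousOn_finSol hdet z j))
          (fun j => hint (hpc.mul (continuousOn_finSol hdet z j)))
          (fun j => hint (hqc.mul (continuousOn_finSol hdet z j))) i]
    refine Tendsto.congr' hN (tendsto_const_nhds.add ?_)
    have m0 := (main x hx 0).2
    have m1 := (main x hx 1).2
    fin_cases i
    · exact (((m1.1.const_mul z).neg).add m0.2.2).sub m1.2.1
    · exact ((m0.1.const_mul z).sub m0.2.1).sub m1.2.2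

end Limit

end DiracInverse
end

noncomputable section

namespace DiracInverse

open scoped InnerProductSpace ENNReal

/-! ### Absolute continuity and the Dirac system -/

section VectorIntegral

variable {f g : ℝ → Fin 2 → ℂ} {v : Fin 2 → ℂ} {b : ℝ}

lemma eq_add_integral_of_apply (hg : ∀ i, Integrable (fun t => g t i) (volume.restrict (Ioo 0 b)))
    (h : ∀ i, ∀ x ∈ Icc 0 b, f x i = v i + ∫ t in (0 : ℝ)..x, g t i) {x : ℝ} (hx : x ∈ Icc 0 b) :
    f x = v + ∫ t in (0 : ℝ)..x, g t := by
  ext i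
  have hi : ∀ i, Integrable (fun t => g t i) (volume.restrict (Ioc 0 x)) := fun i => by
    rw [← Measure.restrict_congr_set Ioo_ae_eq_Ioc]
    exact (hg i).mono_measure (Measure.restrict_mono (Ioo_subset_Ioo_right hx.2) le_rfl)
  rw [h i x hx, Pi.add_apply, intervalIntegral.integral_of_le hx.1,
    intervalIntegral.integral_of_le hx.1, eval_integral hi]

lemma intervalIntegrable_of_apply (hb : 0 ≤ b)
    (hg : ∀ i, Integrable (fun t => g t i) (volume.restrict (Ioo 0 b))) :
    IntervalIntegrable g volume 0 b :=
  (intervalIntegrable_iff_integrableOn_Ioo_of_le hb).2 (Integrable.of_eval hg)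

lemma absolutelyContinuousOnInterval_of_apply (hb : 0 ≤ b)
    (hg : ∀ i, Integrable (fun t => g t i) (volume.restrict (Ioo 0 b)))
    (h : ∀ i, ∀ x ∈ Icc 0 b, f x i = v i + ∫ t in (0 : ℝ)..x, g t i) :
    AbsolutelyContinuousOnInterval f 0 b := by
  refine absolutelyContinuousOnInterval_of_dist_le
    (absolutelyContinuousOnInterval_integral (intervalIntegrable_of_apply hb hg)) fun x hx y hy => ?_
  rw [uIcc_of_le hb] at hx hy
  rw [eq_add_integral_of_apply hg h hx, eq_add_integral_of_apply hg h hy, dist_add_left]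

lemma ae_hasDerivAt_of_apply (hb : 0 ≤ b)
    (hg : ∀ i, Integrable (fun t => g t i) (volume.restrict (Ioo 0 b)))
    (h : ∀ i, ∀ x ∈ Icc 0 b, f x i = v i + ∫ t in (0 : ℝ)..x, g t i) :
    ∀ᵐ x, x ∈ Ioo 0 b → HasDerivAt f (g x) x := by
  filter_upwards [(intervalIntegrable_of_apply hb hg).ae_hasDerivAt_integral] with x hx hxb
  have hxb' : x ∈ uIcc 0 b := by rw [uIcc_of_le hb]; exact Ioo_subset_Icc_self hxb
  refine ((hx hxb' 0 left_mem_uIcc).const_add v).congr_of_eventuallyEq ?_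
  filter_upwards [Ioo_mem_nhds hxb.1 hxb.2] with y hy
  exact eq_add_integral_of_apply hg h (Ioo_subset_Icc_self hy)

end VectorIntegral

/-! ### The value of the commutator on the diagonal -/

/-- The mean over `(x - h, x)` is the left difference quotient at `x` of `y ↦ ∫₀^{x+y} u + ∫₀^y g`.
The first primitive is differentiable by hypothesis at `2x`, the second from the left because `g` is
continuous up to `x`. -/
lemma tendsto_mean_of_ae_eq {f u g : ℝ → ℝ} {x r : ℝ} (hx : 0 < x) (hxr : 2 * x < r)
    (hu : IntervalIntegrable u volume 0 r)
    (hd : HasDerivAt (fun y => ∫ s in (0 : ℝ)..y, u s) (u (2 * x)) (2 * x))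
    (hg : ContinuousOn g (Icc 0 x))
    (hf : ∀ᵐ t ∂(volume.restrict (Ioo 0 x)), f t = u (x + t) + g t) :
    Tendsto (fun h : ℝ => h⁻¹ * ∫ t in (x - h)..x, f t) (𝓝[>] 0) (𝓝 (u (2 * x) + g x)) := by
  set H : ℝ → ℝ := fun y => (∫ s in (0 : ℝ)..(x + y), u s) + ∫ t in (0 : ℝ)..y, g t with hH
  have h1 : HasDerivAt (fun y => ∫ s in (0 : ℝ)..(x + y), u s) (u (2 * x)) x := by
    rw [two_mul] at hd ⊢
    exact hd.comp_const_add x x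
  have hgi : IntervalIntegrable g volume 0 x := by
    refine ContinuousOn.intervalIntegrable ?_
    rwa [uIcc_of_le hx.le]
  have h2 : HasDerivWithinAt (fun y => ∫ t in (0 : ℝ)..y, g t) (g x) (Iic x) x := by
    refine intervalIntegral.integral_hasDerivWithinAt_right (t := Iic x) hgi ?_ ?_
    · refine ⟨Icc 0 x, ?_, hg.aestronglyMeasurable measurableSet_Icc⟩
      exact Icc_mem_nhdsLE hx
    · exact (hg x ⟨hx.le, le_rfl⟩).mono_of_mem_nhdsWithin (Icc_mem_nhdsLE hx)
  have h3 : HasDerivWithinAt H (u (2 * x) + g x) (Iio x) x :=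
    (h1.hasDerivWithinAt.add h2).mono Iio_subset_Iic_self
  rw [hasDerivWithinAt_iff_tendsto_slope' self_notMem_Iio] at h3
  have h4 : Tendsto (fun h : ℝ => x - h) (𝓝[>] 0) (𝓝[<] x) := by
    refine tendsto_nhdsWithin_iff.2 ⟨?_, ?_⟩
    · have : Tendsto (fun h : ℝ => x - h) (𝓝 0) (𝓝 (x - 0)) :=
        (continuous_const.sub continuous_id).tendsto 0
      rw [sub_zero] at this
      exact this.mono_left nhdsWithin_le_nhds
    · filter_upwards [self_mem_nhdsWithin] with h hh
      exact sub_lt_self x hh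
  refine (h3.comp h4).congr' ?_
  filter_upwards [Ioo_mem_nhdsGT hx] with h hh
  have hxh : 0 ≤ x - h := by linarith [hh.2]
  have hux : ∀ y ∈ Icc 0 r, IntervalIntegrable u volume 0 y := fun y hy =>
    hu.mono_set (by rw [uIcc_of_le hy.1, uIcc_of_le (hy.1.trans hy.2)]; exact Icc_subset_Icc_right hy.2)
  have i1 := hux (x + x) ⟨by linarith, by linarith⟩
  have i2 := hux (x + (x - h)) ⟨by linarith, by linarith [hh.1]⟩
  have i3 : IntervalIntegrable g volume 0 (x - h) := hgi.mono_set (by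
    rw [uIcc_of_le hxh, uIcc_of_le hx.le]; exact Icc_subset_Icc_right (by linarith [hh.1]))
  have e1 : ∫ t in (x - h)..x, f t = ∫ t in (x - h)..x, (u (x + t) + g t) := by
    rw [intervalIntegral.integral_of_le (by linarith [hh.1]),
      intervalIntegral.integral_of_le (by linarith [hh.1]), integral_Ioc_eq_integral_Ioo,
      integral_Ioc_eq_integral_Ioo]
    exact integral_congr_ae (ae_restrict_of_ae_restrict_of_subset (Ioo_subset_Ioo_left hxh) hf)
  have i4 : IntervalIntegrable (fun t => u (x + t)) volume (x - h) x := by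
    have := (i2.symm.trans i1).comp_add_left x
    simpa using this
  rw [e1, intervalIntegral.integral_add i4 (i3.symm.trans hgi),
    intervalIntegral.integral_comp_add_left, Function.comp_apply, slope_def_field, hH,
    ← intervalIntegral.integral_interval_sub_left i1 i2,
    ← intervalIntegral.integral_interval_sub_left hgi i3]
  have hh0 : h ≠ 0 := hh.1.ne'
  simp only []
  rw [show x - h - x = -h by ring]
  field_simp
  ring

section Commutator

variable {lam alpha : ℤ → ℝ} {c d : ℝ → ℝ} {F K : ℝ → ℝ → Matrix (Fin 2) (Fin 2) ℝ} {x : ℝ}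

/-- A commutator with `B` is symmetric with trace zero, so two of its four entries decide. -/
lemma hasDiagonalCommutator_iff {p q : ℝ → ℝ} :
    HasDiagonalCommutator K x (potential p q x) ↔
      Tendsto (fun h : ℝ => h⁻¹ * ∫ t in (x - h)..x, -(K x t 0 1 + K x t 1 0)) (𝓝[>] 0) (𝓝 (p x))
      ∧ Tendsto (fun h : ℝ => h⁻¹ * ∫ t in (x - h)..x, (K x t 0 0 - K x t 1 1)) (𝓝[>] 0)
        (𝓝 (q x)) := by
  unfold HasDiagonalCommutator
  simp only [commutator_B, potential, Fin.forall_fin_two, Matrix.of_apply, Matrix.cons_val',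
    Matrix.cons_val_zero, Matrix.cons_val_one, Matrix.cons_val_fin_one]
  constructor
  · rintro ⟨⟨h1, h2⟩, -⟩
    exact ⟨h1, h2⟩
  · rintro ⟨h1, h2⟩
    refine ⟨⟨h1, h2⟩, h2, h1.neg.congr fun h => ?_⟩
    rw [intervalIntegral.integral_neg]
    ring

lemma intervalIntegrable_of_memLp_volTwoPi {f : ℝ → ℝ} (hf : MemLp f 2 volTwoPi) :
    IntervalIntegrable f volume 0 (2 * Real.pi) := by
  rw [intervalIntegrable_iff_integrableOn_Ioo_of_le (by linarith [Real.pi_pos])]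
  have h : IntegrableOn f (Ioo (-(2 * Real.pi)) (2 * Real.pi)) := hf.integrable (by norm_num)
  exact h.mono_set (Ioo_subset_Ioo_left (by linarith [Real.pi_pos]))

/-- Lebesgue differentiation at the point `2x`; the doubling map carries the exceptional null set
back to `(0, π)`. -/
lemma ae_hasDerivAt_two_mul {f : ℝ → ℝ} (hf : MemLp f 2 volTwoPi) :
    ∀ᵐ x ∂volPi, HasDerivAt (fun y => ∫ s in (0 : ℝ)..y, f s) (f (2 * x)) (2 * x) := by
  have h := (intervalIntegrable_of_memLp_volTwoPi hf).ae_hasDerivAt_integral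
  filter_upwards [ae_comp_two_mul (ae_restrict_of_ae h), ae_restrict_mem measurableSet_Ioo] with x h1 h2
  refine h1 ?_ 0 left_mem_uIcc
  rw [uIcc_of_le (by linarith [Real.pi_pos])]
  exact ⟨by linarith [h2.1], by linarith [h2.2]⟩

/-- Solving the main equation for `K`, the combinations `K₀₁ + K₁₀` and `K₀₀ - K₁₁` lose their terms
in `x - t`. What remains is a function of `x + t` plus one continuous in `t`, exactly the form
covered by `tendsto_mean_of_ae_eq`. -/
lemma SolvesMainEquation.hasDiagonalCommutator (hK : SolvesMainEquation F K x)
    (h : IsKernelPair lam alpha c d) (hF : IsMainKernel lam alpha F) (hx : x ∈ Ioo 0 Real.pi)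
    (hc : HasDerivAt (fun y => ∫ s in (0 : ℝ)..y, c s) (c (2 * x)) (2 * x))
    (hd : HasDerivAt (fun y => ∫ s in (0 : ℝ)..y, d s) (d (2 * x)) (2 * x)) :
    HasDiagonalCommutator K x (potential (limP c d K) (limQ c d K) x) := by
  have hx' : x ∈ Icc 0 Real.pi := Ioo_subset_Icc_self hx
  have hle : volume.restrict (Ioo 0 x) ≤ volPi :=
    Measure.restrict_mono (Ioo_subset_Ioo_right hx.2.le) le_rfl
  have hrow : ∀ i j, ∀ᵐ t ∂(volume.restrict (Ioo 0 x)),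
      K x t i j = -kernelMat c d x t i j - ⟪cutRow K x i, kernelRow c d t j⟫_ℝ := by
    intro i j
    filter_upwards [ae_mono hle (hK.ae_row h hF hx' i j), ae_restrict_mem measurableSet_Ioo]
      with t h1 h2
    linarith [h1 h2.2]
  have hcont : ∀ i j, ContinuousOn (fun t => ⟪cutRow K x i, kernelRow c d t j⟫_ℝ) (Icc 0 x) :=
    fun i j => (continuousOn_const.inner (h.continuousOn_kernelRow j)).mono
      (Icc_subset_Icc_right hx.2.le)
  have h2x : 2 * x < 2 * Real.pi := by linarith [hx.2]
  rw [hasDiagonalCommutator_iff]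
  constructor
  · refine tendsto_mean_of_ae_eq (u := fun s => -d s)
      (g := fun t => ⟪cutRow K x 0, kernelRow c d t 1⟫_ℝ + ⟪cutRow K x 1, kernelRow c d t 0⟫_ℝ)
      hx.1 h2x (intervalIntegrable_of_memLp_volTwoPi h.memLp_odd).neg ?_
      ((hcont 0 1).add (hcont 1 0)) ?_
    · simp only [intervalIntegral.integral_neg]
      exact hd.neg
    · filter_upwards [hrow 0 1, hrow 1 0] with t h1 h2
      rw [h1, h2]
      simp only [kernelMat, Matrix.of_apply, Matrix.cons_val', Matrix.cons_val_zero,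
        Matrix.cons_val_one, Matrix.cons_val_fin_one]
      ring
  · refine tendsto_mean_of_ae_eq (u := c)
      (g := fun t => ⟪cutRow K x 1, kernelRow c d t 1⟫_ℝ - ⟪cutRow K x 0, kernelRow c d t 0⟫_ℝ)
      hx.1 h2x (intervalIntegrable_of_memLp_volTwoPi h.memLp_even) hc
      ((hcont 1 1).sub (hcont 0 0)) ?_
    filter_upwards [hrow 0 0, hrow 1 1] with t h1 h2
    rw [h1, h2]
    simp only [kernelMat, Matrix.of_apply, Matrix.cons_val', Matrix.cons_val_zero,
      Matrix.cons_val_one, Matrix.cons_val_fin_one]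
    ring

end Commutator

/-! ### Exhaustion of the interval -/

lemma ae_restrict_Ioo_of_forall_lt {P : ℝ → Prop} {r : ℝ} (hr : 0 < r)
    (h : ∀ b ∈ Ioo 0 r, ∀ᵐ x, x ∈ Ioo 0 b → P x) : ∀ᵐ x ∂(volume.restrict (Ioo 0 r)), P x := by
  obtain ⟨u, -, hu, hlim⟩ := exists_seq_strictMono_tendsto' hr
  filter_upwards [ae_restrict_of_ae (ae_all_iff.2 fun n => h (u n) (hu n)),
    ae_restrict_mem measurableSet_Ioo] with x h1 h2
  obtain ⟨n, hn⟩ := (hlim.eventually (lt_mem_nhds h2.2)).exists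
  exact h1 n ⟨h2.1, hn⟩

end DiracInverse
end

/-! ### Assembly of the theorem. -/

theorem mainTheorem7 (lam alpha : ℤ → ℝ)
    (hlam : Summable fun n : ℤ => (lam n - n) ^ 2)
    (halpha : Summable fun n : ℤ => (alpha n - Real.pi) ^ 2)
    (hpos : ∀ n, 0 < alpha n) :
    (∃ F, DiracInverse.IsMainKernel lam alpha F) ∧
    ∀ F K : ℝ → ℝ → Matrix (Fin 2) (Fin 2) ℝ,
      DiracInverse.IsMainKernel lam alpha F →
      (∀ x ∈ Ioo 0 Real.pi, DiracInverse.SolvesMainEquation F K x) →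
      ∃ p q : ℝ → ℝ,
        (∀ b ∈ Ioo 0 Real.pi, MemLp p 2 (volume.restrict (Ioo 0 b)) ∧
          MemLp q 2 (volume.restrict (Ioo 0 b))) ∧
        (∀ᵐ x ∂(volume.restrict (Ioo 0 Real.pi)),
          DiracInverse.HasDiagonalCommutator K x (DiracInverse.potential p q x)) ∧
        (∀ z : ℂ,
          (∀ b ∈ Ioo 0 Real.pi,
            AbsolutelyContinuousOnInterval (fun x => DiracInverse.phi K x z) 0 b) ∧
          (∀ᵐ x ∂(volume.restrict (Ioo 0 Real.pi)),
            DifferentiableAt ℝ (fun s => DiracInverse.phi K s z) x ∧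
            Matrix.mulVec (DiracInverse.B ℂ) (deriv (fun s => DiracInverse.phi K s z) x)
              + Matrix.mulVec ((DiracInverse.potential p q x).map Complex.ofReal)
                  (DiracInverse.phi K x z)
              = z • DiracInverse.phi K x z) ∧
          DiracInverse.phi K 0 z 0 = 0 ∧ DiracInverse.phi K 0 z 1 = -1) ∧
        (Function.Injective lam → DiracInverse.SolvesMainEquation F K Real.pi →
          MemLp p 2 (volume.restrict (Ioo 0 Real.pi)) ∧
          MemLp q 2 (volume.restrict (Ioo 0 Real.pi)) ∧
          ∀ z : ℂ, AbsolutelyContinuousOnInterval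
            (fun x => DiracInverse.phi K x z) 0 Real.pi) := by
  obtain ⟨c, d, h⟩ := DiracInverse.exists_isKernelPair hlam halpha hpos
  refine ⟨⟨_, h.isMainKernel⟩, fun F K hF hK => ?_⟩
  have hpi := Real.pi_pos
  -- The point `x = 0`, absent from the hypothesis, is harmless because the equation is vacuous on
  -- an empty interval.
  have hKb : ∀ b ∈ Ioo 0 Real.pi, ∀ x ∈ Icc 0 b, DiracInverse.SolvesMainEquation F K x := by
    intro b hb x hx
    rcases hx.1.eq_or_lt with h0 | h0
    · rw [← h0]
      exact DiracInverse.solvesMainEquation_zero F K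
    · exact hK x ⟨h0, hx.2.trans_lt hb.2⟩
  choose δ hδ hco using fun b (hb : b ∈ Ioo 0 Real.pi) =>
    h.exists_coercive hlam halpha hpos (DiracInverse.completeFreq_of_lt hlam hb.2)
  have hint := fun b hb => DiracInverse.phi_eq_integral h hF (Ioo_subset_Icc_self hb) (hKb b hb)
    (hδ b hb) (hco b hb)
  -- The formulas for the potential do not involve `b`, so one pair serves all the intervals `(0,
  -- b)`, including `b = π`.
  refine ⟨DiracInverse.limP c d K, DiracInverse.limQ c d K, fun b hb => ?_, ?_, fun z => ⟨?_, ?_, ?_, ?_⟩,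
    fun hinj hKpi => ?_⟩
  · obtain ⟨hp, hq, -⟩ := DiracInverse.exists_approx_potential h hF (Ioo_subset_Icc_self hb)
      (hKb b hb) (hδ b hb) (hco b hb)
    exact ⟨hp, hq⟩
  · filter_upwards [DiracInverse.ae_hasDerivAt_two_mul h.memLp_even,
      DiracInverse.ae_hasDerivAt_two_mul h.memLp_odd, ae_restrict_mem measurableSet_Ioo]
      with x hc hd hx
    exact (hK x hx).hasDiagonalCommutator h hF hx hc hd
  · intro b hb
    exact DiracInverse.absolutelyContinuousOnInterval_of_apply hb.1.le
      (fun i => (hint b hb z i).1) fun i => (hint b hb z i).2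
  · refine DiracInverse.ae_restrict_Ioo_of_forall_lt hpi fun b hb => ?_
    filter_upwards [DiracInverse.ae_hasDerivAt_of_apply hb.1.le
      (fun i => (hint b hb z i).1) fun i => (hint b hb z i).2] with x hx hxb
    refine ⟨(hx hxb).differentiableAt, ?_⟩
    rw [(hx hxb).deriv]
    exact DiracInverse.B_mulVec_diracField _ _ x z _
  · simp [DiracInverse.phi, DiracInverse.freeSol]
  · simp [DiracInverse.phi, DiracInverse.freeSol]
  -- Distinct frequencies are complete on the whole interval, so the argument for `b < π` runs
  -- unchanged at `b = π`.
  · obtain ⟨δ, hδ, hco⟩ := h.exists_coercive hlam halpha hpos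
      (DiracInverse.completeFreq_pi hlam hinj)
    have hKpi' : ∀ x ∈ Icc 0 Real.pi, DiracInverse.SolvesMainEquation F K x := by
      intro x hx
      rcases hx.2.eq_or_lt with h0 | h0
      · rwa [h0]
      · exact hKb ((x + Real.pi) / 2) ⟨by linarith [hx.1], by linarith⟩ x ⟨hx.1, by linarith⟩
    have hpim : Real.pi ∈ Icc 0 Real.pi := ⟨hpi.le, le_rfl⟩
    obtain ⟨hp, hq, -⟩ := DiracInverse.exists_approx_potential h hF hpim hKpi' hδ hco
    refine ⟨hp, hq, fun z => ?_⟩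
    have hi := fun i => DiracInverse.phi_eq_integral h hF hpim hKpi' hδ hco z i
    exact DiracInverse.absolutelyContinuousOnInterval_of_apply hpi.le
      (fun i => (hi i).1) fun i => (hi i).2
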